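/- **Setting.** Let $\mu>0$. A particle lives an exponentially distributed time with parameter $\mu$ and at the end of its life produces a random number of new particles with probability generating function (p.g.f.) $f$; all particles evolve independently. Let $Z(t)$ be the number of particles alive at time $t$ starting from one particle born at time $0$ (a Markov branching process), and put $F(t;s)=\mathbf E[s^{Z(t)}]$. Let $0<S_1<S_2<\cdots$ be the jump points of a non-homogeneous Poisson process $\nu(t)$ with local intensity $r(t)\ge 0$ and finite mean measure $R(t)=\int_0^t r(u)\,du$; let $I_1,I_2,\dots$ be i.i.d. non-negative integer valued random variables with p.g.f. $g$; let $Z^{(k,j)}$ be i.i.d. copies of $Z$; and let $(S_k)$, $(I_k)$ and $(Z^{(k,j)})$ be independent. The branching process with immigration is $$Y(t)=\sum_{k=1}^{\nu(t)}\sum_{j=1}^{I_k}Z^{(k,j)}(t-S_k),\qquad t\ge 0.$$ Assume that $r(t)=t^{-\theta}L_R(t)$ for $t>0$, $f(s)=s+(1-s)^{1+\gamma}L\!\left(\frac1{1-s}\right)$ and $g(s)=1-(1-s)^{\alpha}\,l\!\left(\frac1{1-s}\right)$ for $s\in[0,1)$, where $\gamma,\alpha\in(0,1]$ and $L_R,L,l$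 are slowly varying at infinity. Let $q(t)=1-g(F(t;0))$, $V(x)=\int_0^{1-1/x}\frac{du}{f(u)-u}$ for $x\ge1$, let $W$ be the inverse function of $V$, let $\Psi(x)=1/[1-g(1-1/x)]$ for $x\ge 1$ and let $\overleftarrow{\Psi}$ be the inverse function of $\Psi$. Let $B$ denote Euler's beta function. **Theorem 5.5.** Suppose in addition that $0<\theta<1$ and $0<\alpha/\gamma<1$. (i) If $t\,r(t)\,q(t)\to0$ as $t\to\infty$, then for every $x\ge0$ $$\mathbf P\{Y(t)/W(\mu t)\le x\mid Y(t)>0\}\to D_1(\theta,\alpha,\gamma;x),\qquad t\to\infty,$$ where $D_1$ is the distribution function of a probability law on $[0,\infty)$ with Laplace transform $$\hat D_1(\lambda)=1-\frac{\lambda^\alpha}{B(1-\theta,1-\frac{\alpha}{\gamma})}\int_0^1(1-u)^{-\theta}(u\lambda^\gamma+1)^{-\alpha/\gamma}\,du,\qquad\lambda>0.$$ (ii) If $t\,r(t)\,q(t)\to K\in(0,\infty)$, then for every $x\ge0$ $$\mathbf P\{Y(t)/W(\mu t)\le x\mid Y(t)>0\}\to D_2(x),\qquad t\to\infty,$$ where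 $D_2$ is the distribution function of a probability law on $[0,\infty)$ with Laplace transform $$\hat D_2(\lambda)=1-\frac{1-\exp\left(-K\lambda^\alpha\int_0^1(1-u)^{-\theta}(u\lambda^\gamma+1)^{-(1-\theta)}\,du\right)}{1-\exp\left(-K\,B(\theta,1-\theta)\right)},\qquad\lambda>0.$$ (iii) If $t\,r(t)\,q(t)\to\infty$, then for every $x\ge0$ $$\mathbf P\{Y(t)/\overleftarrow{\Psi}(R(t))\le x\}\to D_3(\alpha;x),\qquad t\to\infty,$$ where $D_3$ is the distribution function of a probability law on $[0,\infty)$ with Laplace transform $\hat D_3(\lambda)=e^{-\lambda^\alpha}$, $\lambda>0$. -/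

import Mathlib

open MeasureTheory ProbabilityTheory Filter Topology Set

noncomputable section

/-- `L` is slowly varying at infinity: on some half-line it is positive and (Borel) measurable,
and `L (c x) / L x → 1` as `x → ∞` for every `c > 0`. -/
def SlowlyVarying (L : ℝ → ℝ) : Prop :=
  (∃ a : ℝ, (∀ x, a ≤ x → 0 < L x) ∧ Measurable ((Ici a).domRestrict L)) ∧
    ∀ c : ℝ, 0 < c → Tendsto (fun x => L (c * x) / L x) atTop (𝓝 1)

/-- The probability generating function of a law on `ℕ`. -/
def pgf (p : PMF ℕ) (s : ℝ) : ℝ := ∑' n : ℕ, (p n).toReal * s ^ n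

/-- Particles descending from one ancestor born at time `0` are labelled by finite words:
`[]` is the ancestor, and `i :: v` is the particle `v` of the family tree founded by the
`i`-th child of the ancestor (`i = 0, 1, 2, …`).  Given lifetimes `τ` and offspring numbers `ξ`
of all labels, `Alive τ ξ u t` says that particle `u` gets born and is alive at time `t`
(a particle is alive from its birth, included, to its death, excluded). -/
def Alive (τ : List ℕ → ℝ) (ξ : List ℕ → ℕ) : List ℕ → ℝ → Prop
  | [], t => 0 ≤ t ∧ t < τ []
  | i :: v, t =>
      i < ξ [] ∧ τ [] ≤ t ∧ Alive (fun w => τ (i :: w)) (fun w => ξ (i :: w)) v (t - τ [])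

/-- Number of particles alive at time `t` in the family tree of one ancestor born at time `0`. -/
def population (τ : List ℕ → ℝ) (ξ : List ℕ → ℕ) (t : ℝ) : ℕ :=
  {u : List ℕ | Alive τ ξ u t}.ncard

/-- The number of points of the sequence `S` in the interval `(a, b]`. -/
def pointCount (S : ℕ → ℝ) (a b : ℝ) : ℕ := {k : ℕ | a < S k ∧ S k ≤ b}.ncard

/-- `S 0 < S 1 < S 2 < …` are the jump points of a Poisson process on `(0, ∞)` with local
intensity `r`: the numbers of points in disjoint intervals are independent, and the number
of points in `(a, b]` is Poisson distributed with mean `∫_a^b r`. -/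
structure IsPoissonProcess {Ω : Type*} [MeasurableSpace Ω] (P : Measure Ω) (r : ℝ → ℝ)
    (S : ℕ → Ω → ℝ) : Prop where
  measurable : ∀ k, Measurable (S k)
  pos : ∀ᵐ ω ∂P, 0 < S 0 ω
  strictMono : ∀ᵐ ω ∂P, StrictMono fun k => S k ω
  tendsto : ∀ᵐ ω ∂P, Tendsto (fun k => S k ω) atTop atTop
  law : ∀ a b : ℝ, 0 ≤ a → a ≤ b →
    P.map (fun ω => pointCount (fun k => S k ω) a b) =
      poissonMeasure (Real.toNNReal (∫ u in a..b, r u))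
  indep : ∀ (m : ℕ) (t : Fin (m + 1) → ℝ), Monotone t → 0 ≤ t 0 →
    iIndepFun (fun (i : Fin m) ω => pointCount (fun k => S k ω) (t i.castSucc) (t i.succ)) P

/-- The random ingredients of a Markov branching process with non-homogeneous Poisson
immigration: immigration times `S k` with intensity `r`, sizes `I k` of the immigrating groups
(i.i.d. with law `b`), and for the `j`-th member of the `k`-th group a family tree whose
particles `u` have lifetimes `τ (k, j, u)` (exponential with parameter `μ`) and offspring
numbers `ξ (k, j, u)` (with law `p`).  All of these are independent. -/
structure ImmigrationModel {Ω : Type*} [MeasurableSpace Ω] (P : Measure Ω) (μ : ℝ)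
    (p b : PMF ℕ) (r : ℝ → ℝ) where
  S : ℕ → Ω → ℝ
  I : ℕ → Ω → ℕ
  τ : ℕ × ℕ × List ℕ → Ω → ℝ
  ξ : ℕ × ℕ × List ℕ → Ω → ℕ
  poisson_S : IsPoissonProcess P r S
  measurable_I : ∀ k, Measurable (I k)
  measurable_τ : ∀ i, Measurable (τ i)
  measurable_ξ : ∀ i, Measurable (ξ i)
  law_I : ∀ k, P.map (I k) = b.toMeasure
  law_τ : ∀ i, P.map (τ i) = expMeasure μ
  law_ξ : ∀ i, P.map (ξ i) = p.toMeasure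
  iIndepFun_I : iIndepFun I P
  iIndepFun_τ : iIndepFun τ P
  iIndepFun_ξ : iIndepFun ξ P
  indepFun_S : IndepFun (fun ω k => S k ω)
    (fun ω => ((fun k => I k ω), (fun i => τ i ω), (fun i => ξ i ω))) P
  indepFun_I : IndepFun (fun ω k => I k ω) (fun ω => ((fun i => τ i ω), (fun i => ξ i ω))) P
  indepFun_τ : IndepFun (fun ω i => τ i ω) (fun ω i => ξ i ω) P

namespace ImmigrationModel

variable {Ω : Type*} [MeasurableSpace Ω] {P : Measure Ω} {μ : ℝ} {p b : PMF ℕ} {r : ℝ → ℝ}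

/-- `Z^{(k,j)}(t)`: the Markov branching process founded by the `j`-th member of the `k`-th
immigrating group; `t` is the time since immigration. -/
def Z (M : ImmigrationModel P μ p b r) (k j : ℕ) (t : ℝ) (ω : Ω) : ℕ :=
  population (fun u => M.τ (k, j, u) ω) (fun u => M.ξ (k, j, u) ω) t

/-- The Poisson process `ν(t)`: the number of immigration times up to time `t`. -/
def ν (M : ImmigrationModel P μ p b r) (t : ℝ) (ω : Ω) : ℕ :=
  pointCount (fun k => M.S k ω) 0 t

/-- `Y(t) = ∑_{k ≤ ν(t)} ∑_{j ≤ I_k} Z^{(k,j)}(t - S_k)` (indices start at `0` here). -/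
def Y (M : ImmigrationModel P μ p b r) (t : ℝ) (ω : Ω) : ℕ :=
  ∑ k ∈ Finset.range (M.ν t ω), ∑ j ∈ Finset.range (M.I k ω), M.Z k j (t - M.S k ω) ω

/-- `F(t;s) = E[s^{Z(t)} | Z(0) = 1]`; all `Z^{(k,j)}` have the same law. -/
def F (M : ImmigrationModel P μ p b r) (t s : ℝ) : ℝ := ∫ ω, s ^ M.Z 0 0 t ω ∂P

/-- `q(t) = 1 - g(F(t;0))`, with `g` the generating function of the immigrants. -/
def q (M : ImmigrationModel P μ p b r) (t : ℝ) : ℝ := 1 - pgf b (M.F t 0)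

end ImmigrationModel

/-- `V(x) = ∫_0^{1-1/x} du / (f(u) - u)`, `x ≥ 1`, with `f` the offspring generating function. -/
def V (p : PMF ℕ) (x : ℝ) : ℝ := ∫ u in (0 : ℝ)..(1 - 1 / x), 1 / (pgf p u - u)

/-- The inverse function `W` of the increasing function `V` on `[1, ∞)`. -/
def W (p : PMF ℕ) (y : ℝ) : ℝ := sInf {x : ℝ | 1 ≤ x ∧ y ≤ V p x}

/-- `Ψ(x) = 1 / (1 - g(1 - 1/x))`, `x ≥ 1`, with `g` the generating function of the immigrants. -/
def Psi (b : PMF ℕ) (x : ℝ) : ℝ := 1 / (1 - pgf b (1 - 1 / x))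

/-- The inverse function of the non-decreasing function `Ψ` on `[1, ∞)`. -/
def PsiInv (b : PMF ℕ) (y : ℝ) : ℝ := sInf {x : ℝ | 1 ≤ x ∧ y ≤ Psi b x}

/-- `D` is a probability law on `[0, ∞)` with Laplace transform `φ` on `(0, ∞)`. -/
def HasLaplaceTransform (D : Measure ℝ) (φ : ℝ → ℝ) : Prop :=
  IsProbabilityMeasure D ∧ D (Iio 0) = 0 ∧
    ∀ lam : ℝ, 0 < lam → ∫ x, Real.exp (-lam * x) ∂D = φ lam

end

/-! Everything passes through generating functions. Given the immigration times the groups are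
independent, so the Laplace functional of the Poisson process gives E s^{Y(t)} = exp(-∫₀ᵗ r(u)(1 -
g(F(t-u;s))) du) (`ImmigrationModel.integral_pow_Y`). The branching part is solved exactly: ∂F/∂t =
μ(f(F) - F), and V is the primitive that linearises this equation, V(1/(1-F(t;s))) = μt + V(1/(1-s))
(`V_treeGF`). In particular W(μt) = 1/(1-F(t;0)).

V and Ψ are monotone and regularly varying with indices γ and α. For s = exp(-λ/W(μt)) the exact
solution therefore yields (1-g(F(tw;s)))/q(t) → λ^α (wλ^γ+1)^{-α/γ}
(`RegularReproduction.tendsto_pgf_ratio`), and q varies regularly with index -α/γ > -1. An Abelian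
theorem for convolutions, `tendsto_convolution`, with Potter's bounds as domination, turns this into
a limit of the exponent divided by t r(t) q(t): λ^α ∫₀¹ (1-u)^{-θ}(uλ^γ+1)^{-α/γ} du, and B(1-θ,
1-α/γ) when s = 0.

The regimes differ in the size of t r(t) q(t). If it vanishes, both exponents vanish and the
conditional transform 1 - (1-E s^Y)/(1-P(Y=0)) is governed by their ratio. If it tends to K, both
exponents converge, and regular variation forces α/γ = 1-θ. If it diverges, a surviving population
is so large at the scale given by R(t) that the age of a group no longer matters: the exponent is
squeezed between the values for ages t and 0, and both tend to λ^α.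

The continuity theorem (`exists_laplace_limit`) gives convergence at points that carry no mass, so
each limit must be shown to be atomless. The first law is that of U^{1/γ}X with U beta distributed
and X the conditional limit of a single group; the second is the compound Poisson law built on the
first, conditioned to have at least one summand; the third is stable, and its self-similarity
excludes atoms (`HasLaplaceTransform.stable_noAtoms`). -/

/-! ### Slowly varying functions -/

/-- The sets `A n` increase to [0, 2], so their measures tend to 2. The threshold 3/2 is chosen so
that two such sets, one of them shifted by at most 1, cannot be disjoint inside [0, 3]. -/
theorem exists_measure_forall_small {h : ℝ → ℝ}
    (hlim : ∀ u, Tendsto (fun x => h (x + u) - h x) atTop (𝓝 0)) {ε : ℝ} (hε : 0 < ε)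
    {y : ℕ → ℝ} (hy : Tendsto y atTop atTop) :
    ∃ n, 3 / 2 < volume {v : ℝ | v ∈ Icc (0 : ℝ) 2 ∧ ∀ m ≥ n, |h (y m + v) - h (y m)| ≤ ε} := by
  set A : ℕ → Set ℝ := fun n =>
    {v : ℝ | v ∈ Icc (0 : ℝ) 2 ∧ ∀ m ≥ n, |h (y m + v) - h (y m)| ≤ ε}
  have hmono : Monotone A := fun i j hij v hv => ⟨hv.1, fun m hm => hv.2 m (hij.trans hm)⟩
  have hU : ⋃ n, A n = Icc (0 : ℝ) 2 := by
    ext v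
    simp only [mem_iUnion]
    constructor
    · rintro ⟨n, hn⟩
      exact hn.1
    · intro hv
      have := ((hlim v).comp hy).eventually (Metric.closedBall_mem_nhds (0 : ℝ) hε)
      obtain ⟨n, hn⟩ := eventually_atTop.1 this
      refine ⟨n, hv, fun m hm => ?_⟩
      simpa [Metric.mem_closedBall, Real.dist_eq] using hn m hm
  have ht := tendsto_measure_iUnion_atTop (μ := volume) hmono
  rw [hU, Real.volume_Icc] at ht
  have h2 : (3 / 2 : ENNReal) < ENNReal.ofReal (2 - 0) := by
    rw [show (3 / 2 : ENNReal) = ENNReal.ofReal (3 / 2) by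
      rw [ENNReal.ofReal_div_of_pos (by norm_num)]; norm_num]
    exact (ENNReal.ofReal_lt_ofReal_iff (by norm_num)).2 (by norm_num)
  exact (ht.eventually (lt_mem_nhds h2)).exists

/-- A measurable additively slowly varying function varies slowly uniformly on `[0, 1]`. -/
theorem uniform_of_additive_slow {h : ℝ → ℝ} (hm : Measurable h)
    (hlim : ∀ u, Tendsto (fun x => h (x + u) - h x) atTop (𝓝 0)) {ε : ℝ} (hε : 0 < ε) :
    ∃ X, ∀ x ≥ X, ∀ u ∈ Icc (0 : ℝ) 1, |h (x + u) - h x| ≤ ε := by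
  by_contra! hcon
  choose x hx u hu hxu using fun n : ℕ => hcon n
  have hx' : Tendsto x atTop atTop := tendsto_atTop_mono hx tendsto_natCast_atTop_atTop
  have hxu' : Tendsto (fun n => x n + u n) atTop atTop :=
    tendsto_atTop_mono (fun n => le_add_of_nonneg_right (hu n).1) hx'
  obtain ⟨n₁, h₁⟩ := exists_measure_forall_small hlim (half_pos hε) hx'
  obtain ⟨n₂, h₂⟩ := exists_measure_forall_small hlim (half_pos hε) hxu'
  set A := {v : ℝ | v ∈ Icc (0 : ℝ) 2 ∧ ∀ m ≥ n₁, |h (x m + v) - h (x m)| ≤ ε / 2}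
  set B := {v : ℝ | v ∈ Icc (0 : ℝ) 2 ∧
    ∀ m ≥ n₂, |h (x m + u m + v) - h (x m + u m)| ≤ ε / 2}
  have hB : MeasurableSet B := by
    have : B = Icc (0 : ℝ) 2 ∩ ⋂ m ≥ n₂, {v | |h (x m + u m + v) - h (x m + u m)| ≤ ε / 2} := by
      ext v; simp [B]
    rw [this]
    refine measurableSet_Icc.inter (MeasurableSet.iInter fun m => MeasurableSet.iInter fun _ => ?_)
    exact measurableSet_le (by fun_prop) measurable_const
  set N := max n₁ n₂
  -- Both sets lie in [0, 3] and have measure above 3/2, so they meet. A common point v gives a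
  -- value h(x_N + v) within ε/2 of both h(x_N) and h(x_N + u_N).
  have hint : (A ∩ ((fun v => v + u N) '' B)).Nonempty := by
    by_contra hemp
    rw [not_nonempty_iff_eq_empty, ← disjoint_iff_inter_eq_empty] at hemp
    have hBm : MeasurableSet ((fun v => v + u N) '' B) :=
      (MeasurableEquiv.addRight (u N)).measurableSet_image.2 hB
    have hsub : A ∪ ((fun v => v + u N) '' B) ⊆ Icc 0 3 := by
      rintro v (hv | ⟨w, hw, rfl⟩)
      · exact ⟨hv.1.1, hv.1.2.trans (by norm_num)⟩
      · have h1 := hw.1.1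
        have h2 := hw.1.2
        have h3 := (hu N).1
        have h4 := (hu N).2
        exact ⟨by simp; linarith, by simp; linarith⟩
    have h3 := measure_mono (μ := volume) hsub
    rw [measure_union hemp hBm, Real.volume_Icc] at h3
    have hBv : volume ((fun v => v + u N) '' B) = volume B := by
      rw [image_add_right, measure_preimage_add_right]
    rw [hBv] at h3
    have h4 := ENNReal.add_lt_add h₁ h₂
    have h5 : (3 / 2 + 3 / 2 : ENNReal) = ENNReal.ofReal (3 - 0) := by
      rw [ENNReal.div_add_div_same, show (3 + 3 : ENNReal) = 3 * 2 by norm_num,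
        ENNReal.mul_div_cancel_right (by norm_num) (by norm_num)]
      norm_num
    rw [h5] at h4
    exact absurd h3 (not_le.2 h4)
  obtain ⟨v, hvA, w, hwB, rfl⟩ := hint
  have h1 := hvA.2 N (le_max_left _ _)
  have h2 := hwB.2 N (le_max_right _ _)
  have h3 := hxu N
  simp only at h1
  rw [show x N + (w + u N) = x N + u N + w by ring] at h1
  rw [abs_le] at h1 h2
  rcases lt_abs.1 h3 with h3 | h3 <;> linarith [h1.1, h1.2, h2.1, h2.2]

/-- Logarithms turn multiplicative into additive slow variation. As L is controlled only on a
half-line, it is replaced by 1 elsewhere to obtain a function measurable on all of ℝ. -/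
theorem SlowlyVarying.additive {L : ℝ → ℝ} (hL : SlowlyVarying L) :
    ∃ h : ℝ → ℝ, Measurable h ∧ (∀ u, Tendsto (fun x => h (x + u) - h x) atTop (𝓝 0)) ∧
      ∃ X, ∀ x ≥ X, 0 < L (Real.exp x) ∧ h x = Real.log (L (Real.exp x)) := by
  obtain ⟨⟨a, hpos, hmeas⟩, hlim⟩ := hL
  classical
  set L' : ℝ → ℝ := fun x => if x ∈ Ici a then L x else 1
  have hL' : Measurable L' := by
    refine measurable_of_restrict_of_restrict_compl (s := Ici a) measurableSet_Ici ?_ ?_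
    · convert hmeas using 1
      ext ⟨x, hx⟩
      simp only [L', domRestrict_apply, if_pos hx]
    · have : (Ici a)ᶜ.domRestrict L' = fun _ => 1 := by
        ext ⟨x, hx⟩
        simp only [L', domRestrict_apply, if_neg hx]
      rw [this]
      exact measurable_const
  have hev : ∀ᶠ x in atTop, a ≤ Real.exp x := Real.tendsto_exp_atTop.eventually_ge_atTop a
  refine ⟨fun x => Real.log (L' (Real.exp x)), by fun_prop, fun u => ?_, ?_⟩
  · have h1 := ((hlim (Real.exp u) (Real.exp_pos u)).comp Real.tendsto_exp_atTop).log one_ne_zero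
    rw [Real.log_one] at h1
    refine h1.congr' ?_
    filter_upwards [hev, (tendsto_atTop_add_const_right _ u tendsto_id).eventually hev] with x hx hxu
    simp only [id] at hxu
    have e1 : L' (Real.exp x) = L (Real.exp x) := if_pos hx
    have e2 : L' (Real.exp (x + u)) = L (Real.exp (x + u)) := if_pos hxu
    rw [e1, e2, Function.comp_apply, ← Real.exp_add, add_comm u x,
      Real.log_div (hpos _ hxu).ne' (hpos _ hx).ne']
  · obtain ⟨X, hX⟩ := eventually_atTop.1 hev
    refine ⟨X, fun x hx => ⟨hpos _ (hX x hx), ?_⟩⟩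
    have e1 : L' (Real.exp x) = L (Real.exp x) := if_pos (hX x hx)
    simp only [e1]

/-- Potter's bounds. -/
theorem SlowlyVarying.potter {L : ℝ → ℝ} (hL : SlowlyVarying L) {ε : ℝ} (hε : 0 < ε) :
    ∃ T, 1 ≤ T ∧ ∀ x y, T ≤ x → x ≤ y →
      0 < L x ∧ L y ≤ 2 * (y / x) ^ ε * L x ∧ L x ≤ 2 * (y / x) ^ ε * L y := by
  obtain ⟨h, hm, hlim, X₀, hX₀⟩ := hL.additive
  have hl2 : 0 < Real.log 2 := Real.log_pos one_lt_two
  obtain ⟨X₁, hX₁⟩ := uniform_of_additive_slow hm hlim (lt_min hε hl2)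
  -- An increment of at most δ per unit step costs the slope ε over the integer part, and at most
  -- log 2 over the fractional rest; the latter becomes the factor 2.
  set δ := min ε (Real.log 2)
  have hnat : ∀ n : ℕ, ∀ x ≥ X₁, |h (x + n) - h x| ≤ n * δ := by
    intro n
    induction n with
    | zero => intro x hx; simp
    | succ n ih =>
      intro x hx
      have h1 := ih x hx
      have h2 := hX₁ (x + n) (by have := Nat.cast_nonneg (α := ℝ) n; linarith) 1 (by simp)
      push_cast
      rw [← add_assoc]
      calc |h (x + n + 1) - h x| = |(h (x + n + 1) - h (x + n)) + (h (x + n) - h x)| := by ring_nf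
        _ ≤ _ := (abs_add_le _ _).trans (by linarith)
  have hgen : ∀ x ≥ X₁, ∀ y ≥ 0, |h (x + y) - h x| ≤ y * ε + Real.log 2 := by
    intro x hx y hy
    have hn := Nat.floor_le hy
    have hn' := Nat.lt_floor_add_one y
    set n := ⌊y⌋₊
    have h1 := hnat n x hx
    have h2 := hX₁ (x + n) (by have := Nat.cast_nonneg (α := ℝ) n; linarith) (y - n)
      ⟨by linarith, by linarith⟩
    rw [show x + n + (y - n) = x + y by ring] at h2
    have h3 : (n : ℝ) * δ ≤ y * ε :=
      mul_le_mul hn (min_le_left _ _) (le_min hε.le hl2.le) hy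
    have h4 : δ ≤ Real.log 2 := min_le_right _ _
    calc |h (x + y) - h x| = |(h (x + y) - h (x + n)) + (h (x + n) - h x)| := by ring_nf
      _ ≤ _ := (abs_add_le _ _).trans (by linarith)
  set X := max X₀ X₁
  refine ⟨max 1 (Real.exp X), le_max_left _ _, fun x y hx hxy => ?_⟩
  have hx0 : 0 < x := lt_of_lt_of_le one_pos ((le_max_left _ _).trans hx)
  have hy0 : 0 < y := hx0.trans_le hxy
  have hlx : X ≤ Real.log x := (Real.le_log_iff_exp_le hx0).2 ((le_max_right _ _).trans hx)
  have hly : X ≤ Real.log y := hlx.trans (Real.log_le_log hx0 hxy)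
  obtain ⟨px, ex⟩ := hX₀ _ ((le_max_left _ _).trans hlx)
  obtain ⟨py, ey⟩ := hX₀ _ ((le_max_left _ _).trans hly)
  rw [Real.exp_log hx0] at px ex
  rw [Real.exp_log hy0] at py ey
  have hd : 0 ≤ Real.log (y / x) := Real.log_nonneg ((one_le_div hx0).2 hxy)
  have key := hgen _ ((le_max_right _ _).trans hlx) _ hd
  rw [Real.log_div hy0.ne' hx0.ne', add_sub_cancel, ey, ex, abs_le] at key
  have hrp : Real.log (2 * (y / x) ^ ε) = Real.log 2 + ε * (Real.log y - Real.log x) := by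
    rw [Real.log_mul two_ne_zero (by positivity), Real.log_rpow (by positivity),
      Real.log_div hy0.ne' hx0.ne']
  have hc : (0 : ℝ) < 2 * (y / x) ^ ε := by positivity
  refine ⟨px, ?_, ?_⟩
  · rw [← Real.log_le_log_iff py (by positivity), Real.log_mul hc.ne' px.ne', hrp]
    linarith [key.2]
  · rw [← Real.log_le_log_iff px (by positivity), Real.log_mul hc.ne' py.ne', hrp]
    linarith [key.1]

/-! ### Regular variation of monotone functions -/

/-- `h` is regularly varying at infinity with index `ρ`. -/
def RegVar (ρ : ℝ) (h : ℝ → ℝ) : Prop :=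
  ∀ c : ℝ, 0 < c → Tendsto (fun x => h (c * x) / h x) atTop (𝓝 (c ^ ρ))

theorem tendsto_of_forall_lt_mul {ι : Type*} {l : Filter ι} {f : ι → ℝ} {c : ℝ} (hc : 0 < c)
    (hu : ∀ δ > 1, ∀ᶠ i in l, f i ≤ c * δ) (hl : ∀ δ > 1, ∀ᶠ i in l, c / δ ≤ f i) :
    Tendsto f l (𝓝 c) := by
  rw [tendsto_order]
  constructor
  · intro a ha
    rcases le_or_gt a 0 with ha0 | ha0
    · filter_upwards [hl 2 one_lt_two] with i hi
      exact ha0.trans_lt ((by positivity : (0:ℝ) < c / 2).trans_le hi)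
    · obtain ⟨b, hab, hbc⟩ := exists_between ha
      have hb : 0 < b := ha0.trans hab
      filter_upwards [hl (c / b) ((one_lt_div hb).2 hbc)] with i hi
      rw [div_div_cancel₀ hc.ne'] at hi
      exact hab.trans_le hi
  · intro a ha
    obtain ⟨b, hcb, hba⟩ := exists_between ha
    filter_upwards [hu (b / c) ((one_lt_div hc).2 hcb)] with i hi
    rw [mul_div_cancel₀ _ hc.ne'] at hi
    exact hi.trans_lt hba

section Monotone

variable {h : ℝ → ℝ} {ρ : ℝ} {ι : Type*} {l : Filter ι} {x y : ι → ℝ} {c : ℝ}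

theorem RegVar.comp_ratio (hrv : RegVar ρ h) (hc : 0 < c) (hx : Tendsto x l atTop) :
    Tendsto (fun i => h (c * x i) / h (x i)) l (𝓝 (c ^ ρ)) :=
  (hrv c hc).comp hx

/-- Monotonicity replaces uniform convergence: y is trapped between multiples b·x with b close to c,
and b ↦ b^ρ is continuous at c. -/
theorem RegVar.tendsto_ratio (hrv : RegVar ρ h) (hmono : MonotoneOn h (Ici 1))
    (hpos : ∀ᶠ x in atTop, 0 < h x) (hc : 0 < c) (hx : Tendsto x l atTop)
    (hxy : Tendsto (fun i => y i / x i) l (𝓝 c)) :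
    Tendsto (fun i => h (y i) / h (x i)) l (𝓝 (c ^ ρ)) := by
  have hpx := hx.eventually hpos
  have hx0 := hx.eventually_gt_atTop 0
  have hlow : ∀ b, 0 < b → b < c → ∀ᶠ i in l, h (b * x i) / h (x i) ≤ h (y i) / h (x i) := by
    intro b hb hbc
    filter_upwards [hpx, hx0, hxy.eventually (lt_mem_nhds hbc),
      (hx.const_mul_atTop hb).eventually_ge_atTop 1] with i h1 h2 h3 h4
    rw [lt_div_iff₀ h2] at h3
    exact div_le_div_of_nonneg_right (hmono h4 (h4.trans h3.le) h3.le) h1.le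
  have hupp : ∀ b, c < b → ∀ᶠ i in l, h (y i) / h (x i) ≤ h (b * x i) / h (x i) := by
    intro b hbc
    filter_upwards [hpx, hx0, hxy.eventually (gt_mem_nhds hbc),
      hxy.eventually (lt_mem_nhds (half_lt_self hc)),
      (hx.const_mul_atTop (half_pos hc)).eventually_ge_atTop 1] with i h1 h2 h3 h4 h5
    rw [div_lt_iff₀ h2] at h3
    rw [lt_div_iff₀ h2] at h4
    exact div_le_div_of_nonneg_right (hmono (h5.trans h4.le) (h5.trans (h4.trans h3).le) h3.le) h1.le
  have hcont : ContinuousAt (fun b : ℝ => b ^ ρ) c :=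
    Real.continuousAt_rpow_const _ _ (Or.inl hc.ne')
  rw [tendsto_order]
  constructor
  · intro a ha
    have h1 : ∀ᶠ b in 𝓝[<] c, a < b ^ ρ :=
      (hcont.eventually (lt_mem_nhds ha)).filter_mono nhdsWithin_le_nhds
    have h2 : ∀ᶠ b in 𝓝[<] c, 0 < b := (lt_mem_nhds hc).filter_mono nhdsWithin_le_nhds
    obtain ⟨b, hb, hb0, hbc⟩ := (h1.and (h2.and self_mem_nhdsWithin)).exists
    filter_upwards [hlow b hb0 hbc, (hrv.comp_ratio hb0 hx).eventually (lt_mem_nhds hb)]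
      with i h1 h2
    exact h2.trans_le h1
  · intro a ha
    have h1 : ∀ᶠ b in 𝓝[>] c, b ^ ρ < a :=
      (hcont.eventually (gt_mem_nhds ha)).filter_mono nhdsWithin_le_nhds
    obtain ⟨b, hb, hbc⟩ := (h1.and self_mem_nhdsWithin).exists
    filter_upwards [hupp b hbc, (hrv.comp_ratio (hc.trans hbc) hx).eventually (gt_mem_nhds hb)]
      with i h1 h2
    exact h1.trans_lt h2

theorem lt_of_ratio_lt (hmono : MonotoneOn h (Ici 1)) {a b v : ℝ} (hv : 0 < v) (ha : 1 ≤ a)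
    (hab : h b / v < h a / v) : b < a := by
  by_contra! hcon
  exact absurd hab (not_lt.2 (div_le_div_of_nonneg_right (hmono ha (ha.trans hcon) hcon) hv.le))

/-- This does the work of regular variation of an inverse function. For ρ > 0 the limits at cδ and
c/δ lie strictly on either side of c^ρ, and monotonicity of h carries the comparison of values back
to the arguments. -/
theorem RegVar.tendsto_arg_ratio (hrv : RegVar ρ h) (hρ : 0 < ρ) (hmono : MonotoneOn h (Ici 1))
    (hpos : ∀ᶠ x in atTop, 0 < h x) (hc : 0 < c) (hx : Tendsto x l atTop)
    (hy : ∀ᶠ i in l, 1 ≤ y i) (hxy : Tendsto (fun i => h (y i) / h (x i)) l (𝓝 (c ^ ρ))) :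
    Tendsto (fun i => y i / x i) l (𝓝 c) := by
  refine tendsto_of_forall_lt_mul hc (fun δ hδ => ?_) (fun δ hδ => ?_)
  · have hδ0 : 0 < c * δ := mul_pos hc (by linarith)
    obtain ⟨m, hm1, hm2⟩ := exists_between
      (Real.rpow_lt_rpow hc.le (lt_mul_of_one_lt_right hc hδ) hρ)
    filter_upwards [hx.eventually hpos, hx.eventually_gt_atTop 0,
      (hrv.comp_ratio hδ0 hx).eventually (lt_mem_nhds hm2), hxy.eventually (gt_mem_nhds hm1),
      (hx.const_mul_atTop hδ0).eventually_ge_atTop 1] with i h1 h2 h3 h4 h5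
    rw [div_le_iff₀ h2]
    exact (lt_of_ratio_lt hmono h1 h5 (h4.trans h3)).le
  · have hδ0 : 0 < c / δ := div_pos hc (by linarith)
    obtain ⟨m, hm1, hm2⟩ := exists_between
      (Real.rpow_lt_rpow hδ0.le (div_lt_self hc hδ) hρ)
    filter_upwards [hx.eventually hpos, hx.eventually_gt_atTop 0,
      (hrv.comp_ratio hδ0 hx).eventually (gt_mem_nhds hm1), hxy.eventually (lt_mem_nhds hm2),
      hy] with i h1 h2 h3 h4 h5
    rw [le_div_iff₀ h2]
    exact (lt_of_ratio_lt hmono h1 h5 (h3.trans h4)).le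

theorem RegVar.tendsto_arg_ratio_atTop (hrv : RegVar ρ h) (hmono : MonotoneOn h (Ici 1))
    (hpos : ∀ᶠ x in atTop, 0 < h x) (hx : Tendsto x l atTop)
    (hy : ∀ᶠ i in l, 1 ≤ y i) (hxy : Tendsto (fun i => h (y i) / h (x i)) l atTop) :
    Tendsto (fun i => y i / x i) l atTop := by
  rw [tendsto_atTop]
  intro b
  have hb : 0 < max b 1 := lt_max_of_lt_right one_pos
  filter_upwards [hx.eventually hpos, hx.eventually_gt_atTop 0, hy,
    (hrv.comp_ratio hb hx).eventually (gt_mem_nhds (lt_add_one _)),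
    hxy.eventually_ge_atTop ((max b 1) ^ ρ + 1)] with i h1 h2 h3 h4 h5
  refine (le_max_left b 1).trans ?_
  rw [le_div_iff₀ h2]
  exact (lt_of_ratio_lt hmono h1 h3 (h4.trans_le h5)).le

theorem RegVar.tendsto_ratio_atTop (hrv : RegVar ρ h) (hρ : 0 < ρ) (hmono : MonotoneOn h (Ici 1))
    (hpos : ∀ᶠ x in atTop, 0 < h x) (hx : Tendsto x l atTop)
    (hxy : Tendsto (fun i => y i / x i) l atTop) :
    Tendsto (fun i => h (y i) / h (x i)) l atTop := by
  rw [tendsto_atTop]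
  intro A
  obtain ⟨b, hbA, hb⟩ := (((tendsto_rpow_atTop hρ).eventually_gt_atTop A).and
    (eventually_gt_atTop (0 : ℝ))).exists
  filter_upwards [hx.eventually hpos, hx.eventually_gt_atTop 0,
    (hrv.comp_ratio hb hx).eventually (lt_mem_nhds hbA), hxy.eventually_ge_atTop b,
    (hx.const_mul_atTop hb).eventually_ge_atTop 1] with i h1 h2 h3 h4 h5
  rw [le_div_iff₀ h2] at h4
  exact h3.le.trans (div_le_div_of_nonneg_right (hmono h5 (h5.trans h4) h4) h1.le)

end Monotone

/-! ### Abelian theorem for convolutions -/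

theorem intervalIntegrable_beta {a b : ℝ} (ha : a < 1) (hb : b < 1) :
    IntervalIntegrable (fun u : ℝ => u ^ (-a) * (1 - u) ^ (-b)) volume 0 1 := by
  have h := (Complex.betaIntegral_convergent (u := ((1 - a : ℝ) : ℂ)) (v := ((1 - b : ℝ) : ℂ))
    (by simpa using ha) (by simpa using hb)).norm
  refine h.congr_uIoo ?_
  rw [uIoo_of_le zero_le_one]
  intro u hu
  have h1 : 0 < 1 - u := sub_pos.2 hu.2
  have e1 : ((1 : ℂ) - (u : ℂ)) = ((1 - u : ℝ) : ℂ) := by push_cast; ring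
  simp only [norm_mul]
  rw [e1, Complex.norm_cpow_eq_rpow_re_of_pos hu.1, Complex.norm_cpow_eq_rpow_re_of_pos h1]
  simp only [Complex.sub_re, Complex.ofReal_re, Complex.one_re]
  rw [show 1 - a - 1 = -a by ring, show 1 - b - 1 = -b by ring]

theorem integral_beta {a b : ℝ} (ha : a < 1) (hb : b < 1) :
    ∫ u in (0 : ℝ)..1, u ^ (-a) * (1 - u) ^ (-b) = beta (1 - a) (1 - b) := by
  rw [beta_eq_betaIntegralReal _ _ (by linarith) (by linarith), Complex.betaIntegral]
  have h := Complex.betaIntegral_convergent (u := ((1 - a : ℝ) : ℂ)) (v := ((1 - b : ℝ) : ℂ))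
    (by simpa using ha) (by simpa using hb)
  rw [intervalIntegral.integral_of_le zero_le_one] at *
  rw [intervalIntegral.integral_of_le zero_le_one, ← RCLike.re_eq_complex_re,
    ← integral_re ((intervalIntegrable_iff_integrableOn_Ioc_of_le zero_le_one).1 h)]
  refine setIntegral_congr_fun measurableSet_Ioc fun u hu => ?_
  have h1 : 0 ≤ 1 - u := sub_nonneg.2 hu.2
  have e1 : ((1 : ℂ) - (u : ℂ)) = ((1 - u : ℝ) : ℂ) := by push_cast; ring
  simp only [RCLike.re_eq_complex_re]
  rw [e1, show ((1 - a : ℝ) : ℂ) - 1 = ((-a : ℝ) : ℂ) by push_cast; ring,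
    show ((1 - b : ℝ) : ℂ) - 1 = ((-b : ℝ) : ℂ) by push_cast; ring,
    ← Complex.ofReal_cpow hu.1.le, ← Complex.ofReal_cpow h1, Complex.re_mul_ofReal,
    Complex.ofReal_re]

/-- Potter's bound for the slowly varying function t^β q(t) covers v ≥ T; monotonicity of q supplies
its measurability. Small v, where regular variation says nothing, are covered by q ≤ 1. -/
theorem antitone_regVar_bound {β ε : ℝ} (hβ0 : 0 ≤ β) (hε : 0 < ε) {q : ℝ → ℝ}
    (hq : AntitoneOn q (Ioi 0)) (hq0 : ∀ t, 0 < t → 0 < q t) (hq1 : ∀ t, 0 < t → q t ≤ 1)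
    (hqrv : RegVar (-β) q) :
    ∃ T C, 0 < T ∧ ∀ t ≥ T, ∀ v, 0 < v → v ≤ t → q v ≤ C * (t / v) ^ (β + ε) * q t := by
  have hsv : SlowlyVarying fun t => t ^ β * q t := by
    refine ⟨⟨1, fun x hx => ?_, ?_⟩, fun c hc => ?_⟩
    · have : 0 < x := by linarith
      have := hq0 x this
      positivity
    · have h1 : Measurable ((Ici (1:ℝ)).domRestrict q) := by
        have : Antitone ((Ici (1:ℝ)).domRestrict q) := fun a b hab =>
          hq (show (0 : ℝ) < a from lt_of_lt_of_le one_pos a.2)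
            (show (0 : ℝ) < b from lt_of_lt_of_le one_pos b.2) hab
        exact this.measurable
      have h2 : Measurable ((Ici (1:ℝ)).domRestrict fun t : ℝ => t ^ β) :=
        Measurable.comp (g := fun t : ℝ => t ^ β) (by fun_prop) measurable_subtype_coe
      exact h2.mul h1
    · have h1 := (hqrv c hc).const_mul (c ^ β)
      rw [← Real.rpow_add hc, add_neg_cancel, Real.rpow_zero] at h1
      refine h1.congr' ?_
      filter_upwards [eventually_gt_atTop 0] with x hx
      have := (hq0 x hx).ne'
      have := (Real.rpow_pos_of_pos hx β).ne'
      rw [Real.mul_rpow hc.le hx.le]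
      field_simp
  obtain ⟨T, hT1, hT⟩ := hsv.potter hε
  have hT0 : 0 < T := by linarith
  have hqT := hq0 T hT0
  have main : ∀ t ≥ T, ∀ v, T ≤ v → v ≤ t → q v ≤ 2 * (t / v) ^ (β + ε) * q t := by
    intro t ht v hv hvt
    have hv0 : 0 < v := by linarith
    have ht0 : 0 < t := by linarith
    have h1 := (hT v t hv hvt).2.2
    have hvβ := Real.rpow_pos_of_pos hv0 β
    rw [← mul_le_mul_iff_right₀ hvβ]
    refine h1.trans_eq ?_
    rw [Real.rpow_add (by positivity), Real.div_rpow ht0.le hv0.le β]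
    field_simp
  -- The constant serves both ranges: it is at least 2 because q(T) ≤ 1, and for v ≤ T one has q(v)
  -- ≤ 1 = q(T)/q(T), to which the bound at T applies.
  refine ⟨T, 2 / q T, hT0, fun t ht v hv0 hvt => ?_⟩
  have ht0 : 0 < t := by linarith
  have hqt := hq0 t ht0
  rcases le_total T v with hv | hv
  · refine (main t ht v hv hvt).trans ?_
    have : (2 : ℝ) ≤ 2 / q T := by
      rw [le_div_iff₀ hqT]
      linarith [hq1 T hT0]
    gcongr
  · have h1 := main t ht T le_rfl ht
    have h2 : (t / T) ^ (β + ε) ≤ (t / v) ^ (β + ε) :=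
      Real.rpow_le_rpow (by positivity) (div_le_div_of_nonneg_left ht0.le hv0 hv) (by linarith)
    calc q v ≤ 1 := hq1 v hv0
      _ = (1 / q T) * q T := by field_simp
      _ ≤ (1 / q T) * (2 * (t / v) ^ (β + ε) * q t) := by
        gcongr
        exact h1.trans (by gcongr)
      _ = _ := by ring

/-- Potter's bound between v and t dominates the rescaled intensity; the same bound started at the
fixed point T shows that t r(t) grows at least like a power. -/
theorem SlowlyVarying.intensity_bound {θ ε : ℝ} (hε : 0 < ε) {r LR : ℝ → ℝ}
    (hr : ∀ᶠ t in atTop, r t = t ^ (-θ) * LR t) (hLR : SlowlyVarying LR) :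
    ∃ T C, 0 < T ∧ 0 < C ∧ ∀ t v, T ≤ v → v ≤ t → 0 < r t ∧
      r v ≤ 2 * (t / v) ^ (θ + ε) * r t ∧ C * t ^ (1 - θ - ε) ≤ t * r t := by
  obtain ⟨T₀, hT₀⟩ := eventually_atTop.1 hr
  obtain ⟨T₁, hT₁1, hT₁⟩ := hLR.potter hε
  set T := max T₀ T₁
  have hT0 : 0 < T := by positivity
  have hLT := (hT₁ T T (le_max_right _ _) le_rfl).1
  refine ⟨T, T ^ ε * LR T / 2, hT0, by positivity, fun t v hv hvt => ?_⟩
  have hv0 : 0 < v := by linarith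
  have ht0 : 0 < t := by linarith
  rw [hT₀ t ((le_max_left _ _).trans (hv.trans hvt)), hT₀ v ((le_max_left _ _).trans hv)]
  obtain ⟨-, -, h1⟩ := hT₁ v t ((le_max_right _ _).trans hv) hvt
  obtain ⟨-, -, h2⟩ := hT₁ T t (le_max_right _ _) (hv.trans hvt)
  obtain ⟨h3, -, -⟩ := hT₁ t t ((le_max_right _ _).trans (hv.trans hvt)) le_rfl
  refine ⟨by positivity, ?_, ?_⟩
  · have hvβ := Real.rpow_pos_of_pos hv0 (-θ)
    have htβ := Real.rpow_pos_of_pos ht0 (-θ)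
    calc v ^ (-θ) * LR v ≤ v ^ (-θ) * (2 * (t / v) ^ ε * LR t) := by gcongr
      _ = _ := by
        rw [Real.rpow_add (by positivity), Real.div_rpow ht0.le hv0.le θ, Real.rpow_neg ht0.le,
          Real.rpow_neg hv0.le]
        have := (Real.rpow_pos_of_pos ht0 θ).ne'
        field_simp
  · rw [Real.div_rpow ht0.le hT0.le] at h2
    have hTε := Real.rpow_pos_of_pos hT0 ε
    have h4 : T ^ ε * LR T / 2 ≤ t ^ ε * LR t := by
      rw [div_le_iff₀ two_pos]
      calc T ^ ε * LR T ≤ T ^ ε * (2 * (t ^ ε / T ^ ε) * LR t) := by gcongr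
        _ = _ := by field_simp
    calc T ^ ε * LR T / 2 * t ^ (1 - θ - ε) ≤ t ^ ε * LR t * t ^ (1 - θ - ε) := by gcongr
      _ = t ^ (1 - θ) * LR t := by
        rw [mul_right_comm, ← Real.rpow_add ht0]
        ring_nf
      _ = _ := by
        rw [sub_eq_add_neg, Real.rpow_add ht0, Real.rpow_one]
        ring

theorem SlowlyVarying.intensity_ratio {θ : ℝ} {r LR : ℝ → ℝ}
    (hr : ∀ᶠ t in atTop, r t = t ^ (-θ) * LR t) (hLR : SlowlyVarying LR) :
    RegVar (-θ) r := by
  intro u hu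
  have h1 := (hLR.2 u hu).const_mul (u ^ (-θ))
  rw [mul_one] at h1
  refine h1.congr' ?_
  filter_upwards [hr, eventually_gt_atTop 0, (tendsto_id.const_mul_atTop hu).eventually hr]
    with t h2 h3 h4
  simp only [id] at h4
  rw [h2, h4, Real.mul_rpow hu.le h3.le]
  have := (Real.rpow_pos_of_pos h3 (-θ)).ne'
  field_simp

/-- Convolutions of a regularly varying intensity with a regularly varying decreasing function. -/
theorem tendsto_convolution {θ β : ℝ} (hθ0 : 0 ≤ θ) (hθ1 : θ < 1) (hβ0 : 0 ≤ β) (hβ1 : β < 1)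
    {r LR q k : ℝ → ℝ} {ψ : ℝ → ℝ → ℝ}
    (hr0 : ∀ t, 0 < t → 0 ≤ r t) (hrint : ∀ t, 0 < t → IntervalIntegrable r volume 0 t)
    (hr : ∀ᶠ t in atTop, r t = t ^ (-θ) * LR t) (hLR : SlowlyVarying LR)
    (hq : AntitoneOn q (Ioi 0)) (hq0 : ∀ t, 0 < t → 0 < q t) (hq1 : ∀ t, 0 < t → q t ≤ 1)
    (hqrv : RegVar (-β) q)
    (hψ : ∀ᶠ t in atTop, Measurable (ψ t) ∧ ∀ v, 0 < v → 0 ≤ ψ t v ∧ ψ t v ≤ q v)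
    (hk : ∀ w ∈ Ioo (0 : ℝ) 1, Tendsto (fun t => ψ t (t * w) / q t) atTop (𝓝 (k w))) :
    Tendsto (fun t => (∫ v in (0 : ℝ)..t, r v * ψ t (t - v)) / (t * r t * q t)) atTop
      (𝓝 (∫ w in (0 : ℝ)..1, (1 - w) ^ (-θ) * k w)) := by
  -- This room keeps the dominating function u^{-(θ+ε)}(1-u)^{-(β+ε)} integrable on (0, 1).
  obtain ⟨ε, hε, hεθ, hεβ⟩ : ∃ ε > 0, θ + ε < 1 ∧ β + ε < 1 := by
    refine ⟨min (1 - θ) (1 - β) / 2, by have := lt_min (sub_pos.2 hθ1) (sub_pos.2 hβ1); linarith,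
      ?_, ?_⟩
    · linarith [min_le_left (1 - θ) (1 - β)]
    · linarith [min_le_right (1 - θ) (1 - β)]
  obtain ⟨T₁, C, hT₁0, hqC⟩ := antitone_regVar_bound hβ0 hε hq hq0 hq1 hqrv
  obtain ⟨T, C', hT0, hc, hrT⟩ := hLR.intensity_bound hε hr
  have hrpos : ∀ t ≥ T, 0 < r t := fun t ht => (hrT t t ht le_rfl).1
  -- integrability of the integrand
  have hint : ∀ᶠ t in atTop, IntervalIntegrable (fun v => r v * ψ t (t - v)) volume 0 t := by
    filter_upwards [hψ, eventually_gt_atTop 0] with t ⟨hm, hb⟩ ht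
    rw [intervalIntegrable_iff_integrableOn_Ioo_of_le ht.le]
    have h1 : IntegrableOn r (Ioo 0 t) :=
      (intervalIntegrable_iff_integrableOn_Ioo_of_le ht.le).1 (hrint t ht)
    refine Integrable.mul_bdd (c := 1) h1
      (hm.comp (measurable_const.sub measurable_id)).aestronglyMeasurable ?_
    refine (ae_restrict_iff' measurableSet_Ioo).2 (Eventually.of_forall fun v hv => ?_)
    have h2 := hb (t - v) (sub_pos.2 hv.2)
    change ‖ψ t (t - v)‖ ≤ 1
    rw [Real.norm_of_nonneg h2.1]
    exact h2.2.trans (hq1 _ (sub_pos.2 hv.2))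
  -- the contribution of times before `T`
  have hfirst : Tendsto (fun t => (∫ v in (0 : ℝ)..T, r v * ψ t (t - v)) / (t * r t * q t)) atTop
      (𝓝 0) := by
    have h1 : Tendsto (fun t => t * r t) atTop atTop := by
      refine tendsto_atTop_mono' _ ?_
        ((tendsto_rpow_atTop (show 0 < 1 - θ - ε by linarith)).const_mul_atTop hc)
      filter_upwards [eventually_ge_atTop T] with t ht
      exact (hrT t t ht le_rfl).2.2
    have h2 := (hqrv (1 / 2) (by norm_num)).mul (h1.inv_tendsto_atTop.mul_const
      (∫ v in (0 : ℝ)..T, r v))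
    -- For v ≤ T < t/2 the factor ψ is at most q(t/2), which is comparable to q(t), while t r(t) →
    -- ∞; hence early times contribute nothing in the limit.
    rw [zero_mul, mul_zero] at h2
    refine squeeze_zero' ?_ ?_ h2
    · filter_upwards [hψ, eventually_gt_atTop T] with t ⟨hm, hb⟩ ht
      have ht0 : 0 < t := hT0.trans ht
      refine div_nonneg ?_ ?_
      · rw [intervalIntegral.integral_of_le hT0.le]
        refine setIntegral_nonneg measurableSet_Ioc fun v hv => ?_
        exact mul_nonneg (hr0 v hv.1) (hb _ (by linarith [hv.2])).1
      · have := hrpos t ht.le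
        have := hq0 t ht0
        positivity
    · filter_upwards [hψ, eventually_gt_atTop (2 * T), hint] with t ⟨hm, hb⟩ ht hi
      have ht0 : 0 < t := by linarith
      have hrt := hrpos t (by linarith)
      have hqt := hq0 t ht0
      have hle : ∫ v in (0 : ℝ)..T, r v * ψ t (t - v) ≤ ∫ v in (0 : ℝ)..T, r v * q (1 / 2 * t) := by
        refine intervalIntegral.integral_mono_on_of_le_Ioo hT0.le ?_ ((hrint T hT0).mul_const _) ?_
        · refine hi.mono_set ?_
          rw [uIcc_of_le hT0.le, uIcc_of_le ht0.le]
          exact Icc_subset_Icc_right (by linarith)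
        · intro v hv
          refine mul_le_mul_of_nonneg_left ?_ (hr0 v hv.1)
          have h3 : 0 < t - v := by linarith [hv.2]
          exact (hb _ h3).2.trans (hq (show (0:ℝ) < 1 / 2 * t by linarith) h3 (by linarith [hv.2]))
      rw [intervalIntegral.integral_mul_const] at hle
      rw [div_le_iff₀ (by positivity)]
      refine hle.trans_eq ?_
      simp only [Pi.inv_apply]
      field_simp
  -- the contribution of times after `T`
  have hsecond : Tendsto (fun t => (∫ v in T..t, r v * ψ t (t - v)) / (t * r t * q t)) atTop
      (𝓝 (∫ w in (0 : ℝ)..1, (1 - w) ^ (-θ) * k w)) := by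
    have hsub := intervalIntegral.integral_comp_sub_left (a := 0) (b := 1)
      (fun w : ℝ => (1 - w) ^ (-θ) * k w) 1
    simp only [sub_sub_cancel, sub_self, sub_zero] at hsub
    rw [← hsub]
    -- After the scaling v = tu the domain (T/t, 1) depends on t. The indicator moves this
    -- dependence into the integrand, so that dominated convergence applies on the fixed interval
    -- (0, 1).
    set G : ℝ → ℝ → ℝ := fun t => (Ioi (T / t)).indicator
      fun u => r (t * u) / r t * (ψ t (t * (1 - u)) / q t)
    have hG : ∀ᶠ t in atTop, ∫ u in (0 : ℝ)..1, G t u =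
        (∫ v in T..t, r v * ψ t (t - v)) / (t * r t * q t) := by
      filter_upwards [eventually_gt_atTop T] with t ht
      have ht0 : 0 < t := hT0.trans ht
      have hrt := hrpos t ht.le
      have hqt := hq0 t ht0
      have hTt : T / t ≤ 1 := (div_le_one ht0).2 ht.le
      have hsc := intervalIntegral.smul_integral_comp_mul_left (a := T / t) (b := 1)
        (fun v => r v * ψ t (t - v)) t
      rw [mul_div_cancel₀ _ ht0.ne', mul_one, smul_eq_mul] at hsc
      rw [← hsc, intervalIntegral.integral_of_le zero_le_one,
        setIntegral_indicator measurableSet_Ioi, intervalIntegral.integral_of_le hTt,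
        show Ioc (0 : ℝ) 1 ∩ Ioi (T / t) = Ioc (T / t) 1 by
          rw [inter_comm, ← Ioi_inter_Iic, ← inter_assoc, Ioi_inter_Ioi,
            sup_of_le_left (by positivity), Ioi_inter_Iic],
            mul_assoc,
        mul_div_mul_left _ _ ht0.ne', ← integral_div]
      refine integral_congr_ae (Eventually.of_forall fun u => ?_)
      simp only
      rw [show t * (1 - u) = t - t * u by ring]
      field_simp
    refine Tendsto.congr' hG ?_
    refine intervalIntegral.tendsto_integral_filter_of_dominated_convergence
      (fun u => 2 * C * (u ^ (-(θ + ε)) * (1 - u) ^ (-(β + ε)))) ?_ ?_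
      ((intervalIntegrable_beta hεθ hεβ).const_mul _) ?_
    · filter_upwards [hψ, eventually_gt_atTop 0] with t ⟨hm, hb⟩ ht
      refine AEStronglyMeasurable.indicator ?_ measurableSet_Ioi
      have h1 := IntervalIntegrable.comp_mul_left (hrint t ht) (c := t) 
      rw [zero_div, div_self ht.ne'] at h1
      rw [uIoc_of_le zero_le_one]
      have h2 := ((intervalIntegrable_iff_integrableOn_Ioc_of_le zero_le_one).1
        (h1.div_const (r t))).aestronglyMeasurable
      exact h2.mul
        ((hm.comp (measurable_const.mul (measurable_const.sub measurable_id))).div_const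
          _).aestronglyMeasurable
    · filter_upwards [hψ, eventually_gt_atTop T, eventually_ge_atTop T₁] with t ⟨hm, hb⟩ ht ht₁
      have ht0 : 0 < t := hT0.trans ht
      have hrt := hrpos t ht.le
      have hqt := hq0 t ht0
      have hne : ∀ᵐ u : ℝ, u ≠ 1 := (measure_eq_zero_iff_ae_notMem.1 (measure_singleton 1))
      filter_upwards [hne] with u hu1 hu
      rw [uIoc_of_le zero_le_one] at hu
      have hu1 : u < 1 := lt_of_le_of_ne hu.2 hu1
      have hu1' : 0 < 1 - u := sub_pos.2 hu1
      have hu0 := hu.1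
      have h3 := hb (t * (1 - u)) (by positivity)
      have h4 := hqC t ht₁ (t * (1 - u)) (by positivity) (by nlinarith)
      have hC : 0 ≤ C := by
        have := hqC t ht₁ t ht0 le_rfl
        rw [div_self ht0.ne', Real.one_rpow, mul_one] at this
        by_contra! hneg
        nlinarith
      by_cases hT : u ∈ Ioi (T / t)
      · have hTu : T ≤ t * u := by
          have : T / t < u := hT
          rw [div_lt_iff₀ ht0] at this
          linarith
        have h5 := (hrT t (t * u) hTu (by nlinarith)).2.1
        have e1 : (t / (t * u)) ^ (θ + ε) = u ^ (-(θ + ε)) := by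
          rw [Real.rpow_neg hu0.le, ← Real.inv_rpow hu0.le]
          congr 1
          field_simp
        have e2 : (t / (t * (1 - u))) ^ (β + ε) = (1 - u) ^ (-(β + ε)) := by
          rw [Real.rpow_neg hu1'.le, ← Real.inv_rpow hu1'.le]
          congr 1
          field_simp
        rw [e1] at h5
        rw [e2] at h4
        simp only [G, indicator_of_mem hT]
        rw [Real.norm_of_nonneg (mul_nonneg (div_nonneg (hr0 _ (by positivity)) hrt.le)
          (div_nonneg h3.1 hqt.le))]
        have h6 : r (t * u) / r t ≤ 2 * u ^ (-(θ + ε)) := by rwa [div_le_iff₀ hrt]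
        have h7 : ψ t (t * (1 - u)) / q t ≤ C * (1 - u) ^ (-(β + ε)) := by
          rw [div_le_iff₀ hqt]
          exact h3.2.trans h4
        calc _ ≤ 2 * u ^ (-(θ + ε)) * (C * (1 - u) ^ (-(β + ε))) :=
              mul_le_mul h6 h7 (div_nonneg h3.1 hqt.le) (by positivity)
          _ = _ := by ring
      · simp only [G, indicator_of_notMem hT, norm_zero]
        positivity
    · have hne : ∀ᵐ u : ℝ, u ≠ 1 := (measure_eq_zero_iff_ae_notMem.1 (measure_singleton 1))
      filter_upwards [hne] with u hu1 hu
      rw [uIoc_of_le zero_le_one] at hu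
      have hu1 : u < 1 := lt_of_le_of_ne hu.2 hu1
      have h1 := (hLR.intensity_ratio hr u hu.1).mul (hk (1 - u) ⟨sub_pos.2 hu1, by linarith [hu.1]⟩)
      refine h1.congr' ?_
      filter_upwards [(tendsto_id.const_mul_atTop hu.1).eventually (eventually_gt_atTop T),
        eventually_gt_atTop 0] with t ht ht0
      simp only [id] at ht
      have : u ∈ Ioi (T / t) := by
        rw [mem_Ioi, div_lt_iff₀ ht0]
        exact ht
      simp only [G, indicator_of_mem this]
      rw [mul_comm t u]
  refine (hfirst.add hsecond).congr' ?_ |>.trans (by rw [zero_add])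
  filter_upwards [hint, eventually_gt_atTop T] with t hi ht
  have ht0 : 0 < t := hT0.trans ht
  rw [← add_div, intervalIntegral.integral_add_adjacent_intervals]
  · refine hi.mono_set ?_
    rw [uIcc_of_le hT0.le, uIcc_of_le ht0.le]
    exact Icc_subset_Icc_right ht.le
  · refine hi.mono_set ?_
    rw [uIcc_of_le ht.le, uIcc_of_le ht0.le]
    exact Icc_subset_Icc_left hT0.le

/-! ### Karamata's theorem -/

theorem regVar_one : RegVar (-0) fun _ : ℝ => (1 : ℝ) := by
  intro c _
  simp

theorem integral_one_sub_rpow_pos {θ : ℝ} (hθ1 : θ < 1) :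
    0 < ∫ w in (0 : ℝ)..1, (1 - w) ^ (-θ) * 1 := by
  have h := integral_beta (a := 0) (b := θ) one_pos hθ1
  simp only [neg_zero, Real.rpow_zero, one_mul] at h
  simp only [mul_one]
  rw [h]
  exact beta_pos (by norm_num) (by linarith)

section Karamata

variable {θ : ℝ} {r LR : ℝ → ℝ}

/-- This is the convolution theorem with constant second factor, β = 0. The limit equals 1/(1-θ),
but only its positivity is used later. -/
theorem SlowlyVarying.karamata (hθ0 : 0 ≤ θ) (hθ1 : θ < 1)
    (hr0 : ∀ t, 0 < t → 0 ≤ r t) (hrint : ∀ t, 0 < t → IntervalIntegrable r volume 0 t)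
    (hr : ∀ᶠ t in atTop, r t = t ^ (-θ) * LR t) (hLR : SlowlyVarying LR) :
    Tendsto (fun t => (∫ v in (0 : ℝ)..t, r v) / (t * r t)) atTop
      (𝓝 (∫ w in (0 : ℝ)..1, (1 - w) ^ (-θ) * 1)) := by
  have h := tendsto_convolution (q := fun _ => 1) (ψ := fun _ _ => 1) (k := fun _ => 1) hθ0 hθ1
    le_rfl one_pos hr0 hrint hr hLR (fun _ _ _ _ _ => le_rfl) (fun _ _ => one_pos)
    (fun _ _ => le_rfl) regVar_one
    (Eventually.of_forall fun t => ⟨measurable_const, fun _ _ => ⟨zero_le_one, le_rfl⟩⟩)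
    (fun w _ => by simp)
  simpa using h

theorem SlowlyVarying.eventually_intensity_pos
    (hr : ∀ᶠ t in atTop, r t = t ^ (-θ) * LR t) (hLR : SlowlyVarying LR) :
    ∀ᶠ t in atTop, 0 < r t := by
  obtain ⟨T, C, -, -, h⟩ := hLR.intensity_bound one_pos hr
  filter_upwards [eventually_ge_atTop T] with t ht
  exact (h t t ht le_rfl).1

theorem SlowlyVarying.tendsto_mul_intensity (hθ1 : θ < 1)
    (hr : ∀ᶠ t in atTop, r t = t ^ (-θ) * LR t) (hLR : SlowlyVarying LR) :
    Tendsto (fun t => t * r t) atTop atTop := by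
  have hε : 0 < (1 - θ) / 2 := by linarith
  obtain ⟨T, C, hT0, hc, hrT⟩ := hLR.intensity_bound hε hr
  refine tendsto_atTop_mono' _ ?_
    ((tendsto_rpow_atTop (show 0 < 1 - θ - (1 - θ) / 2 by linarith)).const_mul_atTop hc)
  filter_upwards [eventually_ge_atTop T] with t ht
  exact (hrT t t ht le_rfl).2.2

theorem SlowlyVarying.tendsto_integral_atTop (hθ0 : 0 ≤ θ) (hθ1 : θ < 1)
    (hr0 : ∀ t, 0 < t → 0 ≤ r t) (hrint : ∀ t, 0 < t → IntervalIntegrable r volume 0 t)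
    (hr : ∀ᶠ t in atTop, r t = t ^ (-θ) * LR t) (hLR : SlowlyVarying LR) :
    Tendsto (fun t => ∫ v in (0 : ℝ)..t, r v) atTop atTop := by
  refine ((hLR.karamata hθ0 hθ1 hr0 hrint hr).pos_mul_atTop (integral_one_sub_rpow_pos hθ1)
    (hLR.tendsto_mul_intensity hθ1 hr)).congr' ?_
  filter_upwards [eventually_gt_atTop 0, hLR.eventually_intensity_pos hr] with t ht hrt
  field_simp

/-- The integral is asymptotic to a constant times t r(t), so its index is one more than that of r.
It is applied to the integrand defining V. -/
theorem SlowlyVarying.regVar_integral (hθ0 : 0 ≤ θ) (hθ1 : θ < 1)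
    (hr0 : ∀ t, 0 < t → 0 ≤ r t) (hrint : ∀ t, 0 < t → IntervalIntegrable r volume 0 t)
    (hr : ∀ᶠ t in atTop, r t = t ^ (-θ) * LR t) (hLR : SlowlyVarying LR) :
    RegVar (1 - θ) fun t => ∫ v in (0 : ℝ)..t, r v := by
  intro c hc
  have hk := hLR.karamata hθ0 hθ1 hr0 hrint hr
  have hκ := integral_one_sub_rpow_pos hθ1
  have hcx : Tendsto (fun x : ℝ => c * x) atTop atTop := tendsto_id.const_mul_atTop hc
  have h := ((hk.comp hcx).div hk hκ.ne').mul ((hLR.intensity_ratio hr c hc).const_mul c)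
  rw [div_self hκ.ne', one_mul] at h
  rw [sub_eq_add_neg, Real.rpow_add hc, Real.rpow_one]
  refine h.congr' ?_
  filter_upwards [eventually_gt_atTop 0, hLR.eventually_intensity_pos hr,
    hcx.eventually (hLR.eventually_intensity_pos hr),
    (hLR.tendsto_integral_atTop hθ0 hθ1 hr0 hrint hr).eventually_gt_atTop 0] with t ht hrt hrct hR
  simp only [Function.comp_apply, Pi.div_apply]
  field_simp

end Karamata

/-! ### Generating functions -/

section Pgf

variable {p : PMF ℕ} {s t : ℝ}

theorem PMF.summable_toReal (p : PMF ℕ) : Summable fun n => (p n).toReal :=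
  ENNReal.summable_toReal p.tsum_coe_ne_top

theorem pgf_summable (p : PMF ℕ) (hs0 : 0 ≤ s) (hs1 : s ≤ 1) :
    Summable fun n => (p n).toReal * s ^ n :=
  p.summable_toReal.of_nonneg_of_le (fun n => by positivity)
    fun n => mul_le_of_le_one_right ENNReal.toReal_nonneg (pow_le_one₀ hs0 hs1)

theorem pgf_one (p : PMF ℕ) : pgf p 1 = 1 := by
  simp only [pgf, one_pow, mul_one]
  rw [← ENNReal.tsum_toReal_eq p.apply_ne_top, p.tsum_coe, ENNReal.toReal_one]

theorem pgf_nonneg (p : PMF ℕ) (hs0 : 0 ≤ s) : 0 ≤ pgf p s :=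
  tsum_nonneg fun n => by positivity

theorem pgf_mono (p : PMF ℕ) (hs0 : 0 ≤ s) (hst : s ≤ t) (ht : t ≤ 1) : pgf p s ≤ pgf p t :=
  Summable.tsum_le_tsum (fun n => by gcongr) (pgf_summable p hs0 (hst.trans ht))
    (pgf_summable p (hs0.trans hst) ht)

theorem pgf_le_one (p : PMF ℕ) (hs0 : 0 ≤ s) (hs1 : s ≤ 1) : pgf p s ≤ 1 :=
  (pgf_mono p hs0 hs1 le_rfl).trans_eq (pgf_one p)

theorem pgf_continuousOn (p : PMF ℕ) : ContinuousOn (pgf p) (Icc 0 1) := by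
  refine continuousOn_tsum (u := fun n => (p n).toReal) (fun n => by fun_prop) p.summable_toReal ?_
  intro n x hx
  rw [Real.norm_of_nonneg (by have := hx.1; positivity)]
  exact mul_le_of_le_one_right ENNReal.toReal_nonneg (pow_le_one₀ hx.1 hx.2)

theorem integral_pow_toMeasure (p : PMF ℕ) (hs0 : 0 ≤ s) (hs1 : s ≤ 1) :
    ∫ n, s ^ n ∂p.toMeasure = pgf p s := by
  rw [PMF.integral_eq_tsum]
  · simp [pgf]
  · refine Integrable.of_bound (C := 1) (measurable_of_countable _).aestronglyMeasurable ?_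
    refine Eventually.of_forall fun n => ?_
    rw [Real.norm_of_nonneg (by positivity)]
    exact pow_le_one₀ hs0 hs1

theorem pgf_convex (p : PMF ℕ) (hs0 : 0 ≤ s) (hs1 : s ≤ 1) {a : ℝ} (ha0 : 0 ≤ a) (ha1 : a ≤ 1) :
    pgf p (a * s + (1 - a)) ≤ a * pgf p s + (1 - a) := by
  have h1 : 0 ≤ a * s + (1 - a) := by
    have := mul_nonneg ha0 hs0
    linarith
  have h2 : a * s + (1 - a) ≤ 1 := by nlinarith
  calc pgf p (a * s + (1 - a))
      ≤ ∑' n, (a * ((p n).toReal * s ^ n) + (1 - a) * (p n).toReal) := by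
        refine Summable.tsum_le_tsum (fun n => ?_) (pgf_summable p h1 h2)
          (((pgf_summable p hs0 hs1).mul_left a).add (p.summable_toReal.mul_left _))
        have h := (convexOn_pow (𝕜 := ℝ) n).2 (mem_Ici.2 hs0) (mem_Ici.2 zero_le_one) ha0
          (sub_nonneg.2 ha1) (by ring)
        simp only [smul_eq_mul, mul_one, one_pow] at h
        calc (p n).toReal * (a * s + (1 - a)) ^ n ≤ (p n).toReal * (a * s ^ n + (1 - a)) := by
              gcongr
          _ = _ := by ring
    _ = a * pgf p s + (1 - a) := by
        rw [((pgf_summable p hs0 hs1).mul_left a).tsum_add (p.summable_toReal.mul_left _),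
          tsum_mul_left, tsum_mul_left]
        have h3 := pgf_one p
        simp only [pgf, one_pow, mul_one] at h3
        rw [h3, mul_one, pgf]

/-- A generating function which stays above the diagonal near `1` does so on `[0, 1)`. -/
theorem lt_pgf_of_eventually (h : ∀ᶠ x in 𝓝[<] (1 : ℝ), x < pgf p x) (hs0 : 0 ≤ s) (hs1 : s < 1) :
    s < pgf p s := by
  by_contra! hcon
  have h1 : ∀ᶠ x in 𝓝[<] (1 : ℝ), s < x := by
    filter_upwards [Ioo_mem_nhdsLT hs1] with x hx using hx.1
  obtain ⟨x, hx, hsx, hx1⟩ := (h.and (h1.and self_mem_nhdsWithin)).exists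
  have hx1 : x < 1 := hx1
  have hd : 0 < 1 - s := sub_pos.2 hs1
  -- The weight writes x as a convex combination of s and 1. If the value at s were at most s, the
  -- chord to (1, 1) would stay below the diagonal, and by convexity so would the value at x.
  have h2 := pgf_convex p hs0 hs1.le (a := (1 - x) / (1 - s)) (div_nonneg (by linarith) hd.le)
    ((div_le_one hd).2 (by linarith))
  have e : (1 - x) / (1 - s) * s + (1 - (1 - x) / (1 - s)) = x := by field_simp; ring
  rw [e] at h2
  have h3 : (1 - x) / (1 - s) * pgf p s ≤ (1 - x) / (1 - s) * s :=
    mul_le_mul_of_nonneg_left hcon (div_nonneg (by linarith) hd.le)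
  linarith

/-- A generating function which stays above the diagonal near `1` has mean at most `1`. -/
theorem lintegral_le_one_of_eventually (h : ∀ᶠ x in 𝓝[<] (1 : ℝ), x < pgf p x) :
    ∫⁻ n, (n : ENNReal) ∂p.toMeasure ≤ 1 := by
  have hsum : ∫⁻ n, (n : ENNReal) ∂p.toMeasure = ∑' n : ℕ, (n : ENNReal) * p n := by
    rw [lintegral_countable']
    simp [PMF.toMeasure_apply_singleton]
  rw [hsum, ENNReal.tsum_eq_iSup_sum]
  refine iSup_le fun A => ?_
  have hfin : ∑ n ∈ A, (n : ℝ) * (p n).toReal ≤ 1 := by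
    -- Since (1 - x^n)/(1 - x) is a geometric sum tending to n as x ↑ 1, the truncated mean is a
    -- limit of partial sums of (1 - f(x))/(1 - x), which are at most 1 whenever f(x) > x.
    have hlim : Tendsto (fun x : ℝ => ∑ n ∈ A, (∑ i ∈ Finset.range n, x ^ i) * (p n).toReal)
        (𝓝[<] 1) (𝓝 (∑ n ∈ A, (∑ i ∈ Finset.range n, (1 : ℝ) ^ i) * (p n).toReal)) := by
      refine Tendsto.mono_left (Continuous.tendsto ?_ 1) nhdsWithin_le_nhds
      fun_prop
    simp only [one_pow, Finset.sum_const, Finset.card_range, nsmul_eq_mul, mul_one] at hlim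
    refine le_of_tendsto hlim ?_
    filter_upwards [h, self_mem_nhdsWithin, Ioo_mem_nhdsLT (zero_lt_one' ℝ)] with x hx hx1 hx0
    have hx1 : x < 1 := hx1
    have hd : 0 < 1 - x := sub_pos.2 hx1
    rw [← mul_le_mul_iff_left₀ hd, one_mul, Finset.sum_mul]
    have h1 : HasSum (fun n => (p n).toReal - (p n).toReal * x ^ n) (1 - pgf p x) := by
      have h3 := p.summable_toReal.hasSum
      have h4 := pgf_one p
      simp only [pgf, one_pow, mul_one] at h4
      rw [h4] at h3
      exact h3.sub (pgf_summable p hx0.1.le hx1.le).hasSum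
    calc ∑ n ∈ A, (∑ i ∈ Finset.range n, x ^ i) * (p n).toReal * (1 - x)
        = ∑ n ∈ A, ((p n).toReal - (p n).toReal * x ^ n) := by
          refine Finset.sum_congr rfl fun n _ => ?_
          have := geom_sum_mul_neg x n
          linear_combination (p n).toReal * this
      _ ≤ 1 - pgf p x := by
          refine sum_le_hasSum A (fun n _ => ?_) h1
          rw [sub_nonneg]
          exact mul_le_of_le_one_right ENNReal.toReal_nonneg (pow_le_one₀ hx0.1.le hx1.le)
      _ ≤ 1 - x := by linarith
  calc ∑ n ∈ A, (n : ENNReal) * p n = ENNReal.ofReal (∑ n ∈ A, (n : ℝ) * (p n).toReal) := by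
        rw [ENNReal.ofReal_sum_of_nonneg fun n _ => by positivity]
        refine Finset.sum_congr rfl fun n _ => ?_
        rw [ENNReal.ofReal_mul (Nat.cast_nonneg n), ENNReal.ofReal_toReal (p.apply_ne_top n),
          ENNReal.ofReal_natCast]
    _ ≤ 1 := ENNReal.ofReal_le_one.2 hfin

theorem pgf_lt_one_of_eventually (h : ∀ᶠ x in 𝓝[<] (1 : ℝ), pgf p x < 1) (hs0 : 0 ≤ s)
    (hs1 : s < 1) : pgf p s < 1 := by
  have h1 : ∀ᶠ x in 𝓝[<] (1 : ℝ), s < x := by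
    filter_upwards [Ioo_mem_nhdsLT hs1] with x hx using hx.1
  obtain ⟨x, hx, hsx, hx1⟩ := (h.and (h1.and self_mem_nhdsWithin)).exists
  exact (pgf_mono p hs0 hsx.le (le_of_lt hx1)).trans_lt hx

theorem SlowlyVarying.eventually_near_one {L : ℝ → ℝ} (hL : SlowlyVarying L) :
    ∀ᶠ x in 𝓝[<] (1 : ℝ), 0 ≤ x ∧ x < 1 ∧ 0 < L (1 / (1 - x)) := by
  obtain ⟨⟨a, ha, -⟩, -⟩ := hL
  have h1 : Tendsto (fun x : ℝ => 1 / (1 - x)) (𝓝[<] 1) atTop := by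
    simp only [one_div]
    refine tendsto_inv_nhdsGT_zero.comp ?_
    refine tendsto_nhdsWithin_iff.2 ⟨?_, ?_⟩
    · have : Tendsto (fun x : ℝ => 1 - x) (𝓝 1) (𝓝 (1 - 1)) := by
        exact Continuous.tendsto (by fun_prop) 1
      rw [sub_self] at this
      exact this.mono_left nhdsWithin_le_nhds
    · filter_upwards [self_mem_nhdsWithin] with x hx
      exact sub_pos.2 (mem_Iio.1 hx)
  filter_upwards [h1.eventually_ge_atTop a, Ioo_mem_nhdsLT (zero_lt_one' ℝ)] with x h2 h3
  exact ⟨h3.1.le, h3.2, ha _ h2⟩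

end Pgf

/-! ### The functions `V`, `W`, `Ψ` and its inverse -/

section V

variable {p : PMF ℕ}

theorem continuousOn_inv_pgf_sub (hgt : ∀ s, 0 ≤ s → s < 1 → s < pgf p s) :
    ContinuousOn (fun u => 1 / (pgf p u - u)) (Ico 0 1) := by
  refine continuousOn_const.div (((pgf_continuousOn p).mono Ico_subset_Icc_self).sub
    continuousOn_id) fun u hu => ?_
  exact (sub_pos.2 (hgt u hu.1 hu.2)).ne'

theorem one_sub_one_div_mem {x : ℝ} (hx : 1 ≤ x) : 1 - 1 / x ∈ Ico (0 : ℝ) 1 := by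
  have h0 : 0 < x := by linarith
  refine ⟨sub_nonneg.2 ((div_le_one h0).2 hx), ?_⟩
  have : 0 < 1 / x := by positivity
  linarith

theorem intervalIntegrable_inv_pgf_sub (hgt : ∀ s, 0 ≤ s → s < 1 → s < pgf p s) {a b : ℝ}
    (ha : a ∈ Ico (0 : ℝ) 1) (hb : b ∈ Ico (0 : ℝ) 1) :
    IntervalIntegrable (fun u => 1 / (pgf p u - u)) volume a b := by
  refine ((continuousOn_inv_pgf_sub hgt).mono ?_).intervalIntegrable
  exact ordConnected_Ico.uIcc_subset ha hb

theorem V_one (p : PMF ℕ) : V p 1 = 0 := by simp [V]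

theorem V_strictMonoOn (hgt : ∀ s, 0 ≤ s → s < 1 → s < pgf p s) :
    StrictMonoOn (V p) (Ici 1) := by
  intro x hx y hy hxy
  have hx0 : (0 : ℝ) < x := by linarith [mem_Ici.1 hx]
  have h1 := one_sub_one_div_mem hx
  have h2 := one_sub_one_div_mem hy
  have h3 : 1 - 1 / x < 1 - 1 / y := by
    have := one_div_lt_one_div_of_lt hx0 hxy
    linarith
  have h0 : (0 : ℝ) ∈ Ico (0 : ℝ) 1 := ⟨le_rfl, one_pos⟩
  have hadd := intervalIntegral.integral_add_adjacent_intervals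
    (intervalIntegrable_inv_pgf_sub hgt h0 h1) (intervalIntegrable_inv_pgf_sub hgt h1 h2)
  have hpos : 0 < ∫ u in (1 - 1 / x)..(1 - 1 / y), 1 / (pgf p u - u) := by
    refine intervalIntegral.intervalIntegral_pos_of_pos_on
      (intervalIntegrable_inv_pgf_sub hgt h1 h2) (fun u hu => ?_) h3
    exact one_div_pos.2 (sub_pos.2 (hgt u (h1.1.trans hu.1.le) (hu.2.trans h2.2)))
  simp only [V]
  linarith

/-- By strict monotonicity the set whose infimum defines `W` is the half-line from x on. -/
theorem W_V (hgt : ∀ s, 0 ≤ s → s < 1 → s < pgf p s) {x : ℝ} (hx : 1 ≤ x) : W p (V p x) = x := by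
  have : {y : ℝ | 1 ≤ y ∧ V p x ≤ V p y} = Ici x := by
    ext y
    constructor
    · rintro ⟨h1, h2⟩
      exact ((V_strictMonoOn hgt).le_iff_le hx h1).1 h2
    · intro h
      have h1 : 1 ≤ y := hx.trans h
      exact ⟨h1, ((V_strictMonoOn hgt).le_iff_le hx h1).2 h⟩
  rw [W, this, csInf_Ici]

theorem V_one_div_one_sub (p : PMF ℕ) (s : ℝ) :
    V p (1 / (1 - s)) = ∫ u in (0 : ℝ)..s, 1 / (pgf p u - u) := by
  rw [V, one_div_one_div, sub_sub_cancel]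

/-- In the variable s = 1 - 1/x the function V is a primitive of 1/(f(u) - u), which is what
separates variables in the backward equation. -/
theorem hasDerivAt_V (hgt : ∀ s, 0 ≤ s → s < 1 → s < pgf p s) {y : ℝ} (hy0 : 0 < y) (hy1 : y < 1) :
    HasDerivAt (fun s => V p (1 / (1 - s))) (1 / (pgf p y - y)) y := by
  simp only [V_one_div_one_sub]
  have hn : Ico (0 : ℝ) 1 ∈ 𝓝 y := Ico_mem_nhds hy0 hy1
  refine intervalIntegral.integral_hasDerivAt_right
    (intervalIntegrable_inv_pgf_sub hgt ⟨le_rfl, one_pos⟩ ⟨hy0.le, hy1⟩) ?_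
    ((continuousOn_inv_pgf_sub hgt).continuousAt hn)
  exact ContinuousOn.stronglyMeasurableAtFilter_nhdsWithin (s := Ioo 0 1)
    ((continuousOn_inv_pgf_sub hgt).mono Ioo_subset_Ico_self) measurableSet_Ioo y |>.filter_mono
      (le_of_eq (nhdsWithin_eq_nhds.2 (Ioo_mem_nhds hy0 hy1)).symm)

theorem continuousOn_V (hgt : ∀ s, 0 ≤ s → s < 1 → s < pgf p s) :
    ContinuousOn (fun s => V p (1 / (1 - s))) (Ico 0 1) := by
  simp only [V_one_div_one_sub]
  intro y hy
  obtain ⟨b, hyb, hb1⟩ := exists_between hy.2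
  have hb0 : 0 ≤ b := hy.1.trans hyb.le
  have h := intervalIntegral.continuousOn_primitive_interval
    (f := fun u => 1 / (pgf p u - u)) (μ := volume) (a := 0) (b := b) (by
      rw [uIcc_of_le hb0]
      exact ((continuousOn_inv_pgf_sub hgt).mono fun u hu =>
        ⟨hu.1, hu.2.trans_lt hb1⟩).integrableOn_Icc)
  rw [uIcc_of_le hb0] at h
  refine (h y ⟨hy.1, hyb.le⟩).mono_of_mem_nhdsWithin ?_
  rw [mem_nhdsWithin]
  exact ⟨Iio b, isOpen_Iio, hyb, fun z hz => ⟨hz.2.1, le_of_lt hz.1⟩⟩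

variable {γ : ℝ} {L : ℝ → ℝ}

theorem lt_pgf_of_slowlyVarying
    (hf : ∀ s, 0 ≤ s → s < 1 → pgf p s = s + (1 - s) ^ (γ + 1) * L (1 / (1 - s)))
    (hL : SlowlyVarying L) : ∀ᶠ x in 𝓝[<] (1 : ℝ), x < pgf p x := by
  filter_upwards [hL.eventually_near_one] with x hx
  rw [hf x hx.1 hx.2.1]
  have : 0 < 1 - x := sub_pos.2 hx.2.1
  have := hx.2.2
  have : 0 < (1 - x) ^ (γ + 1) * L (1 / (1 - x)) := by positivity
  linarith

theorem SlowlyVarying.inv {L : ℝ → ℝ} (hL : SlowlyVarying L) : SlowlyVarying fun x => (L x)⁻¹ := by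
  obtain ⟨⟨a, ha, hm⟩, h⟩ := hL
  refine ⟨⟨a, fun x hx => inv_pos.2 (ha x hx), hm.inv⟩, fun c hc => ?_⟩
  have := (h c hc).inv₀ one_ne_zero
  rw [inv_one] at this
  refine this.congr fun x => ?_
  rw [inv_div, inv_div_inv]

/-- The substitution u = 1 - 1/y turns V(x) into ∫₁ˣ y^{γ-1}/L(y) dy. Karamata's theorem applies
with θ = 1 - γ, which lies in [0, 1). -/
theorem V_regVar_aux (hγ0 : 0 < γ) (hγ1 : γ ≤ 1)
    (hf : ∀ s, 0 ≤ s → s < 1 → pgf p s = s + (1 - s) ^ (γ + 1) * L (1 / (1 - s)))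
    (hL : SlowlyVarying L) :
    RegVar γ (V p) ∧ Tendsto (V p) atTop atTop := by
  have hgt : ∀ s, 0 ≤ s → s < 1 → s < pgf p s :=
    fun s => lt_pgf_of_eventually (lt_pgf_of_slowlyVarying hf hL)
  set g : ℝ → ℝ := fun y => 1 / (pgf p (1 - 1 / y) - (1 - 1 / y)) * (y ^ 2)⁻¹
  -- Karamata's theorem integrates from 0, so the integrand is extended by zero to (0, 1].
  set r : ℝ → ℝ := (Ioi 1).indicator g
  have hcont : ContinuousOn g (Ici 1) := by
    refine ContinuousOn.mul ?_ ?_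
    · refine (continuousOn_inv_pgf_sub hgt).comp (f := fun y : ℝ => 1 - 1 / y)
        (continuousOn_const.sub (continuousOn_const.div continuousOn_id ?_))
        fun y hy => one_sub_one_div_mem hy
      intro y hy
      have : (1 : ℝ) ≤ y := hy
      positivity
    · refine (continuousOn_pow 2).inv₀ fun y hy => ?_
      have : (1 : ℝ) ≤ y := hy
      positivity
  have hrint : ∀ t, 0 < t → IntervalIntegrable r volume 0 t := by
    intro t ht
    rw [intervalIntegrable_iff_integrableOn_Ioc_of_le ht.le, IntegrableOn,
      integrable_indicator_iff measurableSet_Ioi, IntegrableOn,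
      Measure.restrict_restrict measurableSet_Ioi]
    refine IntegrableOn.mono_set (t := Icc 1 t) ?_ fun y hy => ⟨le_of_lt hy.1, hy.2.2⟩
    exact (hcont.mono fun y hy => hy.1).integrableOn_Icc
  have hr0 : ∀ t, 0 < t → 0 ≤ r t := by
    intro t ht
    refine indicator_nonneg (fun y hy => ?_) t
    have h1 := one_sub_one_div_mem (le_of_lt hy)
    have := sub_pos.2 (hgt _ h1.1 h1.2)
    positivity
  have hr : ∀ᶠ t in atTop, r t = t ^ (-(1 - γ)) * (L t)⁻¹ := by
    filter_upwards [eventually_gt_atTop 1] with t ht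
    have ht0 : 0 < t := by linarith
    have h1 := one_sub_one_div_mem ht.le
    simp only [r, indicator_of_mem (mem_Ioi.2 ht), g]
    rw [hf _ h1.1 h1.2, add_sub_cancel_left, sub_sub_cancel, one_div_one_div, one_div, mul_inv,
      Real.rpow_add (by positivity), Real.rpow_one, one_div, Real.inv_rpow ht0.le,
      show -(1 - γ) = γ - 1 by ring, Real.rpow_sub ht0, Real.rpow_one]
    have := Real.rpow_pos_of_pos ht0 γ
    field_simp
  have hV : ∀ x, 1 ≤ x → ∫ v in (0 : ℝ)..x, r v = V p x := by
    intro x hx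
    have h1 : ∫ v in (0 : ℝ)..x, r v = ∫ v in (1 : ℝ)..x, g v := by
      rw [intervalIntegral.integral_of_le (by linarith), intervalIntegral.integral_of_le hx,
        setIntegral_indicator measurableSet_Ioi, inter_comm, ← Ioi_inter_Iic, ← inter_assoc,
        Ioi_inter_Ioi, sup_of_le_left zero_le_one, Ioi_inter_Iic]
    have h2 := intervalIntegral.integral_comp_mul_deriv' (a := 1) (b := x)
      (f := fun y : ℝ => 1 - 1 / y) (f' := fun y => (y ^ 2)⁻¹)
      (g := fun u => 1 / (pgf p u - u)) ?_ ?_ ?_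
    · rw [h1, V, show (0 : ℝ) = 1 - 1 / 1 by norm_num]
      exact h2
    · intro y hy
      rw [uIcc_of_le hx] at hy
      have hy0 : y ≠ 0 := by linarith [hy.1]
      have := (hasDerivAt_inv hy0).const_sub 1
      simp only [neg_neg] at this
      simpa only [one_div] using this
    · rw [uIcc_of_le hx]
      refine (continuousOn_pow 2).inv₀ fun y hy => ?_
      have : (1 : ℝ) ≤ y := hy.1
      positivity
    · refine (continuousOn_inv_pgf_sub hgt).mono ?_
      rintro _ ⟨y, hy, rfl⟩
      rw [uIcc_of_le hx] at hy
      exact one_sub_one_div_mem hy.1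
  have hev : ∀ᶠ x in atTop, ∫ v in (0 : ℝ)..x, r v = V p x := by
    filter_upwards [eventually_ge_atTop 1] with x hx using hV x hx
  constructor
  · intro c hc
    have h := hL.inv.regVar_integral (by linarith) (by linarith) hr0 hrint hr c hc
    rw [sub_sub_cancel] at h
    refine h.congr' ?_
    filter_upwards [hev, (tendsto_id.const_mul_atTop hc).eventually hev] with x h1 h2
    simp only [id] at h2
    rw [h1, h2]
  · exact (hL.inv.tendsto_integral_atTop (by linarith) (by linarith) hr0 hrint hr).congr' hev

end V

section Psi

variable {b : PMF ℕ}

theorem Psi_pos (hlt : ∀ s, 0 ≤ s → s < 1 → pgf b s < 1) {x : ℝ} (hx : 1 ≤ x) : 0 < Psi b x := by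
  have h := one_sub_one_div_mem hx
  exact one_div_pos.2 (sub_pos.2 (hlt _ h.1 h.2))

theorem Psi_monotoneOn (hlt : ∀ s, 0 ≤ s → s < 1 → pgf b s < 1) : MonotoneOn (Psi b) (Ici 1) := by
  intro x hx y hy hxy
  have h1 := one_sub_one_div_mem hx
  have h2 := one_sub_one_div_mem hy
  have hx0 : (0 : ℝ) < x := by linarith [mem_Ici.1 hx]
  have := one_div_le_one_div_of_le hx0 hxy
  refine one_div_le_one_div_of_le (sub_pos.2 (hlt _ h2.1 h2.2)) ?_
  have := pgf_mono b h1.1 (show 1 - 1 / x ≤ 1 - 1 / y by linarith) h2.2.le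
  linarith

theorem Psi_continuousOn (hlt : ∀ s, 0 ≤ s → s < 1 → pgf b s < 1) :
    ContinuousOn (Psi b) (Ici 1) := by
  have h1 : ContinuousOn (fun x : ℝ => pgf b (1 - 1 / x)) (Ici 1) := by
    refine (pgf_continuousOn b).comp (f := fun y : ℝ => 1 - 1 / y)
      (continuousOn_const.sub (continuousOn_const.div continuousOn_id fun y hy => ?_))
      fun y hy => Ico_subset_Icc_self (one_sub_one_div_mem hy)
    have : (1 : ℝ) ≤ y := hy
    positivity
  refine continuousOn_const.div (continuousOn_const.sub h1) fun x hx => ?_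
  have h := one_sub_one_div_mem hx
  exact (sub_pos.2 (hlt _ h.1 h.2)).ne'

theorem Psi_tendsto_atTop (hlt : ∀ s, 0 ≤ s → s < 1 → pgf b s < 1) :
    Tendsto (Psi b) atTop atTop := by
  have h1 : Tendsto (fun x : ℝ => 1 - 1 / x) atTop (𝓝[Icc 0 1] 1) := by
    refine tendsto_nhdsWithin_iff.2 ⟨?_, ?_⟩
    · have := (tendsto_inv_atTop_zero (𝕜 := ℝ)).const_sub 1
      simpa using this
    · filter_upwards [eventually_ge_atTop 1] with x hx
      exact Ico_subset_Icc_self (one_sub_one_div_mem hx)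
  have h2 := ((pgf_continuousOn b 1 ⟨zero_le_one, le_rfl⟩).tendsto.comp h1).const_sub 1
  rw [pgf_one, sub_self] at h2
  change Tendsto (fun x => 1 / (1 - pgf b (1 - 1 / x))) atTop atTop
  simp only [one_div]
  refine tendsto_inv_nhdsGT_zero.comp (tendsto_nhdsWithin_iff.2 ⟨by simpa using h2, ?_⟩)
  filter_upwards [eventually_ge_atTop 1] with x hx
  have h := one_sub_one_div_mem hx
  simpa using sub_pos.2 (hlt _ h.1 h.2)

/-- Continuity gives a point with value y by the intermediate value theorem; the set in the
definition of `PsiInv` is closed, so its infimum is attained, and monotonicity forces the value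
there to be y. -/
theorem Psi_PsiInv (hlt : ∀ s, 0 ≤ s → s < 1 → pgf b s < 1) {y : ℝ} (hy : Psi b 1 ≤ y) :
    1 ≤ PsiInv b y ∧ Psi b (PsiInv b y) = y := by
  obtain ⟨z, hyz, hz⟩ := (((Psi_tendsto_atTop hlt).eventually_ge_atTop y).and
    (eventually_ge_atTop 1)).exists
  obtain ⟨x, hx, rfl⟩ : y ∈ Psi b '' Icc 1 z :=
    intermediate_value_Icc hz ((Psi_continuousOn hlt).mono fun u hu => hu.1) ⟨hy, hyz⟩
  set A := {x' : ℝ | 1 ≤ x' ∧ Psi b x ≤ Psi b x'}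
  have hcl : IsClosed A := by
    have := (Psi_continuousOn hlt).preimage_isClosed_of_isClosed isClosed_Ici
      (isClosed_Ici (a := Psi b x))
    exact this
  have hbd : BddBelow A := ⟨1, fun u hu => hu.1⟩
  have hmem : sInf A ∈ A := hcl.csInf_mem ⟨x, hx.1, le_rfl⟩ hbd
  refine ⟨hmem.1, le_antisymm ?_ hmem.2⟩
  exact Psi_monotoneOn hlt hmem.1 hx.1 (csInf_le hbd ⟨hx.1, le_rfl⟩)

theorem PsiInv_tendsto_atTop (hlt : ∀ s, 0 ≤ s → s < 1 → pgf b s < 1) :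
    Tendsto (PsiInv b) atTop atTop := by
  rw [tendsto_atTop]
  intro c
  filter_upwards [eventually_gt_atTop (Psi b (max c 1)), eventually_ge_atTop (Psi b 1)] with y h1 h2
  obtain ⟨h3, h4⟩ := Psi_PsiInv hlt h2
  by_contra! hcon
  have := Psi_monotoneOn hlt h3 (le_max_right c 1) (hcon.le.trans (le_max_left c 1))
  linarith

variable {α : ℝ} {l : ℝ → ℝ}

theorem pgf_lt_one_of_slowlyVarying
    (hg : ∀ s, 0 ≤ s → s < 1 → pgf b s = 1 - (1 - s) ^ α * l (1 / (1 - s)))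
    (hl : SlowlyVarying l) : ∀ s, 0 ≤ s → s < 1 → pgf b s < 1 := by
  refine fun s => pgf_lt_one_of_eventually ?_
  filter_upwards [hl.eventually_near_one] with x hx
  rw [hg x hx.1 hx.2.1]
  have : 0 < 1 - x := sub_pos.2 hx.2.1
  have := hx.2.2
  have : 0 < (1 - x) ^ α * l (1 / (1 - x)) := by positivity
  linarith

theorem Psi_regVar (hg : ∀ s, 0 ≤ s → s < 1 → pgf b s = 1 - (1 - s) ^ α * l (1 / (1 - s)))
    (hl : SlowlyVarying l) : RegVar α (Psi b) := by
  intro c hc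
  have heq : ∀ x, 1 ≤ x → Psi b x = x ^ α * (l x)⁻¹ := by
    intro x hx
    have h := one_sub_one_div_mem hx
    have hx0 : 0 < x := by linarith
    rw [Psi, hg _ h.1 h.2, sub_sub_cancel, sub_sub_cancel, one_div_one_div, one_div, mul_inv,
      one_div, Real.inv_rpow hx0.le, inv_inv]
  have h := (hl.inv.2 c hc).const_mul (c ^ α)
  rw [mul_one] at h
  refine h.congr' ?_
  filter_upwards [eventually_ge_atTop 1, (tendsto_id.const_mul_atTop hc).eventually_ge_atTop 1]
    with x h1 h2
  simp only [id] at h2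
  rw [heq _ h1, heq _ h2, Real.mul_rpow hc.le (by linarith)]
  have : x ^ α ≠ 0 := (Real.rpow_pos_of_pos (by linarith) α).ne'
  field_simp

end Psi

/-! ### Laplace transforms -/

theorem integral_polynomial_unitInterval {m : Measure (Icc (0 : ℝ) 1)} [IsFiniteMeasure m]
    (P : Polynomial ℝ) :
    ∫ y, P.eval (y : ℝ) ∂m = P.sum fun n a => a * ∫ y, (y : ℝ) ^ n ∂m := by
  simp only [Polynomial.eval_eq_sum, Polynomial.sum]
  rw [integral_finsetSum]
  · simp only [integral_const_mul]
  · intro n _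
    refine (BoundedContinuousFunction.mkOfCompact
      ⟨fun y : Icc (0 : ℝ) 1 => P.coeff n * (y : ℝ) ^ n, by fun_prop⟩).integrable m

/-- A probability measure on `[0, 1]` is determined by its moments. -/
theorem ext_of_moments {m m' : Measure (Icc (0 : ℝ) 1)} [IsProbabilityMeasure m]
    [IsProbabilityMeasure m']
    (h : ∀ n : ℕ, 0 < n → ∫ y, (y : ℝ) ^ n ∂m = ∫ y, (y : ℝ) ^ n ∂m') : m = m' := by
  -- The zeroth moment is automatic for probability measures. It is left out of the hypothesis
  -- because moments will come from Laplace transforms, which are known for λ > 0 only.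
  have h' : ∀ n : ℕ, ∫ y, (y : ℝ) ^ n ∂m = ∫ y, (y : ℝ) ^ n ∂m' := by
    intro n
    rcases Nat.eq_zero_or_pos n with rfl | hn
    · simp
    · exact h n hn
  refine ext_of_forall_integral_eq_of_IsFiniteMeasure fun f => ?_
  refine eq_of_forall_dist_le fun ε hε => ?_
  obtain ⟨P, hP⟩ := exists_polynomial_near_continuousMap 0 1 f.toContinuousMap (ε / 2) (half_pos hε)
  have hb : ∀ (μ : Measure (Icc (0 : ℝ) 1)) [IsProbabilityMeasure μ],
      dist (∫ y, f y ∂μ) (∫ y, P.eval (y : ℝ) ∂μ) ≤ ε / 2 := by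
    intro μ _
    have hPi : Integrable (fun y : Icc (0 : ℝ) 1 => P.eval (y : ℝ)) μ :=
      (BoundedContinuousFunction.mkOfCompact
        ⟨fun y : Icc (0 : ℝ) 1 => P.eval (y : ℝ), by fun_prop⟩).integrable μ
    rw [dist_eq_norm, ← integral_sub (f.integrable μ) hPi]
    refine (norm_integral_le_of_norm_le_const (C := ε / 2) (Eventually.of_forall fun y => ?_)).trans
      (by simp)
    have := (ContinuousMap.norm_coe_le_norm (P.toContinuousMapOn (Icc 0 1) - f.toContinuousMap) y)
    rw [← norm_neg]
    simp only [neg_sub]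
    exact this.trans hP.le
  have e : ∫ y, P.eval (y : ℝ) ∂m = ∫ y, P.eval (y : ℝ) ∂m' := by
    rw [integral_polynomial_unitInterval, integral_polynomial_unitInterval]
    simp only [h']
  calc dist (∫ y, f y ∂m) (∫ y, f y ∂m')
      ≤ dist (∫ y, f y ∂m) (∫ y, P.eval (y : ℝ) ∂m) +
        dist (∫ y, P.eval (y : ℝ) ∂m) (∫ y, f y ∂m') := dist_triangle _ _ _
    _ ≤ ε / 2 + ε / 2 := by
        refine add_le_add (hb m) ?_
        rw [e, dist_comm]
        exact hb m'
    _ = ε := add_halves ε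

/-- Probability measures on [0, 1] form a compact space, so every ultrafilter finer than `l` yields
a limit, and the limiting moments identify all these limits. -/
theorem exists_tendsto_of_moments {ι : Type*} {l : Filter ι} [NeBot l]
    {m : ι → ProbabilityMeasure (Icc (0 : ℝ) 1)} {a : ℕ → ℝ}
    (h : ∀ n : ℕ, 0 < n → Tendsto (fun i => ∫ y, (y : ℝ) ^ n ∂(m i : Measure (Icc (0 : ℝ) 1))) l (𝓝 (a n))) :
    ∃ M, Tendsto m l (𝓝 M) := by
  have key : ∀ U : Ultrafilter ι, ↑U ≤ l → ∃ M : ProbabilityMeasure (Icc (0 : ℝ) 1),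
      Tendsto m U (𝓝 M) ∧ ∀ n : ℕ, 0 < n → ∫ y, (y : ℝ) ^ n ∂(M : Measure (Icc (0 : ℝ) 1)) = a n := by
    intro U hU
    obtain ⟨M, -, hM⟩ := isCompact_univ.ultrafilter_le_nhds (U.map m) (by simp)
    refine ⟨M, hM, fun n hn => tendsto_nhds_unique ?_ ((h n hn).mono_left hU)⟩
    have := (ProbabilityMeasure.tendsto_iff_forall_integral_tendsto.1 hM)
      (BoundedContinuousFunction.mkOfCompact ⟨fun y : Icc (0 : ℝ) 1 => (y : ℝ) ^ n, by fun_prop⟩)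
    exact this
  obtain ⟨M, -, hM⟩ := key (Ultrafilter.of l) (Ultrafilter.of_le l)
  refine ⟨M, (tendsto_iff_ultrafilter _ _ _).2 fun U hU => ?_⟩
  obtain ⟨M', h1, h2⟩ := key U hU
  have : M = M' := by
    have := M.2
    have := M'.2
    exact Subtype.ext (ext_of_moments fun n hn => (hM n hn).trans (h2 n hn).symm)
  rw [this]
  exact h1

/-- The map `x ↦ e^{-x}` from `[0, ∞)` to `[0, 1]`. -/
noncomputable def expNeg (x : ℝ) : Icc (0 : ℝ) 1 :=
  -- Truncation at 0 makes the map total and continuous; laws on [0, ∞) do not see it.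
  ⟨Real.exp (-(max x 0)), (Real.exp_pos _).le, Real.exp_le_one_iff.2 (by simp)⟩

theorem continuous_expNeg : Continuous expNeg := by
  unfold expNeg
  fun_prop

theorem expNeg_of_nonneg {x : ℝ} (hx : 0 ≤ x) : (expNeg x : ℝ) = Real.exp (-x) := by
  simp [expNeg, max_eq_left hx]

theorem ae_nonneg_of_Iio {m : Measure ℝ} (h : m (Iio 0) = 0) : ∀ᵐ x ∂m, 0 ≤ x := by
  filter_upwards [measure_eq_zero_iff_ae_notMem.1 h] with x hx
  exact not_lt.1 hx

theorem integral_expNeg_rpow {m : Measure ℝ} (h : m (Iio 0) = 0) (lam : ℝ) :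
    ∫ y, (y : ℝ) ^ lam ∂(m.map expNeg) = ∫ x, Real.exp (-lam * x) ∂m := by
  rw [integral_map continuous_expNeg.measurable.aemeasurable
    (Measurable.aestronglyMeasurable (by fun_prop))]
  refine integral_congr_ae ?_
  filter_upwards [ae_nonneg_of_Iio h] with x hx
  rw [expNeg_of_nonneg hx, ← Real.exp_mul]
  ring_nf

theorem integral_expNeg_pow {m : Measure ℝ} (h : m (Iio 0) = 0) (n : ℕ) :
    ∫ y, (y : ℝ) ^ n ∂(m.map expNeg) = ∫ x, Real.exp (-(n : ℝ) * x) ∂m := by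
  rw [← integral_expNeg_rpow h]
  simp

/-- Under x ↦ e^{-x} the transform at λ = n becomes the n-th moment of a law on [0, 1], and -log
recovers the original law. -/
theorem HasLaplaceTransform.ext {D D' : Measure ℝ} {φ φ' : ℝ → ℝ} (h : HasLaplaceTransform D φ)
    (h' : HasLaplaceTransform D' φ') (hφ : ∀ lam, 0 < lam → φ lam = φ' lam) : D = D' := by
  obtain ⟨hD, h0, hl⟩ := h
  obtain ⟨hD', h0', hl'⟩ := h'
  have := Measure.isProbabilityMeasure_map (μ := D) continuous_expNeg.measurable.aemeasurable
  have := Measure.isProbabilityMeasure_map (μ := D') continuous_expNeg.measurable.aemeasurable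
  have e : D.map expNeg = D'.map expNeg := by
    refine ext_of_moments fun n hn => ?_
    have hn' : (0 : ℝ) < n := by exact_mod_cast hn
    rw [integral_expNeg_pow h0, integral_expNeg_pow h0', hl _ hn', hl' _ hn', hφ _ hn']
  have hlog : Measurable fun y : Icc (0 : ℝ) 1 => -Real.log y := by fun_prop
  have hrec : ∀ m : Measure ℝ, m (Iio 0) = 0 →
      m = (m.map expNeg).map fun y : Icc (0 : ℝ) 1 => -Real.log y := by
    intro m hm
    rw [Measure.map_map hlog continuous_expNeg.measurable]
    conv_lhs => rw [← Measure.map_id (μ := m)]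
    refine Measure.map_congr ?_
    filter_upwards [ae_nonneg_of_Iio hm] with x hx
    simp [expNeg_of_nonneg hx]
  rw [hrec D h0, hrec D' h0', e]

theorem HasLaplaceTransform.congr {D : Measure ℝ} {φ φ' : ℝ → ℝ} (h : HasLaplaceTransform D φ)
    (hφ : ∀ lam, 0 < lam → φ lam = φ' lam) : HasLaplaceTransform D φ' :=
  ⟨h.1, h.2.1, fun lam hlam => (h.2.2 lam hlam).trans (hφ lam hlam)⟩

/-- As λ ↓ 0, y^λ tends to the indicator of y > 0, so the limit of φ at 0 is the mass off 0. In the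
coordinate x = -log y this says that no mass escapes to infinity. -/
theorem measure_zero_of_tendsto_integral_rpow {M : Measure (Icc (0 : ℝ) 1)} [IsProbabilityMeasure M]
    {φ : ℝ → ℝ} (h : ∀ lam, 0 < lam → ∫ y, (y : ℝ) ^ lam ∂M = φ lam)
    (hφ : Tendsto φ (𝓝[>] 0) (𝓝 1)) :
    ∀ᵐ y : Icc (0 : ℝ) 1 ∂M, (0 : ℝ) < y := by
  have hu : Tendsto (fun n : ℕ => 1 / ((n : ℝ) + 1)) atTop (𝓝[>] 0) :=
    tendsto_nhdsWithin_iff.2 ⟨tendsto_one_div_add_atTop_nhds_zero_nat,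
      Eventually.of_forall fun n => mem_Ioi.2 (by positivity)⟩
  have h1 := hφ.comp hu
  have hset : MeasurableSet {y : Icc (0 : ℝ) 1 | (0 : ℝ) < y} :=
    measurableSet_lt measurable_const measurable_subtype_coe
  have h2 : Tendsto (fun n : ℕ => ∫ y : Icc (0 : ℝ) 1, (y : ℝ) ^ (1 / ((n : ℝ) + 1)) ∂M) atTop
      (𝓝 (∫ y : Icc (0 : ℝ) 1, {y : Icc (0 : ℝ) 1 | (0 : ℝ) < y}.indicator 1 y ∂M)) := by
    refine tendsto_integral_of_dominated_convergence (fun _ => 1)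
      (fun n => Measurable.aestronglyMeasurable (by fun_prop)) (integrable_const 1)
      (fun n => Eventually.of_forall fun y => ?_) (Eventually.of_forall fun y => ?_)
    · rw [Real.norm_of_nonneg (Real.rpow_nonneg y.2.1 _)]
      exact Real.rpow_le_one y.2.1 y.2.2 (by positivity)
    · rcases y.2.1.eq_or_lt with hy | hy
      · rw [indicator_of_notMem (show y ∉ {y : Icc (0 : ℝ) 1 | (0 : ℝ) < y} from not_lt.2 hy.ge)]
        refine tendsto_const_nhds.congr fun n => ?_
        rw [← hy, Real.zero_rpow (by positivity)]
      · rw [indicator_of_mem (show y ∈ {y : Icc (0 : ℝ) 1 | (0 : ℝ) < y} from hy)]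
        have := (Real.continuousAt_const_rpow hy.ne' (b := 0)).tendsto.comp
          (tendsto_one_div_add_atTop_nhds_zero_nat (𝕜 := ℝ))
        rw [Real.rpow_zero] at this
        exact this
  have h3 := tendsto_nhds_unique h2 (h1.congr fun n => (h _ (by positivity)).symm)
  rw [integral_indicator_one hset] at h3
  have h4 : M {y : Icc (0 : ℝ) 1 | (0 : ℝ) < y} = 1 := by
    rw [measureReal_def] at h3
    rwa [← ENNReal.toReal_eq_one_iff]
  exact (prob_compl_eq_zero_iff hset).2 h4

/-- The continuity theorem for Laplace transforms. -/
theorem exists_laplace_limit {ι : Type*} {l : Filter ι} [NeBot l] {m : ι → Measure ℝ}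
    {φ : ℝ → ℝ} (hm : ∀ᶠ i in l, IsProbabilityMeasure (m i) ∧ m i (Iio 0) = 0)
    (hφ : ∀ lam, 0 < lam → Tendsto (fun i => ∫ x, Real.exp (-lam * x) ∂(m i)) l (𝓝 (φ lam)))
    (hφ0 : Tendsto φ (𝓝[>] 0) (𝓝 1)) :
    ∃ D, HasLaplaceTransform D φ ∧
      ∀ x, D {x} = 0 → Tendsto (fun i => (m i).real (Iic x)) l (𝓝 (D.real (Iic x))) := by
  classical
  set pm : ι → ProbabilityMeasure (Icc (0 : ℝ) 1) := fun i =>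
    if h : IsProbabilityMeasure (m i) then
      ⟨(m i).map expNeg, Measure.isProbabilityMeasure_map continuous_expNeg.measurable.aemeasurable⟩
    else ⟨Measure.dirac ⟨0, by simp⟩, inferInstance⟩
  have hpm : ∀ᶠ i in l, m i (Iio 0) = 0 ∧ (pm i : Measure (Icc (0 : ℝ) 1)) = (m i).map expNeg := by
    filter_upwards [hm] with i ⟨h1, h2⟩
    refine ⟨h2, ?_⟩
    rw [show pm i = _ from dif_pos h1]
    rfl
  obtain ⟨M, hM⟩ := exists_tendsto_of_moments (m := pm) (l := l) (a := fun n => φ n) (by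
    intro n hn
    refine (hφ n (by exact_mod_cast hn)).congr' ?_
    filter_upwards [hpm] with i ⟨h1, h2⟩
    rw [h2, integral_expNeg_pow h1])
  have hMφ : ∀ lam, 0 < lam → ∫ y, (y : ℝ) ^ lam ∂(M : Measure (Icc (0 : ℝ) 1)) = φ lam := by
    intro lam hlam
    have hc : Continuous fun y : Icc (0 : ℝ) 1 => (y : ℝ) ^ lam :=
      (Real.continuous_rpow_const hlam.le).comp continuous_subtype_val
    refine tendsto_nhds_unique ((ProbabilityMeasure.tendsto_iff_forall_integral_tendsto.1 hM)
      (BoundedContinuousFunction.mkOfCompact ⟨_, hc⟩)) ((hφ lam hlam).congr' ?_)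
    filter_upwards [hpm] with i ⟨h1, h2⟩
    rw [h2, ← integral_expNeg_rpow h1]
    rfl
  have hpos := measure_zero_of_tendsto_integral_rpow hMφ hφ0
  have hlog : Measurable fun y : Icc (0 : ℝ) 1 => -Real.log y := by fun_prop
  refine ⟨(M : Measure (Icc (0 : ℝ) 1)).map fun y : Icc (0 : ℝ) 1 => -Real.log y,
    ⟨Measure.isProbabilityMeasure_map hlog.aemeasurable, ?_, fun lam hlam => ?_⟩, fun x hx => ?_⟩
  · rw [Measure.map_apply hlog measurableSet_Iio]
    convert measure_empty (μ := (M : Measure (Icc (0 : ℝ) 1)))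
    ext y
    simp only [mem_preimage, mem_Iio, mem_empty_iff_false, iff_false, not_lt, Left.nonneg_neg_iff]
    exact Real.log_nonpos y.2.1 y.2.2
  · rw [integral_map hlog.aemeasurable (Measurable.aestronglyMeasurable (by fun_prop)),
      ← hMφ lam hlam]
    refine integral_congr_ae ?_
    filter_upwards [hpos] with y hy
    rw [Real.rpow_def_of_pos hy]
    ring_nf
  · rw [Measure.map_apply hlog (measurableSet_singleton x)] at hx
    rw [measureReal_def, Measure.map_apply hlog measurableSet_Iic]
    rcases lt_or_ge x 0 with hx0 | hx0
    · have e1 : (fun y : Icc (0 : ℝ) 1 => -Real.log y) ⁻¹' Iic x = ∅ := by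
        ext y
        simp only [mem_preimage, mem_Iic, mem_empty_iff_false, iff_false, not_le]
        have := Real.log_nonpos y.2.1 y.2.2
        linarith
      rw [e1, measure_empty, ENNReal.toReal_zero]
      refine tendsto_const_nhds.congr' ?_
      filter_upwards [hm] with i ⟨h1, h2⟩
      rw [measureReal_def, measure_mono_null (Iic_subset_Iio.2 hx0) h2, ENNReal.toReal_zero]
    · set A := {y : Icc (0 : ℝ) 1 | Real.exp (-x) ≤ y}
      have hA : MeasurableSet A := measurableSet_le measurable_const measurable_subtype_coe
      -- The two sets differ at most at y = 0, where `Real.log` has the default value 0; that point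
      -- is null for M.
      have e1 : (M : Measure (Icc (0 : ℝ) 1)) ((fun y : Icc (0 : ℝ) 1 => -Real.log y) ⁻¹' Iic x) =
          (M : Measure (Icc (0 : ℝ) 1)) A := by
        refine measure_congr ?_
        filter_upwards [hpos] with y hy
        refine propext ?_
        change -Real.log y ≤ x ↔ Real.exp (-x) ≤ y
        rw [← Real.le_log_iff_exp_le hy, neg_le]
      -- The frontier is contained in {e^{-x}}, whose mass is bounded by that of x under the limit
      -- law.
      have hfr : (M : Measure (Icc (0 : ℝ) 1)) (frontier A) = 0 := by
        refine measure_mono_null ?_ hx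
        refine (frontier_le_subset_eq continuous_const continuous_subtype_val).trans ?_
        intro y hy
        have hy : Real.exp (-x) = y := hy
        simp [← hy]
      have := ProbabilityMeasure.tendsto_measure_of_null_frontier_of_tendsto' hM hfr
      rw [e1]
      refine ((ENNReal.tendsto_toReal (measure_ne_top _ _)).comp this).congr' ?_
      filter_upwards [hpm] with i ⟨h1, h2⟩
      rw [Function.comp_apply, h2, Measure.map_apply continuous_expNeg.measurable hA,
        measureReal_def]
      congr 2
      ext u
      simp only [A, expNeg, mem_preimage, mem_ofPred_eq, Real.exp_le_exp, neg_le_neg_iff, mem_Iic,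
        max_le_iff, hx0, and_true]

/-! ### Laws without atoms -/

theorem exp_neg_mul_le_one {lam x : ℝ} (hlam : 0 ≤ lam) (hx : 0 ≤ x) : Real.exp (-lam * x) ≤ 1 := by
  rw [Real.exp_le_one_iff, neg_mul, Left.neg_nonpos_iff]
  positivity

theorem integrable_exp_neg_mul {m : Measure ℝ} [IsFiniteMeasure m] (h0 : m (Iio 0) = 0) {lam : ℝ}
    (hlam : 0 < lam) : Integrable (fun x => Real.exp (-lam * x)) m := by
  refine Integrable.of_bound (C := 1) (Measurable.aestronglyMeasurable (by fun_prop)) ?_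
  filter_upwards [ae_nonneg_of_Iio h0] with x hx
  rw [Real.norm_of_nonneg (Real.exp_pos _).le]
  exact exp_neg_mul_le_one hlam.le hx

theorem HasLaplaceTransform.measure_zero {D : Measure ℝ} {φ : ℝ → ℝ} (h : HasLaplaceTransform D φ)
    (hφ : Tendsto φ atTop (𝓝 0)) : D {0} = 0 := by
  obtain ⟨hD, h0, hl⟩ := h
  have h1 : D.real {0} ≤ 0 := by
    refine ge_of_tendsto hφ ?_
    filter_upwards [eventually_gt_atTop 0] with lam hlam
    rw [← hl lam hlam, ← integral_indicator_one (measurableSet_singleton 0)]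
    refine integral_mono ((integrable_const 1).indicator (measurableSet_singleton 0))
      (integrable_exp_neg_mul h0 hlam) fun x => ?_
    refine indicator_le' (fun y hy => ?_) (fun y _ => (Real.exp_pos _).le) x
    rw [mem_singleton_iff.1 hy]
    simp
  have h2 := le_antisymm h1 measureReal_nonneg
  rwa [measureReal_eq_zero_iff] at h2

/-- The law is that of U^κ X with U ~ ν independent of X. For fixed x ≠ 0 the map u ↦ u^κ x is
injective on u > 0, so the diffuse law of U leaves no atom. -/
theorem HasLaplaceTransform.exists_scale_mixture {X : Measure ℝ} {φ : ℝ → ℝ}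
    (h : HasLaplaceTransform X φ) (hX0 : X {0} = 0) (ν : Measure ℝ) [IsProbabilityMeasure ν]
    [NullSingletonClass ν] (hν : ∀ᵐ u ∂ν, 0 < u) {κ : ℝ} (hκ : 0 < κ) :
    ∃ D, HasLaplaceTransform D (fun lam => ∫ u, φ (lam * u ^ κ) ∂ν) ∧ ∀ x, D {x} = 0 := by
  obtain ⟨hX, h0, hl⟩ := h
  have hm : Measurable fun z : ℝ × ℝ => z.2 ^ κ * z.1 := by fun_prop
  have hnn : ∀ᵐ z ∂(X.prod ν), 0 ≤ z.1 ∧ 0 < z.2 := by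
    have h1 : ∀ᵐ z ∂(X.prod ν), 0 ≤ z.1 :=
      Measure.quasiMeasurePreserving_fst.ae (ae_nonneg_of_Iio h0)
    have h2 : ∀ᵐ z ∂(X.prod ν), 0 < z.2 := Measure.quasiMeasurePreserving_snd.ae hν
    exact h1.and h2
  refine ⟨(X.prod ν).map fun z => z.2 ^ κ * z.1,
    ⟨Measure.isProbabilityMeasure_map hm.aemeasurable, ?_, fun lam hlam => ?_⟩, fun a => ?_⟩
  · rw [Measure.map_apply hm measurableSet_Iio]
    refine measure_mono_null ?_ (ae_iff.1 hnn)
    intro z hz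
    rw [mem_ofPred_eq]
    rintro ⟨h1, h2⟩
    exact absurd (show z.2 ^ κ * z.1 < 0 from hz) (not_lt.2 (by positivity))
  · rw [integral_map hm.aemeasurable (Measurable.aestronglyMeasurable (by fun_prop)),
      integral_prod_symm]
    · refine integral_congr_ae ?_
      filter_upwards [hν] with u hu
      have hu' := Real.rpow_pos_of_pos hu κ
      rw [← hl _ (mul_pos hlam hu')]
      refine integral_congr_ae (Eventually.of_forall fun x => ?_)
      simp only
      ring_nf
    · refine Integrable.of_bound (C := 1) (Measurable.aestronglyMeasurable (by fun_prop)) ?_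
      filter_upwards [hnn] with z ⟨h1, h2⟩
      rw [Real.norm_of_nonneg (Real.exp_pos _).le]
      exact exp_neg_mul_le_one hlam.le (by positivity)
  · have hs : MeasurableSet ((fun z : ℝ × ℝ => z.2 ^ κ * z.1) ⁻¹' {a}) :=
      hm (measurableSet_singleton a)
    rw [Measure.map_apply hm (measurableSet_singleton a), Measure.measure_prod_null hs]
    filter_upwards [measure_eq_zero_iff_ae_notMem.1 hX0] with x hx
    have hx : x ≠ 0 := hx
    have hsub : (Prod.mk x ⁻¹' ((fun z : ℝ × ℝ => z.2 ^ κ * z.1) ⁻¹' {a})) ⊆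
        {u | 0 < u ∧ u ^ κ * x = a} ∪ {u | ¬ 0 < u} := by
      intro u hu
      by_cases h : 0 < u
      · exact Or.inl ⟨h, hu⟩
      · exact Or.inr h
    refine measure_mono_null hsub (measure_union_null (Set.Subsingleton.measure_zero ?_ ν)
      (ae_iff.1 hν))
    rintro u ⟨hu, hu'⟩ v ⟨hv, hv'⟩
    have := mul_right_cancel₀ hx (hu'.trans hv'.symm)
    exact (Real.rpow_left_inj hu.le hv.le hκ.ne').1 this

theorem HasLaplaceTransform.map_add_mul {D D' : Measure ℝ} {φ φ' : ℝ → ℝ}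
    (h : HasLaplaceTransform D φ) (h' : HasLaplaceTransform D' φ') {c : ℝ} (hc : 0 < c) :
    HasLaplaceTransform ((D.prod D').map fun z => c * (z.1 + z.2))
      (fun lam => φ (lam * c) * φ' (lam * c)) := by
  obtain ⟨hD, h0, hl⟩ := h
  obtain ⟨hD', h0', hl'⟩ := h'
  have hm : Measurable fun z : ℝ × ℝ => c * (z.1 + z.2) := by fun_prop
  have hnn : ∀ᵐ z ∂(D.prod D'), 0 ≤ z.1 ∧ 0 ≤ z.2 := by
    have h1 : ∀ᵐ z ∂(D.prod D'), 0 ≤ z.1 :=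
      Measure.quasiMeasurePreserving_fst.ae (ae_nonneg_of_Iio h0)
    have h2 : ∀ᵐ z ∂(D.prod D'), 0 ≤ z.2 :=
      Measure.quasiMeasurePreserving_snd.ae (ae_nonneg_of_Iio h0')
    exact h1.and h2
  refine ⟨Measure.isProbabilityMeasure_map hm.aemeasurable, ?_, fun lam hlam => ?_⟩
  · rw [Measure.map_apply hm measurableSet_Iio]
    refine measure_mono_null ?_ (ae_iff.1 hnn)
    intro z hz
    rw [mem_ofPred_eq]
    rintro ⟨h1, h2⟩
    exact absurd (show c * (z.1 + z.2) < 0 from hz) (not_lt.2 (by positivity))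
  · beta_reduce
    rw [integral_map hm.aemeasurable (Measurable.aestronglyMeasurable (by fun_prop)),
      ← hl _ (mul_pos hlam hc), ← hl' _ (mul_pos hlam hc), ← integral_prod_mul]
    refine integral_congr_ae (Eventually.of_forall fun z => ?_)
    simp only
    rw [← Real.exp_add]
    ring_nf

theorem prod_map_add_singleton {D D' : Measure ℝ} [SFinite D] [SFinite D'] {c : ℝ} (hc : c ≠ 0)
    (a : ℝ) :
    ((D.prod D').map fun z => c * (z.1 + z.2)) {a} = ∫⁻ x, D' {a / c - x} ∂D := by
  have hm : Measurable fun z : ℝ × ℝ => c * (z.1 + z.2) := by fun_prop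
  rw [Measure.map_apply hm (measurableSet_singleton a),
    Measure.prod_apply (hm (measurableSet_singleton a))]
  refine lintegral_congr fun x => ?_
  congr 1
  ext y
  simp only [mem_preimage, mem_singleton_iff]
  constructor
  · intro h
    rw [← h]
    field_simp
    ring
  · rintro rfl
    field_simp
    ring

/-- The law of a sum of `n` independent copies. -/
noncomputable def convPow (D : Measure ℝ) : ℕ → Measure ℝ
  | 0 => Measure.dirac 0
  | n + 1 => ((convPow D n).prod D).map fun z => 1 * (z.1 + z.2)

theorem HasLaplaceTransform.convPow {D : Measure ℝ} {φ : ℝ → ℝ} (h : HasLaplaceTransform D φ)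
    (n : ℕ) : HasLaplaceTransform (convPow D n) (fun lam => φ lam ^ n) := by
  induction n with
  | zero =>
    refine ⟨inferInstanceAs (IsProbabilityMeasure (Measure.dirac 0)), ?_, fun lam _ => ?_⟩
    · simp [_root_.convPow]
    · simp [_root_.convPow]
  | succ n ih =>
    refine (ih.map_add_mul h one_pos).congr fun lam _ => ?_
    rw [mul_one, pow_succ]

/-- A Poisson(c) number of independent summands with law D, conditioned on being positive, has this
transform. Conditioning removes the empty sum, the only possible source of an atom; every other sum
contains an atomless term. -/
theorem HasLaplaceTransform.exists_compound_poisson {D : Measure ℝ} {φ : ℝ → ℝ}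
    (h : HasLaplaceTransform D φ) (hna : ∀ x, D {x} = 0) {c : ℝ} (hc : 0 < c) :
    ∃ E, HasLaplaceTransform E
      (fun lam => (Real.exp (c * φ lam) - 1) / (Real.exp c - 1)) ∧ ∀ x, E {x} = 0 := by
  have hD := h.1
  have hcp := fun n => (h.convPow n).1
  have hec : 0 < Real.exp c - 1 := sub_pos.2 (Real.one_lt_exp_iff.2 hc)
  -- `w n` is the zero-truncated Poisson probability of n + 1 summands.
  set w : ℕ → ℝ := fun n => c ^ (n + 1) / (n + 1).factorial / (Real.exp c - 1)
  have hw0 : ∀ n, 0 ≤ w n := fun n => by positivity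
  have hsum : ∀ y : ℝ, HasSum (fun n : ℕ => w n * y ^ (n + 1))
      ((Real.exp (c * y) - 1) / (Real.exp c - 1)) := by
    intro y
    have h1 : HasSum (fun n : ℕ => (c * y) ^ n / n.factorial) (Real.exp (c * y)) := by
      rw [Real.exp_eq_exp_ℝ]
      exact NormedSpace.expSeries_div_hasSum_exp (c * y)
    have h2 := (hasSum_nat_add_iff' 1).2 h1
    simp only [Finset.range_one, Finset.sum_singleton, pow_zero, Nat.factorial_zero, Nat.cast_one,
      div_one] at h2
    refine (h2.div_const (Real.exp c - 1)).congr_fun ?_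
    intro n
    simp only [w, mul_pow]
    ring
  have hw1 : HasSum w 1 := by
    have := hsum 1
    simp only [one_pow, mul_one] at this
    rwa [div_self hec.ne'] at this
  set E : Measure ℝ := Measure.sum fun n => ENNReal.ofReal (w n) • _root_.convPow D (n + 1)
  have hE0 : E (Iio 0) = 0 := by
    rw [Measure.sum_apply_eq_zero]
    intro n
    rw [Measure.smul_apply, (h.convPow (n + 1)).2.1, smul_zero]
  have hEp : IsProbabilityMeasure E := by
    refine ⟨?_⟩
    rw [Measure.sum_apply _ MeasurableSet.univ]
    simp only [Measure.smul_apply, measure_univ, smul_eq_mul, mul_one]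
    rw [← ENNReal.ofReal_tsum_of_nonneg hw0 hw1.summable, hw1.tsum_eq, ENNReal.ofReal_one]
  refine ⟨E, ⟨hEp, hE0, fun lam hlam => ?_⟩, fun x => ?_⟩
  · have h1 := hasSum_integral_measure (integrable_exp_neg_mul hE0 hlam)
    refine h1.unique ((hsum (φ lam)).congr_fun fun n => ?_)
    rw [integral_smul_measure, ENNReal.toReal_ofReal (hw0 n), (h.convPow (n + 1)).2.2 lam hlam,
      smul_eq_mul]
  · rw [Measure.sum_apply_eq_zero]
    intro n
    rw [Measure.smul_apply, _root_.convPow, prod_map_add_singleton one_ne_zero]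
    simp [hna]

/-- D is the law of c(X + X') for independent copies. An atom of maximal mass at x₀ averages the
masses at x₀/c - x, so almost all of these are maximal too. There are finitely many maximal atoms,
so D would be bounded above, which contradicts the behaviour of the transform at 0 when α < 1. -/
theorem HasLaplaceTransform.stable_noAtoms {D : Measure ℝ} {α : ℝ} (hα0 : 0 < α) (hα1 : α < 1)
    (h : HasLaplaceTransform D fun lam => Real.exp (-(lam ^ α))) (a : ℝ) : D {a} = 0 := by
  have hD := h.1
  -- Chosen so that 2(cλ)^α = λ^α.
  set c : ℝ := (2 : ℝ) ^ (-α⁻¹)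
  have hc : 0 < c := by positivity
  have hcα : c ^ α = 1 / 2 := by
    rw [← Real.rpow_mul zero_le_two, neg_mul, inv_mul_cancel₀ hα0.ne', Real.rpow_neg_one, one_div]
  have hself : D = (D.prod D).map fun z => c * (z.1 + z.2) := by
    refine h.ext (h.map_add_mul h hc) fun lam hlam => ?_
    rw [← Real.exp_add, Real.mul_rpow hlam.le hc.le, hcα]
    ring_nf
  by_contra ha
  have hfin : ∀ ε : ENNReal, 0 < ε → {x : ℝ | ε ≤ D {x}}.Finite := fun ε hε =>
    Measure.finite_const_le_meas_of_disjoint_iUnion D hε (fun x => measurableSet_singleton x)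
      (fun x y hxy => by simpa using hxy) (measure_ne_top _ _)
  obtain ⟨x₀, hx₀, hmax⟩ := (hfin _ (pos_iff_ne_zero.2 ha)).exists_maximalFor (fun x => D {x}) _
    ⟨a, le_refl (D {a})⟩
  have hle : ∀ x, D {x} ≤ D {x₀} := by
    intro x
    rcases le_total (D {x}) (D {x₀}) with h1 | h1
    · exact h1
    · exact hmax (hx₀.trans h1 : D {a} ≤ D {x}) h1
  have hpos : 0 < D {x₀} := (pos_iff_ne_zero.2 ha).trans_le hx₀
  have hint : ∫⁻ _, D {x₀} ∂D ≤ ∫⁻ x, D {x₀ / c - x} ∂D := by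
    rw [← prod_map_add_singleton hc.ne' x₀, ← hself]
    simp
  have hae := ae_eq_of_ae_le_of_lintegral_le (Eventually.of_forall fun x => hle (x₀ / c - x))
    (by
      refine ne_top_of_le_ne_top ?_ (lintegral_mono fun x => hle (x₀ / c - x))
      simp) aemeasurable_const hint
  obtain ⟨B, hB⟩ := (hfin _ hpos).bddBelow
  have hbd : ∀ᵐ x ∂D, x ≤ x₀ / c - B := by
    filter_upwards [hae] with x hx
    have := hB (show x₀ / c - x ∈ {x : ℝ | D {x₀} ≤ D {x}} from hx.ge)
    linarith
  set M := x₀ / c - B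
  -- If X ≤ M almost surely, then e^{-λM} ≤ e^{-λ^α}, that is λ^α ≤ λM. This fails as λ ↓ 0.
  have hlow : ∀ lam : ℝ, 0 < lam → 1 ≤ lam ^ (1 - α) * M := by
    intro lam hlam
    have h1 : Real.exp (-lam * M) ≤ Real.exp (-(lam ^ α)) := by
      rw [show Real.exp (-(lam ^ α)) = _ from (h.2.2 lam hlam).symm]
      have : ∫ _, Real.exp (-lam * M) ∂D ≤ ∫ x, Real.exp (-lam * x) ∂D := by
        refine integral_mono_ae (integrable_const _) (integrable_exp_neg_mul h.2.1 hlam) ?_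
        filter_upwards [hbd] with x hx
        rw [Real.exp_le_exp]
        nlinarith
      simpa using this
    rw [Real.exp_le_exp] at h1
    have hl := Real.rpow_pos_of_pos hlam α
    rw [Real.rpow_sub hlam, Real.rpow_one, div_mul_eq_mul_div, one_le_div hl]
    linarith
  have hlim : Tendsto (fun lam : ℝ => lam ^ (1 - α) * M) (𝓝[>] 0) (𝓝 (0 ^ (1 - α) * M)) :=
    (((Real.continuousAt_rpow_const 0 (1 - α) (Or.inr (by linarith))).tendsto.mono_left
      nhdsWithin_le_nhds).mul_const M)
  rw [Real.zero_rpow (by linarith), zero_mul] at hlim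
  have := ge_of_tendsto hlim (by
    filter_upwards [self_mem_nhdsWithin] with lam hlam using hlow lam hlam)
  linarith

/-! ### Family trees -/

/-- The tree with root data `z` whose `i`-th child founds the tree `η i`. -/
def graft {X : Type*} (z : X) (η : ℕ → List ℕ → X) : List ℕ → X
  | [] => z
  | i :: w => η i w

theorem measurable_graft {X : Type*} [MeasurableSpace X] :
    Measurable fun x : X × (ℕ → List ℕ → X) => graft x.1 x.2 := by
  refine measurable_pi_lambda _ fun u => ?_
  cases u with
  | nil => exact measurable_fst
  | cons i w =>
    exact (measurable_pi_apply w).comp ((measurable_pi_apply i).comp measurable_snd)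

/-- The law of a family of independent data with law `ρ` attached to all labels. -/
noncomputable def treeLaw {X : Type*} [MeasurableSpace X] (ρ : Measure X) : Measure (List ℕ → X) :=
  Measure.infinitePi fun _ => ρ

section TreeLaw

variable {X : Type*} [MeasurableSpace X] (ρ : Measure X) [IsProbabilityMeasure ρ]

instance : IsProbabilityMeasure (treeLaw ρ) :=
  inferInstanceAs (IsProbabilityMeasure (Measure.infinitePi fun _ => ρ))

theorem cons_pair_injective : Function.Injective fun x : ℕ × List ℕ => x.1 :: x.2 := by
  rintro ⟨i, v⟩ ⟨j, w⟩ h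
  simpa using h

/-- The subtrees of the children are independent copies of the whole tree. -/
theorem treeLaw_eq_map_graft :
    (ρ.prod (Measure.infinitePi fun _ : ℕ => treeLaw ρ)).map (fun x => graft x.1 x.2) =
      treeLaw ρ := by
  classical
  refine Measure.eq_infinitePi _ fun s t ht => ?_
  -- It suffices to test cylinders. A cylinder splits into a condition on the root, `t₀`, and a
  -- cylinder over the pairs (i, w) that encode the nonempty labels i :: w.
  set s' := s.preimage (fun x : ℕ × List ℕ => x.1 :: x.2) cons_pair_injective.injOn
  set t₀ : Set X := if [] ∈ s then t [] else univ
  have hpre : (fun x : X × (ℕ → List ℕ → X) => graft x.1 x.2) ⁻¹' (Set.pi s t) =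
      t₀ ×ˢ ((MeasurableEquiv.curry ℕ (List ℕ) X).symm ⁻¹'
        Set.pi s' fun x => t (x.1 :: x.2)) := by
    ext ⟨z, η⟩
    simp only [mem_preimage, Set.mem_pi, mem_prod, Finset.mem_coe, s', Finset.mem_preimage]
    constructor
    · intro h
      refine ⟨?_, fun x hx => h _ hx⟩
      simp only [t₀]
      split_ifs with h0
      · exact h _ h0
      · trivial
    · rintro ⟨h1, h2⟩ u hu
      cases u with
      | nil =>
        simp only [t₀, if_pos hu] at h1
        exact h1
      | cons i w => exact h2 (i, w) hu
  rw [Measure.map_apply measurable_graft (.pi (Finset.countable_toSet s) fun i _ => ht i), hpre,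
    Measure.prod_prod, ← Measure.map_apply (MeasurableEquiv.measurable _)
      (.pi (Finset.countable_toSet s') fun i _ => ht _)]
  have e : (Measure.infinitePi fun _ : ℕ => treeLaw ρ) =
      Measure.infinitePi fun _ : ℕ => Measure.infinitePi fun _ : List ℕ => ρ := rfl
  rw [e, Measure.infinitePi_map_curry_symm (fun (_ : ℕ) (_ : List ℕ) => ρ),
    Measure.infinitePi_pi _ (fun i _ => ht _),
    Finset.prod_preimage' (fun x : ℕ × List ℕ => x.1 :: x.2) s cons_pair_injective.injOn
      (fun u => ρ (t u)), ← Finset.prod_filter_mul_prod_filter_not s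
      (fun u => u ∈ range fun x : ℕ × List ℕ => x.1 :: x.2), mul_comm]
  congr 1
  have hf : s.filter (fun u => ¬ u ∈ range fun x : ℕ × List ℕ => x.1 :: x.2) =
      if [] ∈ s then {[]} else ∅ := by
    ext u
    cases u with
    | nil => split_ifs with h <;> simp [h]
    | cons i w => split_ifs <;> simp
  rw [hf]
  simp only [t₀]
  split_ifs <;> simp

end TreeLaw

/-- The set of particles alive at time `t`. -/
def aliveSet (ζ : List ℕ → ℝ × ℕ) (t : ℝ) : Set (List ℕ) :=
  {u | Alive (fun u => (ζ u).1) (fun u => (ζ u).2) u t}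

/-- The population size at time `t` in terms of the joint data of the particles. -/
noncomputable def treePop (ζ : List ℕ → ℝ × ℕ) (t : ℝ) : ℕ :=
  population (fun u => (ζ u).1) (fun u => (ζ u).2) t

theorem nil_mem_aliveSet {ζ : List ℕ → ℝ × ℕ} {t : ℝ} :
    [] ∈ aliveSet ζ t ↔ 0 ≤ t ∧ t < (ζ []).1 := Iff.rfl

theorem cons_mem_aliveSet {ζ : List ℕ → ℝ × ℕ} {t : ℝ} {i : ℕ} {v : List ℕ} :
    i :: v ∈ aliveSet ζ t ↔ i < (ζ []).2 ∧ (ζ []).1 ≤ t ∧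
      v ∈ aliveSet (fun w => ζ (i :: w)) (t - (ζ []).1) := Iff.rfl

theorem measurableSet_aliveSet (u : List ℕ) :
    MeasurableSet {x : (List ℕ → ℝ × ℕ) × ℝ | u ∈ aliveSet x.1 x.2} := by
  induction u with
  | nil =>
    exact (measurableSet_le measurable_const measurable_snd).inter
      (measurableSet_lt measurable_snd (by fun_prop))
  | cons i v ih =>
    have h1 : MeasurableSet {x : (List ℕ → ℝ × ℕ) × ℝ | i < (x.1 []).2} :=
      measurableSet_lt measurable_const (by fun_prop)
    have h2 : MeasurableSet {x : (List ℕ → ℝ × ℕ) × ℝ | (x.1 []).1 ≤ x.2} :=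
      measurableSet_le (by fun_prop) measurable_snd
    have h3 : Measurable fun x : (List ℕ → ℝ × ℕ) × ℝ =>
        ((fun w => x.1 (i :: w)), x.2 - (x.1 []).1) := by fun_prop
    exact h1.inter (h2.inter (h3 ih))

open Classical in
/-- The number of particles alive at time `t` whose label satisfies `Q`. -/
noncomputable def aliveCount (Q : List ℕ → Prop) (ζ : List ℕ → ℝ × ℕ) (t : ℝ) : ENNReal :=
  ∑' u, if Q u ∧ u ∈ aliveSet ζ t then 1 else 0

theorem measurable_aliveCount (Q : List ℕ → Prop) :
    Measurable fun x : (List ℕ → ℝ × ℕ) × ℝ => aliveCount Q x.1 x.2 := by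
  classical
  refine Measurable.tsum fun u => ?_
  refine Measurable.ite ?_ measurable_const measurable_const
  exact (MeasurableSet.const (Q u)).inter (measurableSet_aliveSet u)

theorem aliveCount_true (ζ : List ℕ → ℝ × ℕ) (t : ℝ) :
    aliveCount (fun _ => True) ζ t = (aliveSet ζ t).encard := by
  classical
  rw [← ENNReal.tsum_set_one, tsum_subtype (aliveSet ζ t) fun _ => (1 : ENNReal), aliveCount]
  simp [indicator_apply]

/-- No finiteness is needed: `ncard` and `toReal` both send an infinite population to 0. -/
theorem treePop_eq_toReal (ζ : List ℕ → ℝ × ℕ) (t : ℝ) :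
    (treePop ζ t : ℝ) = (aliveCount (fun _ => True) ζ t).toReal := by
  rw [aliveCount_true]
  change (((aliveSet ζ t).ncard : ℕ) : ℝ) = _
  rcases (aliveSet ζ t).finite_or_infinite with h | h
  · rw [← h.cast_ncard_eq]
    simp
  · rw [h.ncard, h.encard_eq]
    simp

theorem measurable_treePop :
    Measurable fun x : (List ℕ → ℝ × ℕ) × ℝ => treePop x.1 x.2 := by
  refine measurable_to_countable' fun n => ?_
  have : (fun x : (List ℕ → ℝ × ℕ) × ℝ => treePop x.1 x.2) ⁻¹' {n} =
      (fun x : (List ℕ → ℝ × ℕ) × ℝ => (aliveCount (fun _ => True) x.1 x.2).toReal) ⁻¹'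
        {(n : ℝ)} := by
    ext x
    simp [← treePop_eq_toReal]
  rw [this]
  exact (measurable_aliveCount _).ennreal_toReal (measurableSet_singleton _)

theorem tsum_list (F : List ℕ → ENNReal) :
    ∑' u, F u = F [] + ∑' i, ∑' v, F (i :: v) := by
  classical
  rw [ENNReal.tsum_eq_add_tsum_ite [], ← ENNReal.tsum_prod (f := fun i v => F (i :: v)),
    ← cons_pair_injective.tsum_eq]
  · simp
  · intro u hu
    cases u with
    | nil => simp at hu
    | cons i v => exact ⟨(i, v), rfl⟩

theorem aliveCount_of_lt {Q : List ℕ → Prop} {z : ℝ × ℕ} {η : ℕ → List ℕ → ℝ × ℕ} {t : ℝ}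
    (ht : 0 ≤ t) (htz : t < z.1) (hQ : Q []) : aliveCount Q (graft z η) t = 1 := by
  classical
  rw [aliveCount, tsum_list]
  have h1 : ∀ i v, i :: v ∉ aliveSet (graft z η) t := by
    intro i v h
    exact absurd (cons_mem_aliveSet.1 h).2.1 (not_le.2 htz)
  have h2 : [] ∈ aliveSet (graft z η) t := ⟨ht, htz⟩
  simp [h1, h2, hQ]

/-- Branching at the first death, valid in [0, ∞] even for infinite populations. The predicate on
labels is carried along so that a bound on the generation can be lowered by one. -/
theorem aliveCount_of_le {Q : List ℕ → Prop} {z : ℝ × ℕ} {η : ℕ → List ℕ → ℝ × ℕ} {t : ℝ}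
    (htz : z.1 ≤ t) :
    aliveCount Q (graft z η) t =
      ∑ i ∈ Finset.range z.2, aliveCount (fun v => Q (i :: v)) (η i) (t - z.1) := by
  classical
  rw [aliveCount, tsum_list]
  have h2 : [] ∉ aliveSet (graft z η) t := fun h => absurd (nil_mem_aliveSet.1 h).2 (not_lt.2 htz)
  have h1 : ∀ i v, i :: v ∈ aliveSet (graft z η) t ↔ i < z.2 ∧ v ∈ aliveSet (η i) (t - z.1) :=
    fun i v => cons_mem_aliveSet.trans ⟨fun h => ⟨h.1, h.2.2⟩, fun h => ⟨h.1, htz, h.2⟩⟩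
  simp only [h2, and_false, if_false, zero_add, h1]
  rw [tsum_eq_sum (s := Finset.range z.2)]
  · refine Finset.sum_congr rfl fun i hi => ?_
    simp [aliveCount, Finset.mem_range.1 hi]
  · intro i hi
    simp [Finset.mem_range.not.1 hi]

section Moments

variable {e : Measure ℝ} {p : PMF ℕ} [IsProbabilityMeasure e]

theorem lintegral_eval_treeLaw {X : Type*} [MeasurableSpace X] (ρ : Measure X)
    [IsProbabilityMeasure ρ] {h : (List ℕ → X) → ENNReal} (hh : Measurable h) (i : ℕ) :
    ∫⁻ η : ℕ → List ℕ → X, h (η i) ∂(Measure.infinitePi fun _ : ℕ => treeLaw ρ) =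
      ∫⁻ ζ, h ζ ∂treeLaw ρ :=
  (measurePreserving_eval_infinitePi (fun _ : ℕ => treeLaw ρ) i).lintegral_comp hh

/-- Before its death the root counts 1; afterwards each child contributes at most 1 by induction,
and the mean number of children is at most 1. Truncating at a generation makes the induction
possible before non-explosion is known. -/
theorem lintegral_aliveCount_length_le (hmean : ∫⁻ n, (n : ENNReal) ∂p.toMeasure ≤ 1) (n : ℕ)
    {t : ℝ} (ht : 0 ≤ t) :
    ∫⁻ ζ, aliveCount (fun u => u.length < n) ζ t ∂treeLaw (e.prod p.toMeasure) ≤ 1 := by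
  induction n generalizing t with
  | zero => simp [aliveCount]
  | succ n ih =>
    have hmeas : ∀ (Q : List ℕ → Prop) (t : ℝ), Measurable fun ζ => aliveCount Q ζ t := fun Q t =>
      (measurable_aliveCount Q).comp (measurable_id.prodMk measurable_const)
    rw [← treeLaw_eq_map_graft, lintegral_map (hmeas _ _) measurable_graft,
      lintegral_prod (fun x : (ℝ × ℕ) × (ℕ → List ℕ → ℝ × ℕ) =>
        aliveCount (fun u => u.length < n + 1) (graft x.1 x.2) t)
        ((hmeas _ _).comp measurable_graft).aemeasurable]
    have hin : ∀ z : ℝ × ℕ, ∫⁻ η : ℕ → List ℕ → ℝ × ℕ,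
        aliveCount (fun u => u.length < n + 1) (graft z η) t
          ∂(Measure.infinitePi fun _ : ℕ => treeLaw (e.prod p.toMeasure)) ≤
        if t < z.1 then 1 else (z.2 : ENNReal) := by
      intro z
      split_ifs with hz
      · simp [aliveCount_of_lt ht hz]
      · simp only [aliveCount_of_le (not_lt.1 hz), List.length_cons, add_lt_add_iff_right]
        have hm' : ∀ i, Measurable fun η : ℕ → List ℕ → ℝ × ℕ =>
            aliveCount (fun v => v.length < n) (η i) (t - z.1) :=
          fun i => (hmeas _ _).comp (measurable_pi_apply i)
        rw [lintegral_finsetSum _ fun i _ => hm' i]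
        calc _ ≤ ∑ i ∈ Finset.range z.2, (1 : ENNReal) := by
              refine Finset.sum_le_sum fun i _ => ?_
              rw [lintegral_eval_treeLaw (e.prod p.toMeasure) (hmeas _ _) i]
              exact ih (sub_nonneg.2 (not_lt.1 hz))
          _ = z.2 := by simp
    refine (lintegral_mono hin).trans ?_
    have hm2 : Measurable fun z : ℝ × ℕ => if t < z.1 then 1 else (z.2 : ENNReal) :=
      Measurable.ite (measurableSet_lt measurable_const measurable_fst) measurable_const
        (Measurable.comp (g := fun n : ℕ => (n : ENNReal)) (measurable_of_countable _)
          measurable_snd)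
    rw [lintegral_prod _ hm2.aemeasurable]
    calc _ ≤ ∫⁻ _, 1 ∂e := by
          refine lintegral_mono fun a => ?_
          simp only
          split_ifs
          · simp
          · exact hmean
      _ = 1 := by simp

-- Non-explosion: any finite set of labels has bounded length, so the bound 1 for truncated
-- populations passes to the whole expected population.
open Classical in
theorem ae_aliveCount_lt_top (hmean : ∫⁻ n, (n : ENNReal) ∂p.toMeasure ≤ 1) {t : ℝ} (ht : 0 ≤ t) :
    ∀ᵐ ζ ∂treeLaw (e.prod p.toMeasure), aliveCount (fun _ => True) ζ t < ⊤ := by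
  have hmeas : ∀ (Q : List ℕ → Prop) (t : ℝ), Measurable fun ζ => aliveCount Q ζ t := fun Q t =>
    (measurable_aliveCount Q).comp (measurable_id.prodMk measurable_const)
  refine ae_lt_top (hmeas _ _) (ne_top_of_le_ne_top ENNReal.one_ne_top ?_)
  have hm : ∀ (Q : List ℕ → Prop) (u : List ℕ), Measurable fun ζ : List ℕ → ℝ × ℕ =>
      if Q u ∧ u ∈ aliveSet ζ t then (1 : ENNReal) else 0 := fun Q u =>
    Measurable.ite ((MeasurableSet.const (Q u)).inter
      ((measurable_id.prodMk measurable_const) (measurableSet_aliveSet u)))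
      measurable_const measurable_const
  simp only [aliveCount]
  rw [lintegral_tsum fun u => (hm (fun _ => True) u).aemeasurable, ENNReal.tsum_eq_iSup_sum]
  refine iSup_le fun s => ?_
  rw [← lintegral_finsetSum _ fun u _ => hm (fun _ => True) u]
  refine le_trans (lintegral_mono fun ζ => ?_)
    (lintegral_aliveCount_length_le (e := e) hmean (s.sup List.length + 1) ht)
  refine le_trans (Finset.sum_le_sum fun u hu => ?_) (ENNReal.sum_le_tsum s)
  have : u.length < s.sup List.length + 1 := Nat.lt_succ_of_le (Finset.le_sup hu)
  simp [this]

end Moments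

/-! ### The generating function of the population size -/

/-- The generating function of the population size at time `t` when the particles have lifetimes
with law `e` and offspring numbers with law `p`. -/
noncomputable def treeGF (e : Measure ℝ) (p : PMF ℕ) (t s : ℝ) : ℝ :=
  ∫ ζ, s ^ treePop ζ t ∂treeLaw (e.prod p.toMeasure)

section Renewal

variable {e : Measure ℝ} {p : PMF ℕ} [IsProbabilityMeasure e] {s t : ℝ}

theorem measurable_treePop_right (t : ℝ) : Measurable fun ζ => treePop ζ t :=
  measurable_treePop.comp (measurable_id.prodMk measurable_const)

theorem measurable_pow_treePop (s t : ℝ) :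
    Measurable fun ζ : List ℕ → ℝ × ℕ => s ^ treePop ζ t :=
  (measurable_of_countable fun n : ℕ => s ^ n).comp (measurable_treePop_right t)

theorem pow_mem_Icc (hs0 : 0 ≤ s) (hs1 : s ≤ 1) (n : ℕ) : s ^ n ∈ Icc (0 : ℝ) 1 :=
  ⟨pow_nonneg hs0 n, pow_le_one₀ hs0 hs1⟩

theorem norm_le_one_of_mem_Icc {x : ℝ} (hx : x ∈ Icc (0 : ℝ) 1) : ‖x‖ ≤ 1 := by
  rw [Real.norm_of_nonneg hx.1]
  exact hx.2

theorem integral_mem_Icc {Ω : Type*} [MeasurableSpace Ω] {P : Measure Ω} [IsProbabilityMeasure P]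
    {f : Ω → ℝ} (hf : ∀ ω, f ω ∈ Icc (0 : ℝ) 1) : ∫ ω, f ω ∂P ∈ Icc (0 : ℝ) 1 := by
  refine ⟨integral_nonneg fun ω => (hf ω).1, ?_⟩
  refine (integral_mono_of_nonneg (Eventually.of_forall fun ω => (hf ω).1) (integrable_const 1)
    (Eventually.of_forall fun ω => (hf ω).2)).trans_eq (by simp)

theorem treeGF_mem (hs0 : 0 ≤ s) (hs1 : s ≤ 1) : treeGF e p t s ∈ Icc (0 : ℝ) 1 :=
  integral_mem_Icc fun _ => pow_mem_Icc hs0 hs1 _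

theorem measurable_treeGF (s : ℝ) : Measurable fun t => treeGF e p t s := by
  refine StronglyMeasurable.measurable ?_
  refine StronglyMeasurable.integral_prod_left' (f := fun x : (List ℕ → ℝ × ℕ) × ℝ =>
    s ^ treePop x.1 x.2) ?_
  exact ((measurable_of_countable fun n : ℕ => s ^ n).comp measurable_treePop).stronglyMeasurable

theorem treePop_of_lt {z : ℝ × ℕ} {η : ℕ → List ℕ → ℝ × ℕ} (ht : 0 ≤ t) (htz : t < z.1) :
    treePop (graft z η) t = 1 := by
  have := treePop_eq_toReal (graft z η) t
  rw [aliveCount_of_lt ht htz trivial] at this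
  exact_mod_cast this

/-- Finiteness matters here, since `treePop` counts an infinite population as 0 and is then not
additive. -/
theorem treePop_of_le {z : ℝ × ℕ} {η : ℕ → List ℕ → ℝ × ℕ} (htz : z.1 ≤ t)
    (hfin : ∀ i, aliveCount (fun _ => True) (η i) (t - z.1) < ⊤) :
    treePop (graft z η) t = ∑ i ∈ Finset.range z.2, treePop (η i) (t - z.1) := by
  have h := treePop_eq_toReal (graft z η) t
  rw [aliveCount_of_le htz, ENNReal.toReal_sum fun i _ => (hfin i).ne] at h
  simp only [← treePop_eq_toReal] at h
  exact_mod_cast h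

theorem integral_prod_eval_infinitePi {X : Type*} [MeasurableSpace X] (T : Measure X)
    [IsProbabilityMeasure T] {h : X → ℝ} (hh : Measurable h) (n : ℕ) :
    ∫ η : ℕ → X, ∏ i ∈ Finset.range n, h (η i) ∂(Measure.infinitePi fun _ : ℕ => T) =
      (∫ x, h x ∂T) ^ n := by
  have hind : iIndepFun (fun (i : Fin n) (η : ℕ → X) => h (η i))
      (Measure.infinitePi fun _ : ℕ => T) :=
    (iIndepFun_infinitePi (P := fun _ : ℕ => T) (X := fun _ x => h x) fun _ => hh).precomp
      Fin.val_injective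
  have h1 := hind.integral_fun_prod_eq_prod_integral fun i =>
    (hh.comp (measurable_pi_apply _)).aestronglyMeasurable
  have h2 : ∀ i : ℕ, ∫ η : ℕ → X, h (η i) ∂(Measure.infinitePi fun _ : ℕ => T) = ∫ x, h x ∂T := by
    intro i
    conv_rhs => rw [← Measure.infinitePi_map_eval (fun _ : ℕ => T) i]
    rw [integral_map (measurable_pi_apply i).aemeasurable hh.aestronglyMeasurable]
  simp only [h2, Finset.prod_const, Finset.card_univ, Fintype.card_fin] at h1
  rw [← h1]
  refine integral_congr_ae (Eventually.of_forall fun η => ?_)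
  exact Finset.prod_range fun i => h (η i)

/-- Condition on the root. If it is still alive the population is 1; if it died at a with n
children, these found n independent trees of age t - a, and averaging the n-th power over n gives f.
The mean bound enters through non-explosion. -/
theorem treeGF_renewal (hmean : ∫⁻ n, (n : ENNReal) ∂p.toMeasure ≤ 1) (ht : 0 ≤ t) (hs0 : 0 ≤ s)
    (hs1 : s ≤ 1) :
    treeGF e p t s = ∫ a, (if t < a then s else pgf p (treeGF e p (t - a) s)) ∂e := by
  have hin : ∀ z : ℝ × ℕ, ∫ η : ℕ → List ℕ → ℝ × ℕ, s ^ treePop (graft z η) t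
      ∂(Measure.infinitePi fun _ : ℕ => treeLaw (e.prod p.toMeasure)) =
      if t < z.1 then s else treeGF e p (t - z.1) s ^ z.2 := by
    intro z
    split_ifs with hz
    · simp [treePop_of_lt ht hz]
    · rw [treeGF, ← integral_prod_eval_infinitePi _ (measurable_pow_treePop _ _)]
      have hfin : ∀ᵐ η ∂(Measure.infinitePi fun _ : ℕ => treeLaw (e.prod p.toMeasure)),
          ∀ i, aliveCount (fun _ => True) (η i) (t - z.1) < ⊤ := by
        rw [ae_all_iff]
        intro i
        exact (measurePreserving_eval_infinitePi
          (fun _ : ℕ => treeLaw (e.prod p.toMeasure)) i).quasiMeasurePreserving.ae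
            (ae_aliveCount_lt_top hmean (sub_nonneg.2 (not_lt.1 hz)))
      refine integral_congr_ae ?_
      filter_upwards [hfin] with η hη
      rw [treePop_of_le (not_lt.1 hz) hη, Finset.prod_pow_eq_pow_sum]
  have hm2 : Measurable fun z : ℝ × ℕ => if t < z.1 then s else treeGF e p (t - z.1) s ^ z.2 := by
    refine Measurable.ite (measurableSet_lt measurable_const measurable_fst) measurable_const ?_
    exact ((measurable_treeGF s).comp (measurable_const.sub measurable_fst)).pow measurable_snd
  have hb2 : ∀ z : ℝ × ℕ, (if t < z.1 then s else treeGF e p (t - z.1) s ^ z.2) ∈ Icc (0:ℝ) 1 := by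
    intro z
    split_ifs
    · exact ⟨hs0, hs1⟩
    · have := treeGF_mem (e := e) (p := p) (t := t - z.1) hs0 hs1
      exact pow_mem_Icc this.1 this.2 _
  rw [treeGF, ← treeLaw_eq_map_graft, integral_map measurable_graft.aemeasurable
    (measurable_pow_treePop _ _).aestronglyMeasurable, integral_prod]
  · simp only [hin]
    rw [integral_prod]
    · refine integral_congr_ae (Eventually.of_forall fun a => ?_)
      simp only
      split_ifs
      · simp
      · have := treeGF_mem (e := e) (p := p) (t := t - a) hs0 hs1
        exact integral_pow_toMeasure p this.1 this.2
    · exact Integrable.of_bound (C := 1) hm2.aestronglyMeasurable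
        (Eventually.of_forall fun z => norm_le_one_of_mem_Icc (hb2 z))
  · exact Integrable.of_bound (C := 1)
      ((measurable_pow_treePop _ _).comp measurable_graft).aestronglyMeasurable
      (Eventually.of_forall fun z => norm_le_one_of_mem_Icc (pow_mem_Icc hs0 hs1 _))

end Renewal

/-! ### The backward equation -/

theorem integral_expMeasure {μ : ℝ} (hμ : 0 < μ) (h : ℝ → ℝ) :
    ∫ a, h a ∂expMeasure μ = ∫ a in Ioi 0, μ * Real.exp (-μ * a) * h a := by
  have e : expMeasure μ = volume.withDensity (exponentialPDF μ) := rfl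
  have hm : Measurable (exponentialPDF μ) :=
    (measurable_exponentialPDFReal μ).ennreal_ofReal
  rw [e, integral_withDensity_eq_integral_toReal_smul hm
    (Eventually.of_forall fun a => ENNReal.ofReal_lt_top), ← integral_Ici_eq_integral_Ioi,
    ← integral_indicator measurableSet_Ici]
  refine integral_congr_ae (Eventually.of_forall fun a => ?_)
  simp only [exponentialPDF_eq, indicator_apply, mem_Ici]
  split_ifs with ha
  · rw [ENNReal.toReal_ofReal (by positivity), smul_eq_mul, neg_mul]
  · simp

section Backward

variable {p : PMF ℕ} {μ s t : ℝ}

theorem measurable_pgf (p : PMF ℕ) : Measurable (pgf p) := by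
  unfold pgf
  exact Measurable.tsum fun n => by fun_prop

/-- The integrand of the backward equation in integrated form. -/
noncomputable def backwardKernel (p : PMF ℕ) (μ s v : ℝ) : ℝ :=
  μ * Real.exp (μ * v) * pgf p (treeGF (expMeasure μ) p v s)

theorem pgf_mem {x : ℝ} (hx : x ∈ Icc (0 : ℝ) 1) : pgf p x ∈ Icc (0 : ℝ) 1 :=
  ⟨pgf_nonneg p hx.1, pgf_le_one p hx.1 hx.2⟩

theorem measurable_backwardKernel (hμ : 0 < μ) : Measurable (backwardKernel p μ s) := by
  have := isProbabilityMeasure_expMeasure hμ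
  have := (measurable_pgf p).comp (measurable_treeGF (e := expMeasure μ) (p := p) s)
  unfold backwardKernel
  exact (by fun_prop : Measurable fun v => μ * Real.exp (μ * v)).mul this

theorem integral_mul_exp (μ : ℝ) (t : ℝ) :
    ∫ v in (0 : ℝ)..t, μ * Real.exp (μ * v) = Real.exp (μ * t) - 1 := by
  have : ∀ v ∈ uIcc 0 t, HasDerivAt (fun v => Real.exp (μ * v)) (μ * Real.exp (μ * v)) v := by
    intro v _
    have := ((hasDerivAt_id v).const_mul μ).exp
    simpa [mul_comm] using this
  rw [intervalIntegral.integral_eq_sub_of_hasDerivAt this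
    (Continuous.intervalIntegrable (by fun_prop) _ _)]
  simp

theorem intervalIntegrable_backwardKernel (hμ : 0 < μ) (hs0 : 0 ≤ s) (hs1 : s ≤ 1) (a b : ℝ) :
    IntervalIntegrable (backwardKernel p μ s) volume a b := by
  have := isProbabilityMeasure_expMeasure hμ
  have h : IntervalIntegrable (fun v => μ * Real.exp (μ * v)) volume a b :=
    Continuous.intervalIntegrable (by fun_prop) _ _
  refine h.mono_fun (measurable_backwardKernel hμ).aestronglyMeasurable
    (Eventually.of_forall fun v => ?_)
  have h1 := pgf_mem (p := p) (treeGF_mem (e := expMeasure μ) (p := p) (t := v) hs0 hs1)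
  simp only [backwardKernel]
  rw [norm_mul]
  exact mul_le_of_le_one_right (norm_nonneg _) (norm_le_one_of_mem_Icc h1)

/-- The factor e^{μt} and the substitution v = t - a remove t from the integrand, so the renewal
equation exhibits F as a primitive, hence as a continuous and then differentiable function. -/
theorem exp_mul_treeGF (hmean : ∫⁻ n, (n : ENNReal) ∂p.toMeasure ≤ 1)
    (hμ : 0 < μ) (ht : 0 ≤ t) (hs0 : 0 ≤ s) (hs1 : s ≤ 1) :
    Real.exp (μ * t) * treeGF (expMeasure μ) p t s =
      s + ∫ v in (0 : ℝ)..t, backwardKernel p μ s v := by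
  have hP := isProbabilityMeasure_expMeasure hμ
  set F := fun t => treeGF (expMeasure μ) p t s
  set h : ℝ → ℝ := fun a => if t < a then s else pgf p (F (t - a))
  have hexp : IntegrableOn (fun a => μ * Real.exp (-μ * a)) (Ioi 0) :=
    (integrableOn_exp_mul_Ioi (neg_lt_zero.2 hμ) 0).const_mul μ
  have hh : ∀ a, h a ∈ Icc (0 : ℝ) 1 := by
    intro a
    simp only [h]
    split_ifs
    · exact ⟨hs0, hs1⟩
    · exact pgf_mem (treeGF_mem hs0 hs1)
  have hhm : Measurable h := by
    refine Measurable.ite (measurableSet_lt measurable_const measurable_id) measurable_const ?_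
    exact (measurable_pgf p).comp ((measurable_treeGF s).comp (measurable_const.sub measurable_id))
  have hint : IntegrableOn (fun a => μ * Real.exp (-μ * a) * h a) (Ioi 0) :=
    hexp.mul_bdd hhm.aestronglyMeasurable
      (Eventually.of_forall fun a => norm_le_one_of_mem_Icc (hh a))
  have h1 : F t = ∫ a in Ioi 0, μ * Real.exp (-μ * a) * h a := by
    rw [← integral_expMeasure hμ]
    exact treeGF_renewal hmean ht hs0 hs1
  rw [← Ioc_union_Ioi_eq_Ioi ht, setIntegral_union (Ioc_disjoint_Ioi le_rfl) measurableSet_Ioi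
    (hint.mono_set Ioc_subset_Ioi_self) (hint.mono_set (Ioi_subset_Ioi ht))] at h1
  have h2 : ∫ a in Ioi t, μ * Real.exp (-μ * a) * h a = s * Real.exp (-μ * t) := by
    have : ∀ a ∈ Ioi t, μ * Real.exp (-μ * a) * h a = μ * s * Real.exp (-μ * a) := by
      intro a ha
      simp only [h, if_pos (mem_Ioi.1 ha)]
      ring
    rw [setIntegral_congr_fun measurableSet_Ioi this, integral_const_mul,
      integral_exp_mul_Ioi (neg_lt_zero.2 hμ)]
    field_simp
  have h3 : ∫ a in Ioc 0 t, μ * Real.exp (-μ * a) * h a =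
      Real.exp (-μ * t) * ∫ v in (0 : ℝ)..t, backwardKernel p μ s v := by
    have h4 := intervalIntegral.integral_comp_sub_left (a := 0) (b := t) (backwardKernel p μ s) t
    rw [sub_self, sub_zero] at h4
    rw [← h4, intervalIntegral.integral_of_le ht, ← integral_const_mul]
    refine setIntegral_congr_fun measurableSet_Ioc fun a ha => ?_
    simp only [h, if_neg (not_lt.2 ha.2), backwardKernel]
    have : Real.exp (-μ * a) = Real.exp (-μ * t) * Real.exp (μ * (t - a)) := by
      rw [← Real.exp_add]
      ring_nf
    rw [this]
    ring
  have e1 : Real.exp (μ * t) * Real.exp (-μ * t) = 1 := by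
    rw [← Real.exp_add]
    simp
  change Real.exp (μ * t) * F t = _
  rw [h1, h2, h3]
  linear_combination (s + ∫ v in (0 : ℝ)..t, backwardKernel p μ s v) * e1

theorem treeGF_zero (hmean : ∫⁻ n, (n : ENNReal) ∂p.toMeasure ≤ 1)
    (hμ : 0 < μ) (hs0 : 0 ≤ s) (hs1 : s ≤ 1) :
    treeGF (expMeasure μ) p 0 s = s := by
  simpa using exp_mul_treeGF (t := 0) hmean hμ le_rfl hs0 hs1

theorem treeGF_eq (hmean : ∫⁻ n, (n : ENNReal) ∂p.toMeasure ≤ 1)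
    (hμ : 0 < μ) (ht : 0 ≤ t) (hs0 : 0 ≤ s) (hs1 : s ≤ 1) :
    treeGF (expMeasure μ) p t s =
      Real.exp (-μ * t) * (s + ∫ v in (0 : ℝ)..t, backwardKernel p μ s v) := by
  rw [← exp_mul_treeGF hmean hμ ht hs0 hs1, ← mul_assoc, ← Real.exp_add]
  simp

theorem treeGF_lt_one (hmean : ∫⁻ n, (n : ENNReal) ∂p.toMeasure ≤ 1)
    (hμ : 0 < μ) (ht : 0 ≤ t) (hs0 : 0 ≤ s) (hs1 : s < 1) :
    treeGF (expMeasure μ) p t s < 1 := by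
  have hP := isProbabilityMeasure_expMeasure hμ
  have h1 := exp_mul_treeGF hmean hμ ht hs0 hs1.le
  have h2 : ∫ v in (0 : ℝ)..t, backwardKernel p μ s v ≤ Real.exp (μ * t) - 1 := by
    rw [← integral_mul_exp]
    refine intervalIntegral.integral_mono_on ht (intervalIntegrable_backwardKernel hμ hs0 hs1.le _ _)
      (Continuous.intervalIntegrable (by fun_prop) _ _) fun v _ => ?_
    exact mul_le_of_le_one_right (by positivity) (pgf_mem (treeGF_mem hs0 hs1.le)).2
  by_contra! hcon
  have := mul_le_mul_of_nonneg_left hcon (Real.exp_pos (μ * t)).le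
  linarith

/-- For t > 0 this puts F(t;s) into the open interval where V is differentiable, even when s = 0. -/
theorem treeGF_pos (hmean : ∫⁻ n, (n : ENNReal) ∂p.toMeasure ≤ 1)
    (h0 : 0 < pgf p 0) (hμ : 0 < μ) (ht : 0 < t) (hs0 : 0 ≤ s) (hs1 : s < 1) :
    0 < treeGF (expMeasure μ) p t s := by
  have hP := isProbabilityMeasure_expMeasure hμ
  have h1 := exp_mul_treeGF hmean hμ ht.le hs0 hs1.le
  have h2 : (Real.exp (μ * t) - 1) * pgf p 0 ≤ ∫ v in (0 : ℝ)..t, backwardKernel p μ s v := by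
    rw [← integral_mul_exp, ← intervalIntegral.integral_mul_const]
    refine intervalIntegral.integral_mono_on ht.le
      (Continuous.intervalIntegrable (by fun_prop) _ _)
      (intervalIntegrable_backwardKernel hμ hs0 hs1.le _ _) fun v _ => ?_
    have h3 := treeGF_mem (e := expMeasure μ) (p := p) (t := v) hs0 hs1.le
    exact mul_le_mul_of_nonneg_left (pgf_mono p le_rfl h3.1 h3.2) (by positivity)
  have h3 : 0 < (Real.exp (μ * t) - 1) * pgf p 0 :=
    mul_pos (sub_pos.2 (Real.one_lt_exp_iff.2 (by positivity))) h0
  by_contra! hcon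
  have := mul_nonpos_of_nonneg_of_nonpos (Real.exp_pos (μ * t)).le hcon
  linarith

theorem treeGF_continuousOn (hmean : ∫⁻ n, (n : ENNReal) ∂p.toMeasure ≤ 1)
    (hμ : 0 < μ) (hs0 : 0 ≤ s) (hs1 : s ≤ 1) :
    ContinuousOn (fun t => treeGF (expMeasure μ) p t s) (Ici 0) := by
  have h := intervalIntegral.continuous_primitive
    (fun a b => intervalIntegrable_backwardKernel (p := p) hμ hs0 hs1 a b) 0
  have h2 : Continuous fun t : ℝ =>
      Real.exp (-μ * t) * (s + ∫ v in (0 : ℝ)..t, backwardKernel p μ s v) := by fun_prop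
  exact h2.continuousOn.congr fun t ht => treeGF_eq hmean hμ ht hs0 hs1

theorem treeGF_hasDerivAt (hmean : ∫⁻ n, (n : ENNReal) ∂p.toMeasure ≤ 1)
    (hμ : 0 < μ) (ht : 0 < t) (hs0 : 0 ≤ s) (hs1 : s ≤ 1) :
    HasDerivAt (fun t => treeGF (expMeasure μ) p t s)
      (μ * (pgf p (treeGF (expMeasure μ) p t s) - treeGF (expMeasure μ) p t s)) t := by
  have hP := isProbabilityMeasure_expMeasure hμ
  have hc : ContinuousAt (fun t => treeGF (expMeasure μ) p t s) t :=
    (treeGF_continuousOn hmean hμ hs0 hs1).continuousAt (Ici_mem_nhds ht)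
  have hk : ContinuousAt (backwardKernel p μ s) t := by
    refine ContinuousAt.mul (by fun_prop) ?_
    have h1 : Tendsto (fun v => treeGF (expMeasure μ) p v s) (𝓝 t)
        (𝓝[Icc 0 1] (treeGF (expMeasure μ) p t s)) :=
      tendsto_nhdsWithin_iff.2 ⟨hc, Eventually.of_forall fun v => treeGF_mem hs0 hs1⟩
    exact ((pgf_continuousOn p _ (treeGF_mem hs0 hs1)).tendsto.comp h1)
  have h1 := intervalIntegral.integral_hasDerivAt_right
    (intervalIntegrable_backwardKernel (p := p) hμ hs0 hs1 0 t)
    (measurable_backwardKernel hμ).stronglyMeasurable.stronglyMeasurableAtFilter hk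
  have h2 : HasDerivAt (fun t => Real.exp (-μ * t)) (Real.exp (-μ * t) * -μ) t := by
    have := ((hasDerivAt_id t).const_mul (-μ)).exp
    simpa using this
  have h3 := h2.mul (h1.const_add s)
  have e1 : Real.exp (-μ * t) * Real.exp (μ * t) = 1 := by
    rw [← Real.exp_add]
    simp
  have h4 := treeGF_eq hmean hμ ht.le hs0 hs1
  refine (h3.congr_of_eventuallyEq ?_).congr_deriv ?_
  · filter_upwards [Ioi_mem_nhds ht] with u hu
    exact treeGF_eq hmean hμ (le_of_lt hu) hs0 hs1
  · rw [show backwardKernel p μ s t = μ * Real.exp (μ * t) *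
      pgf p (treeGF (expMeasure μ) p t s) from rfl]
    change _ * -μ * (s + ∫ v in (0 : ℝ)..t, backwardKernel p μ s v) + _ = _
    linear_combination (μ * pgf p (treeGF (expMeasure μ) p t s)) * e1 + μ * h4

/-- Separation of variables: by the backward equation V(1/(1-F)) has constant time derivative μ, and
the mean value theorem on [0, t] integrates this. -/
theorem V_treeGF (hmean : ∫⁻ n, (n : ENNReal) ∂p.toMeasure ≤ 1)
    (hgt : ∀ s, 0 ≤ s → s < 1 → s < pgf p s) (hμ : 0 < μ) (ht : 0 ≤ t) (hs0 : 0 ≤ s)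
    (hs1 : s < 1) :
    V p (1 / (1 - treeGF (expMeasure μ) p t s)) = μ * t + V p (1 / (1 - s)) := by
  have hP := isProbabilityMeasure_expMeasure hμ
  rcases ht.eq_or_lt with rfl | ht
  · rw [treeGF_zero hmean hμ hs0 hs1.le]
    simp
  set F := fun t => treeGF (expMeasure μ) p t s
  have hF : ∀ v, 0 ≤ v → F v ∈ Ico (0 : ℝ) 1 := fun v hv =>
    ⟨(treeGF_mem hs0 hs1.le).1, treeGF_lt_one hmean hμ hv hs0 hs1⟩
  have hcont : ContinuousOn (fun v => V p (1 / (1 - F v))) (Icc 0 t) :=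
    (continuousOn_V hgt).comp (f := F)
      ((treeGF_continuousOn hmean hμ hs0 hs1.le).mono Icc_subset_Ici_self) fun v hv => hF v hv.1
  obtain ⟨c, hc, hslope⟩ := exists_hasDerivAt_eq_slope (fun v => V p (1 / (1 - F v))) (fun _ => μ)
    ht hcont fun v hv => by
      have hv0 := treeGF_pos hmean (hgt 0 le_rfl one_pos) hμ hv.1 hs0 hs1
      have h1 := (hasDerivAt_V hgt hv0 (hF v hv.1.le).2).comp v
        (treeGF_hasDerivAt hmean hμ hv.1 hs0 hs1.le)
      refine h1.congr_deriv ?_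
      have := sub_pos.2 (hgt _ hv0.le (hF v hv.1.le).2)
      field_simp
  have h0 : F 0 = s := treeGF_zero hmean hμ hs0 hs1.le
  rw [h0, sub_zero, eq_div_iff ht.ne'] at hslope
  change V p (1 / (1 - F t)) = _
  linarith

end Backward

/-! ### Laplace functional of a Poisson process -/

theorem integral_pow_poissonMeasure (Λ : NNReal) (x : ℝ) :
    ∫ n, x ^ n ∂poissonMeasure Λ = Real.exp (-(Λ * (1 - x))) := by
  rw [integral_poissonMeasure]
  have h := (NormedSpace.expSeries_div_hasSum_exp ((Λ : ℝ) * x)).mul_left (Real.exp (-Λ))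
  rw [← Real.exp_eq_exp_ℝ, ← Real.exp_add] at h
  rw [show -((Λ : ℝ) * (1 - x)) = -(Λ : ℝ) + Λ * x by ring, ← h.tsum_eq]
  refine tsum_congr fun n => ?_
  rw [smul_eq_mul, mul_pow]
  ring

theorem measurable_pointCount (a c : ℝ) : Measurable fun S : ℕ → ℝ => pointCount S a c := by
  classical
  have h1 : Measurable fun S : ℕ → ℝ =>
      ∑' k, if a < S k ∧ S k ≤ c then (1 : ENNReal) else 0 := by
    refine Measurable.tsum fun k => Measurable.ite ?_ measurable_const measurable_const
    exact (measurableSet_lt measurable_const (measurable_pi_apply k)).inter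
      (measurableSet_le (measurable_pi_apply k) measurable_const)
  have h2 : ∀ S : ℕ → ℝ, (pointCount S a c : ℝ) =
      (∑' k, if a < S k ∧ S k ≤ c then (1 : ENNReal) else 0).toReal := by
    intro S
    have h3 : (∑' k, if a < S k ∧ S k ≤ c then (1 : ENNReal) else 0) =
        ({k | a < S k ∧ S k ≤ c} : Set ℕ).encard := by
      rw [← ENNReal.tsum_set_one, tsum_subtype _ fun _ => (1 : ENNReal)]
      simp [indicator_apply]
    rw [h3, pointCount]
    rcases ({k | a < S k ∧ S k ≤ c} : Set ℕ).finite_or_infinite with h | h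
    · rw [← h.cast_ncard_eq]
      simp
    · rw [h.ncard, h.encard_eq]
      simp
  refine measurable_to_countable' fun n => ?_
  have : (fun S : ℕ → ℝ => pointCount S a c) ⁻¹' {n} =
      (fun S : ℕ → ℝ => (∑' k, if a < S k ∧ S k ≤ c then (1 : ENNReal) else 0).toReal) ⁻¹'
        {(n : ℝ)} := by
    ext x
    simp [← h2]
  rw [this]
  exact h1.ennreal_toReal (measurableSet_singleton _)

theorem mem_range_pointCount {S : ℕ → ℝ} (h0 : 0 < S 0) (hmono : StrictMono S)
    (hlim : Tendsto S atTop atTop) (t : ℝ) (k : ℕ) :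
    k ∈ Finset.range (pointCount S 0 t) ↔ S k ≤ t := by
  have hpos : ∀ k, 0 < S k := fun k => h0.trans_le (hmono.monotone (Nat.zero_le k))
  obtain ⟨n, hn⟩ := (hlim.eventually_gt_atTop t).exists
  have hex : ∃ n, t < S n := ⟨n, hn⟩
  classical
  have hset : {k : ℕ | 0 < S k ∧ S k ≤ t} = ↑(Finset.range (Nat.find hex)) := by
    ext k
    simp only [mem_ofPred_eq, Finset.coe_range, mem_Iio]
    constructor
    · rintro ⟨-, h⟩
      by_contra! hcon
      exact absurd (hmono.monotone hcon) (not_le.2 (h.trans_lt (Nat.find_spec hex)))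
    · intro h
      exact ⟨hpos k, not_lt.1 (Nat.find_min hex h)⟩
  have hcard : pointCount S 0 t = Nat.find hex := by
    rw [pointCount, hset, Set.ncard_coe_finset, Finset.card_range]
  rw [hcard, ← Finset.mem_coe, ← hset]
  exact ⟨fun h => h.2, fun h => ⟨hpos k, h⟩⟩

/-- The right end point of the cell of the grid of mesh `t / n` containing `u`. -/
noncomputable def gridCeil (t : ℝ) (n : ℕ) (u : ℝ) : ℝ := t * (⌈u * n / t⌉₊ : ℝ) / n

section Grid

variable {t u : ℝ} {n : ℕ}

theorem gridCeil_mem (ht : 0 < t) (hn : 0 < n) (hut : u ≤ t) :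
    gridCeil t n u ∈ Icc 0 t := by
  have hn' : (0 : ℝ) < n := by exact_mod_cast hn
  refine ⟨by unfold gridCeil; positivity, ?_⟩
  have : ⌈u * n / t⌉₊ ≤ n := by
    rw [Nat.ceil_le, div_le_iff₀ ht]
    nlinarith
  have : (⌈u * n / t⌉₊ : ℝ) ≤ n := by exact_mod_cast this
  rw [gridCeil, div_le_iff₀ hn']
  nlinarith

theorem gridCeil_eq (ht : 0 < t) (hn : 0 < n) {i : ℕ} (h1 : t * i / n < u)
    (h2 : u ≤ t * (i + 1) / n) : gridCeil t n u = t * (i + 1) / n := by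
  have hn' : (0 : ℝ) < n := by exact_mod_cast hn
  rw [div_lt_iff₀ hn'] at h1
  rw [le_div_iff₀ hn'] at h2
  have : ⌈u * n / t⌉₊ = i + 1 := by
    rw [Nat.ceil_eq_iff (Nat.succ_ne_zero i)]
    constructor
    · rw [lt_div_iff₀ ht]
      simp
      linarith
    · rw [div_le_iff₀ ht]
      push_cast
      linarith
  rw [gridCeil, this]
  push_cast
  ring

theorem gridCeil_tendsto (ht : 0 < t) (hu : 0 ≤ u) :
    Tendsto (fun n => gridCeil t n u) atTop (𝓝 u) := by
  have h1 : Tendsto (fun n : ℕ => t / n) atTop (𝓝 0) := tendsto_const_div_atTop_nhds_zero_nat t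
  have h2 : Tendsto (fun n : ℕ => u + t / n) atTop (𝓝 (u + 0)) := h1.const_add u
  rw [add_zero] at h2
  refine tendsto_of_tendsto_of_tendsto_of_le_of_le' tendsto_const_nhds h2 ?_ ?_
  · filter_upwards [eventually_gt_atTop 0] with n hn
    have hn' : (0 : ℝ) < n := by exact_mod_cast hn
    have := Nat.le_ceil (u * n / t)
    rw [div_le_iff₀ ht] at this
    rw [gridCeil, le_div_iff₀ hn']
    linarith
  · filter_upwards [eventually_gt_atTop 0] with n hn
    have hn' : (0 : ℝ) < n := by exact_mod_cast hn
    have := (Nat.ceil_lt_add_one (show 0 ≤ u * n / t by positivity)).le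
    rw [gridCeil, div_le_iff₀ hn']
    have h3 : t * (⌈u * n / t⌉₊ : ℝ) ≤ t * (u * n / t + 1) := by gcongr
    refine h3.trans_eq ?_
    field_simp

theorem exists_grid_cell (ht : 0 < t) (hn : 0 < n) (hu0 : 0 < u) (hut : u ≤ t) :
    ∃ i : Fin n, t * (i : ℕ) / n < u ∧ u ≤ t * ((i : ℕ) + 1) / n := by
  have hn' : (0 : ℝ) < n := by exact_mod_cast hn
  have h1 : 0 < ⌈u * n / t⌉₊ := Nat.ceil_pos.2 (by positivity)
  have h2 : ⌈u * n / t⌉₊ ≤ n := by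
    rw [Nat.ceil_le, div_le_iff₀ ht]
    nlinarith
  obtain ⟨m, hm⟩ := Nat.exists_eq_succ_of_ne_zero h1.ne'
  have h3 := (Nat.ceil_eq_iff (Nat.succ_ne_zero m)).1 hm
  refine ⟨⟨m, by omega⟩, ?_, ?_⟩
  · rw [div_lt_iff₀ hn']
    have := h3.1
    rw [lt_div_iff₀ ht] at this
    simp at this
    linarith
  · rw [le_div_iff₀ hn']
    have := h3.2
    rw [div_le_iff₀ ht] at this
    push_cast at this
    linarith

theorem grid_cell_unique (ht : 0 < t) (hn : 0 < n) {i j : ℕ} (h1 : t * i / n < u)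
    (h2 : u ≤ t * (i + 1) / n) (h3 : t * j / n < u) (h4 : u ≤ t * (j + 1) / n) : i = j := by
  have e := (gridCeil_eq ht hn h1 h2).symm.trans (gridCeil_eq ht hn h3 h4)
  have hn' : (0 : ℝ) < n := by exact_mod_cast hn
  field_simp at e
  have : (i : ℝ) = j := by linarith
  exact_mod_cast this

/-- Rounding the points to grid points makes the product depend only on the numbers of points in the
cells, which are independent Poisson variables. -/
theorem prod_gridCeil {S : ℕ → ℝ} (h0 : 0 < S 0) (hmono : StrictMono S)
    (hlim : Tendsto S atTop atTop) (ht : 0 < t) (hn : 0 < n) (φ : ℝ → ℝ) :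
    ∏ k ∈ Finset.range (pointCount S 0 t), φ (gridCeil t n (S k)) =
      ∏ i : Fin n, φ (t * ((i : ℕ) + 1) / n) ^
        pointCount S (t * (i : ℕ) / n) (t * ((i : ℕ) + 1) / n) := by
  classical
  have hpos : ∀ k, 0 < S k := fun k => h0.trans_le (hmono.monotone (Nat.zero_le k))
  have hn' : (0 : ℝ) < n := by exact_mod_cast hn
  have : Nonempty (Fin n) := ⟨⟨0, hn⟩⟩
  choose! c hc1 hc2 using fun k (hk : S k ≤ t) => exists_grid_cell ht hn (hpos k) hk
  rw [← Finset.prod_fiberwise_of_maps_to (s := Finset.range (pointCount S 0 t))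
    (t := Finset.univ) (g := c) fun _ _ => Finset.mem_univ _]
  refine Finset.prod_congr rfl fun i _ => ?_
  have hcell : ∀ k, k ∈ (Finset.range (pointCount S 0 t)).filter (fun k => c k = i) ↔
      t * (i : ℕ) / n < S k ∧ S k ≤ t * ((i : ℕ) + 1) / n := by
    intro k
    rw [Finset.mem_filter, mem_range_pointCount h0 hmono hlim]
    constructor
    · rintro ⟨h1, rfl⟩
      exact ⟨hc1 k h1, hc2 k h1⟩
    · rintro ⟨h1, h2⟩
      have hi : ((i : ℕ) : ℝ) + 1 ≤ n := by exact_mod_cast i.2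
      have h3 : S k ≤ t := h2.trans (by rw [div_le_iff₀ hn']; nlinarith)
      exact ⟨h3, Fin.ext (grid_cell_unique ht hn (hc1 k h3) (hc2 k h3) h1 h2)⟩
  have hcard : pointCount S (t * (i : ℕ) / n) (t * ((i : ℕ) + 1) / n) =
      ((Finset.range (pointCount S 0 t)).filter (fun k => c k = i)).card := by
    rw [← Set.ncard_coe_finset, pointCount]
    congr 1
    ext k
    rw [Finset.mem_coe, hcell]
    rfl
  rw [hcard, ← Finset.prod_const]
  refine Finset.prod_congr rfl fun k hk => ?_
  obtain ⟨h1, h2⟩ := (hcell k).1 hk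
  rw [gridCeil_eq ht hn h1 h2]

end Grid

section PoissonFunctional

variable {Ω : Type*} [MeasurableSpace Ω] {P : Measure Ω} [IsProbabilityMeasure P] {r : ℝ → ℝ}
  {S : ℕ → Ω → ℝ} {t : ℝ} {φ : ℝ → ℝ}

theorem Measurable.prod_range {X : Type*} [MeasurableSpace X] {N : X → ℕ} (hN : Measurable N)
    {f : ℕ → X → ℝ} (hf : ∀ k, Measurable (f k)) :
    Measurable fun x => ∏ k ∈ Finset.range (N x), f k x := by
  have h : Measurable fun y : ℕ × X => ∏ k ∈ Finset.range y.1, f k y.2 :=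
    measurable_from_prod_countable_right fun n =>
      Finset.measurable_fun_prod (Finset.range n) fun k _ => hf k
  exact h.comp (hN.prodMk measurable_id)

theorem prod_mem_Icc {ι : Type*} {s : Finset ι} {f : ι → ℝ} (h : ∀ i ∈ s, f i ∈ Icc (0 : ℝ) 1) :
    ∏ i ∈ s, f i ∈ Icc (0 : ℝ) 1 :=
  ⟨Finset.prod_nonneg fun i hi => (h i hi).1,
    Finset.prod_le_one (fun i hi => (h i hi).1) fun i hi => (h i hi).2⟩

theorem integral_grid_sub {a : ℕ → ℝ} {n : ℕ}
    (hr : ∀ i < n, IntervalIntegrable r volume (a i) (a (i + 1)))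
    (hmono : Monotone a) {c : ℝ → ℝ}
    (hc : ∀ i < n, ∀ u, a i < u → u ≤ a (i + 1) → c u = c (a (i + 1))) :
    ∑ i ∈ Finset.range n, (∫ u in a i..a (i + 1), r u) * c (a (i + 1)) =
      ∫ u in a 0..a n, r u * c u := by
  have heq : ∀ i < n, EqOn (fun u => r u * c (a (i + 1))) (fun u => r u * c u)
      (uIoc (a i) (a (i + 1))) := by
    intro i hi u hu
    rw [uIoc_of_le (hmono (Nat.le_succ i))] at hu
    simp only [hc i hi u hu.1 hu.2]
  rw [← intervalIntegral.sum_integral_adjacent_intervals fun i hi =>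
    ((hr i hi).mul_const (c (a (i + 1)))).congr (heq i hi)]
  refine Finset.sum_congr rfl fun i hi => ?_
  rw [← intervalIntegral.integral_mul_const]
  exact intervalIntegral.integral_congr_ae (Eventually.of_forall fun u hu =>
    heq i (Finset.mem_range.1 hi) hu)

theorem IsPoissonProcess.integral_prod_grid (hS : IsPoissonProcess P r S)
    (hr0 : ∀ t, 0 < t → 0 ≤ r t) (hrint : ∀ t, 0 < t → IntervalIntegrable r volume 0 t)
    (ht : 0 < t) {n : ℕ} (hn : 0 < n) :
    ∫ ω, ∏ k ∈ Finset.range (pointCount (fun k => S k ω) 0 t), φ (gridCeil t n (S k ω)) ∂P =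
      Real.exp (-∫ u in (0 : ℝ)..t, r u * (1 - φ (gridCeil t n u))) := by
  have hn' : (0 : ℝ) < n := by exact_mod_cast hn
  set a : ℕ → ℝ := fun i => t * i / n
  have ha : Monotone a := by
    intro i j hij
    have : (i : ℝ) ≤ j := by exact_mod_cast hij
    simp only [a]
    gcongr
  have ha0 : a 0 = 0 := by simp [a]
  have han : a n = t := by simp only [a]; field_simp
  have has : ∀ i : ℕ, t * ((i : ℝ) + 1) / n = a (i + 1) := fun i => by simp [a]
  have hnn : ∀ i, 0 ≤ a i := fun i => ha0.symm.le.trans (ha (Nat.zero_le i))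
  set N : Fin n → Ω → ℕ := fun i ω => pointCount (fun k => S k ω) (a i) (a (i + 1))
  have hSm : Measurable fun ω => fun k => S k ω := measurable_pi_lambda _ hS.measurable
  have hNm : ∀ i, Measurable (N i) := fun i => (measurable_pointCount _ _).comp hSm
  have hint : ∀ i < n, IntervalIntegrable r volume (a i) (a (i + 1)) := by
    intro i hi
    refine (hrint t ht).mono_set ?_
    rw [uIcc_of_le (ha (Nat.le_succ i)), uIcc_of_le ht.le]
    exact Icc_subset_Icc (hnn i) ((ha hi).trans_eq han)
  have hind : iIndepFun N P := by
    have := hS.indep n (fun i => a i) (fun i j hij => ha hij) (by simp [ha0])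
    simpa [N] using this
  have h1 : ∫ ω, ∏ k ∈ Finset.range (pointCount (fun k => S k ω) 0 t),
      φ (gridCeil t n (S k ω)) ∂P = ∫ ω, ∏ i : Fin n, φ (a (i + 1)) ^ N i ω ∂P := by
    refine integral_congr_ae ?_
    filter_upwards [hS.pos, hS.strictMono, hS.tendsto] with ω h1 h2 h3
    rw [prod_gridCeil h1 h2 h3 ht hn]
    simp only [has]
    rfl
  have h2 := hind.integral_fun_prod_comp (f := fun (i : Fin n) (m : ℕ) => φ (a (i + 1)) ^ m)
    (fun i => (hNm i).aemeasurable) fun i => (measurable_of_countable _).aestronglyMeasurable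
  have h3 : ∀ i : Fin n, ∫ ω, φ (a (i + 1)) ^ N i ω ∂P =
      Real.exp (-((∫ u in a i..a (i + 1), r u) * (1 - φ (a (i + 1))))) := by
    intro i
    have hl := hS.law (a i) (a (i + 1)) (hnn i) (ha (Nat.le_succ i))
    have h4 : 0 ≤ ∫ u in a i..a (i + 1), r u := by
      rw [intervalIntegral.integral_of_le (ha (Nat.le_succ i))]
      exact setIntegral_nonneg measurableSet_Ioc fun u hu => hr0 u ((hnn i).trans_lt hu.1)
    rw [← integral_map (f := fun m : ℕ => φ (a (i + 1)) ^ m) (hNm i).aemeasurable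
      (measurable_of_countable _).aestronglyMeasurable]
    simp only [N]
    rw [hl, integral_pow_poissonMeasure, Real.coe_toNNReal _ h4]
  rw [h1, h2]
  simp only [h3]
  rw [← Real.exp_sum]
  congr 1
  rw [Finset.sum_neg_distrib, neg_inj]
  have h5 : ∀ i < n, gridCeil t n (a (i + 1)) = a (i + 1) := by
    intro i hi
    have hlt : t * i / n < a (i + 1) := by
      rw [← has]
      gcongr
      linarith
    rw [gridCeil_eq ht hn hlt (has i).ge, has]
  have h4 := integral_grid_sub (n := n) (r := r) (c := fun u => 1 - φ (gridCeil t n u))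
    hint ha fun i hi u hu1 hu2 => by
      rw [h5 i hi, gridCeil_eq ht hn hu1 (hu2.trans_eq (has i).symm), has]
  rw [ha0, han] at h4
  rw [← h4, Finset.sum_range]
  exact Finset.sum_congr rfl fun i _ => by rw [h5 i i.2]

theorem measurable_gridCeil (t : ℝ) (n : ℕ) : Measurable (gridCeil t n) := by
  unfold gridCeil
  fun_prop

/-- The formula for rounded points passes to the limit of vanishing mesh: φ is continuous with
values in [0, 1], so both sides converge by dominated convergence. -/
theorem IsPoissonProcess.integral_prod (hS : IsPoissonProcess P r S)
    (hr0 : ∀ t, 0 < t → 0 ≤ r t) (hrint : ∀ t, 0 < t → IntervalIntegrable r volume 0 t)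
    (ht : 0 < t) (hφm : Measurable φ) (hφc : ContinuousOn φ (Icc 0 t))
    (hφ : ∀ u ∈ Icc 0 t, φ u ∈ Icc (0 : ℝ) 1) :
    ∫ ω, ∏ k ∈ Finset.range (pointCount (fun k => S k ω) 0 t), φ (S k ω) ∂P =
      Real.exp (-∫ u in (0 : ℝ)..t, r u * (1 - φ u)) := by
  have hSm : Measurable fun ω => fun k => S k ω := measurable_pi_lambda _ hS.measurable
  have hNm : Measurable fun ω => pointCount (fun k => S k ω) 0 t :=
    (measurable_pointCount 0 t).comp hSm
  have hlimφ : ∀ u, 0 ≤ u → u ≤ t → Tendsto (fun n => φ (gridCeil t n u)) atTop (𝓝 (φ u)) := by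
    intro u hu0 hut
    refine (hφc u ⟨hu0, hut⟩).tendsto.comp (tendsto_nhdsWithin_iff.2
      ⟨gridCeil_tendsto ht hu0, ?_⟩)
    filter_upwards [eventually_gt_atTop 0] with n hn using gridCeil_mem ht hn hut
  have hleft : Tendsto (fun n => ∫ ω, ∏ k ∈ Finset.range (pointCount (fun k => S k ω) 0 t),
      φ (gridCeil t n (S k ω)) ∂P) atTop
      (𝓝 (∫ ω, ∏ k ∈ Finset.range (pointCount (fun k => S k ω) 0 t), φ (S k ω) ∂P)) := by
    refine tendsto_integral_filter_of_dominated_convergence (fun _ => 1) ?_ ?_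
      (integrable_const 1) ?_
    · refine Eventually.of_forall fun n => Measurable.aestronglyMeasurable ?_
      exact hNm.prod_range fun k => hφm.comp ((measurable_gridCeil t n).comp (hS.measurable k))
    · filter_upwards [eventually_gt_atTop 0] with n hn
      filter_upwards [hS.pos, hS.strictMono, hS.tendsto] with ω h1 h2 h3
      refine norm_le_one_of_mem_Icc (prod_mem_Icc fun k hk => ?_)
      exact hφ _ (gridCeil_mem ht hn ((mem_range_pointCount h1 h2 h3 t k).1 hk))
    · filter_upwards [hS.pos, hS.strictMono, hS.tendsto] with ω h1 h2 h3
      refine tendsto_finsetProd _ fun k hk => ?_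
      exact hlimφ _ (h1.le.trans (h2.monotone (Nat.zero_le k)))
        ((mem_range_pointCount h1 h2 h3 t k).1 hk)
  have hright : Tendsto (fun n => ∫ u in (0 : ℝ)..t, r u * (1 - φ (gridCeil t n u))) atTop
      (𝓝 (∫ u in (0 : ℝ)..t, r u * (1 - φ u))) := by
    have hrm := ((intervalIntegrable_iff_integrableOn_Ioc_of_le ht.le).1
      (hrint t ht)).aestronglyMeasurable
    refine intervalIntegral.tendsto_integral_filter_of_dominated_convergence (fun u => ‖r u‖) ?_ ?_
      (hrint t ht).norm ?_
    · refine Eventually.of_forall fun n => ?_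
      rw [uIoc_of_le ht.le]
      exact hrm.mul (measurable_const.sub
        (hφm.comp (measurable_gridCeil t n))).aestronglyMeasurable
    · filter_upwards [eventually_gt_atTop 0] with n hn
      refine Eventually.of_forall fun u hu => ?_
      rw [uIoc_of_le ht.le] at hu
      have := hφ _ (gridCeil_mem ht hn hu.2)
      rw [norm_mul]
      refine mul_le_of_le_one_right (norm_nonneg _) (norm_le_one_of_mem_Icc ⟨?_, ?_⟩)
      · linarith [this.2]
      · linarith [this.1]
    · refine Eventually.of_forall fun u hu => ?_
      rw [uIoc_of_le ht.le] at hu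
      exact ((hlimφ u hu.1.le hu.2).const_sub 1).const_mul (r u)
  refine tendsto_nhds_unique hleft
    (((Real.continuous_exp.tendsto _).comp hright.neg).congr' ?_)
  filter_upwards [eventually_gt_atTop 0] with n hn
  exact (hS.integral_prod_grid hr0 hrint ht hn).symm

end PoissonFunctional

/-! ### Independence and products over groups -/

section Independence

variable {Ω : Type*} [MeasurableSpace Ω] {P : Measure Ω} [IsProbabilityMeasure P]

/-- Rectangles form a generating π-system, and on them the joint probability factors first between
the two families and then within each. -/
theorem ProbabilityTheory.IndepFun.iIndepFun_prodMk {ι α β : Type*} [MeasurableSpace α]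
    [MeasurableSpace β] {X : ι → Ω → α} {Y : ι → Ω → β} (hX : ∀ i, Measurable (X i))
    (hY : ∀ i, Measurable (Y i)) (hXi : iIndepFun X P) (hYi : iIndepFun Y P)
    (hXY : IndepFun (fun ω i => X i ω) (fun ω i => Y i ω) P) :
    iIndepFun (fun i ω => (X i ω, Y i ω)) P := by
  set π : ι → Set (Set Ω) := fun i => preimage (fun ω => (X i ω, Y i ω)) ''
    (image2 (· ×ˢ ·) {s | MeasurableSet s} {t | MeasurableSet t})
  rw [iIndepFun_iff_iIndep]
  refine iIndepSets.iIndep (fun i => ((hX i).prodMk (hY i)).comap_le) π (fun i => ?_)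
    (fun i => ?_) ?_
  · exact isPiSystem_prod.comap _
  · rw [← MeasurableSpace.comap_generateFrom, generateFrom_prod]
  · rw [iIndepSets_iff]
    intro s f hf
    have hf' : ∀ i, ∃ A B, MeasurableSet A ∧ MeasurableSet B ∧
        (i ∈ s → f i = X i ⁻¹' A ∩ Y i ⁻¹' B) := by
      intro i
      by_cases hi : i ∈ s
      · obtain ⟨_, ⟨A, hA, B, hB, rfl⟩, h⟩ := hf i hi
        exact ⟨A, B, hA, hB, fun _ => h.symm⟩
      · exact ⟨∅, ∅, .empty, .empty, fun h => absurd h hi⟩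
    choose A B hA hB h using hf'
    have h1 : ⋂ i ∈ s, f i = (fun ω i => X i ω) ⁻¹' (Set.pi s A) ∩
        (fun ω i => Y i ω) ⁻¹' (Set.pi s B) := by
      ext ω
      simp only [mem_iInter, mem_inter_iff, mem_preimage, Set.mem_pi, Finset.mem_coe]
      constructor
      · exact fun hω => ⟨fun i hi => ((h i hi ▸ hω i hi : ω ∈ X i ⁻¹' A i ∩ Y i ⁻¹' B i)).1,
          fun i hi => ((h i hi ▸ hω i hi : ω ∈ X i ⁻¹' A i ∩ Y i ⁻¹' B i)).2⟩
      · exact fun hω i hi => by rw [h i hi]; exact ⟨hω.1 i hi, hω.2 i hi⟩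
    have h2 : (fun ω i => X i ω) ⁻¹' (Set.pi s A) = ⋂ i ∈ s, X i ⁻¹' A i := by
      ext ω
      simp
    have h3 : (fun ω i => Y i ω) ⁻¹' (Set.pi s B) = ⋂ i ∈ s, Y i ⁻¹' B i := by
      ext ω
      simp
    have hXY1 := hXY.measure_inter_preimage_eq_mul (Set.pi s A) (Set.pi s B)
      (.pi (Finset.countable_toSet s) fun i _ => hA i)
      (.pi (Finset.countable_toSet s) fun i _ => hB i)
    rw [h1, hXY1, h2, h3, hXi.meas_biInter fun i _ => ⟨A i, hA i, rfl⟩,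
      hYi.meas_biInter fun i _ => ⟨B i, hB i, rfl⟩, ← Finset.prod_mul_distrib]
    refine Finset.prod_congr rfl fun i hi => ?_
    have hXY2 := (hXY.comp (measurable_pi_apply i) (measurable_pi_apply i)).measure_inter_preimage_eq_mul
      (A i) (B i) (hA i) (hB i)
    rw [h i hi]
    exact hXY2.symm

theorem integral_finsetProd_eval_infinitePi {X κ : Type*} [MeasurableSpace X] (T : Measure X)
    [IsProbabilityMeasure T] {h : κ → X → ℝ} (hh : ∀ i, Measurable (h i)) (A : Finset κ) :
    ∫ η : κ → X, ∏ i ∈ A, h i (η i) ∂(Measure.infinitePi fun _ : κ => T) =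
      ∏ i ∈ A, ∫ x, h i x ∂T := by
  have hind : iIndepFun (fun (i : A) (η : κ → X) => h i (η i))
      (Measure.infinitePi fun _ : κ => T) :=
    (iIndepFun_infinitePi (P := fun _ : κ => T) (X := fun i x => h i x) hh).precomp
      Subtype.val_injective
  have h1 := hind.integral_fun_prod_eq_prod_integral fun i =>
    ((hh i).comp (measurable_pi_apply _)).aestronglyMeasurable
  have h2 : ∀ i : κ, ∫ η : κ → X, h i (η i) ∂(Measure.infinitePi fun _ : κ => T) =
      ∫ x, h i x ∂T := by
    intro i
    conv_rhs => rw [← Measure.infinitePi_map_eval (fun _ : κ => T) i]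
    rw [integral_map (measurable_pi_apply i).aemeasurable (hh i).aestronglyMeasurable]
  simp only [h2] at h1
  rw [← Finset.prod_coe_sort A fun i => ∫ x, h i x ∂T, ← h1]
  refine integral_congr_ae (Eventually.of_forall fun η => ?_)
  exact (Finset.prod_coe_sort A fun i => h i (η i)).symm

end Independence

/-- Independent groups of sizes with generating function `pgf b`, each of whose members
contributes an independent factor. -/
theorem integral_prod_groups {X : Type*} [MeasurableSpace X] (T : Measure X)
    [IsProbabilityMeasure T] (b : PMF ℕ) {h : ℕ → X → ℝ} (hh : ∀ k, Measurable (h k))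
    (hb : ∀ k x, h k x ∈ Icc (0 : ℝ) 1) (A : Finset ℕ) :
    ∫ i : ℕ → ℕ, ∫ η : ℕ × ℕ → X, ∏ k ∈ A, ∏ j ∈ Finset.range (i k), h k (η (k, j))
        ∂(Measure.infinitePi fun _ => T) ∂(Measure.infinitePi fun _ => b.toMeasure) =
      ∏ k ∈ A, pgf b (∫ x, h k x ∂T) := by
  have h1 : ∀ i : ℕ → ℕ, ∫ η : ℕ × ℕ → X, ∏ k ∈ A, ∏ j ∈ Finset.range (i k), h k (η (k, j))
      ∂(Measure.infinitePi fun _ => T) = ∏ k ∈ A, (∫ x, h k x ∂T) ^ i k := by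
    intro i
    -- All members of all groups in `A`, flattened to one index set so that a single product formula
    -- applies.
    set A' : Finset (ℕ × ℕ) :=
      (A.sigma fun k => Finset.range (i k)).map (Equiv.sigmaEquivProd ℕ ℕ).toEmbedding
    have hA' : ∀ x : ℕ × ℕ, x ∈ A' ↔ x.1 ∈ A ∧ x.2 ∈ Finset.range (i x.1) := by
      intro x
      simp [A', Finset.mem_map_equiv]
    have h2 := integral_finsetProd_eval_infinitePi T (h := fun x : ℕ × ℕ => h x.1)
      (fun x => hh x.1) A'
    rw [Finset.prod_finset_product A' A (fun k => Finset.range (i k)) hA'] at h2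
    simp only [Finset.prod_const, Finset.card_range] at h2
    rw [← h2]
    refine integral_congr_ae (Eventually.of_forall fun η => ?_)
    exact (Finset.prod_finset_product A' A (fun k => Finset.range (i k)) hA'
      (f := fun x => h x.1 (η x))).symm
  simp only [h1]
  rw [integral_finsetProd_eval_infinitePi b.toMeasure (h := fun k n => (∫ x, h k x ∂T) ^ n)
    (fun k => measurable_of_countable _)]
  refine Finset.prod_congr rfl fun k _ => ?_
  have := integral_mem_Icc (P := T) (hb k)
  exact integral_pow_toMeasure b this.1 this.2

/-! ### The joint law of the model -/

namespace ImmigrationModel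

variable {Ω : Type*} [MeasurableSpace Ω] {P : Measure Ω} [IsProbabilityMeasure P] {μ : ℝ}
  {p b : PMF ℕ} {r : ℝ → ℝ} (M : ImmigrationModel P μ p b r)

/-- The labelled family tree founded by the `kj.2`-th member of the `kj.1`-th group. -/
def tree (ω : Ω) (kj : ℕ × ℕ) (u : List ℕ) : ℝ × ℕ :=
  (M.τ (kj.1, kj.2, u) ω, M.ξ (kj.1, kj.2, u) ω)

theorem measurable_tree : Measurable M.tree :=
  measurable_pi_lambda _ fun _ => measurable_pi_lambda _ fun _ =>
    (M.measurable_τ _).prodMk (M.measurable_ξ _)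

/-- Regrouping the label (k, j, u) as ((k, j), u) and currying turns one independent family of
particles into an independent family of trees. -/
theorem map_tree (hμ : 0 < μ) : P.map M.tree =
    Measure.infinitePi fun _ => treeLaw ((expMeasure μ).prod p.toMeasure) := by
  have := isProbabilityMeasure_expMeasure hμ
  have h1 := IndepFun.iIndepFun_prodMk M.measurable_τ M.measurable_ξ M.iIndepFun_τ M.iIndepFun_ξ
    M.indepFun_τ
  have h2 := h1.precomp (g := Equiv.prodAssoc ℕ ℕ (List ℕ)) (Equiv.injective _)
  have hm : ∀ i : (ℕ × ℕ) × List ℕ, Measurable fun ω =>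
      (M.τ (Equiv.prodAssoc ℕ ℕ (List ℕ) i) ω, M.ξ (Equiv.prodAssoc ℕ ℕ (List ℕ) i) ω) :=
    fun i => (M.measurable_τ _).prodMk (M.measurable_ξ _)
  have h3 := h2.map_fun_eq_infinitePi_map hm
  have h4 : ∀ i, P.map (fun ω => (M.τ i ω, M.ξ i ω)) = (expMeasure μ).prod p.toMeasure := by
    intro i
    have := (indepFun_iff_map_prod_eq_prod_map_map (M.measurable_τ i).aemeasurable
      (M.measurable_ξ i).aemeasurable).1
        (M.indepFun_τ.comp (measurable_pi_apply i) (measurable_pi_apply i))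
    rw [this, M.law_τ, M.law_ξ]
  have h5 := congrArg (Measure.map (MeasurableEquiv.curry (ℕ × ℕ) (List ℕ) (ℝ × ℕ))) h3
  rw [Measure.map_map (MeasurableEquiv.measurable _) (measurable_pi_lambda _ hm)] at h5
  simp only [Function.comp_def, h4] at h5
  rw [Measure.infinitePi_map_curry fun _ _ => (expMeasure μ).prod p.toMeasure] at h5
  exact h5

theorem map_I : P.map (fun ω k => M.I k ω) = Measure.infinitePi fun _ => b.toMeasure := by
  rw [M.iIndepFun_I.map_fun_eq_infinitePi_map M.measurable_I]
  simp only [M.law_I]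

theorem measurable_S : Measurable fun ω k => M.S k ω :=
  measurable_pi_lambda _ M.poisson_S.measurable

theorem map_I_tree (hμ : 0 < μ) : P.map (fun ω => ((fun k => M.I k ω), M.tree ω)) =
    (Measure.infinitePi fun _ => b.toMeasure).prod
      (Measure.infinitePi fun _ => treeLaw ((expMeasure μ).prod p.toMeasure)) := by
  have hg : Measurable fun x : (ℕ × ℕ × List ℕ → ℝ) × (ℕ × ℕ × List ℕ → ℕ) =>
      fun (kj : ℕ × ℕ) (u : List ℕ) => (x.1 (kj.1, kj.2, u), x.2 (kj.1, kj.2, u)) := by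
    fun_prop
  have h := M.indepFun_I.comp measurable_id hg
  rw [← M.map_tree hμ, ← M.map_I]
  exact (indepFun_iff_map_prod_eq_prod_map_map
    (measurable_pi_lambda _ M.measurable_I).aemeasurable M.measurable_tree.aemeasurable).1 h

theorem map_S_I_tree (hμ : 0 < μ) :
    P.map (fun ω => ((fun k => M.S k ω), ((fun k => M.I k ω), M.tree ω))) =
    (P.map fun ω k => M.S k ω).prod ((Measure.infinitePi fun _ => b.toMeasure).prod
      (Measure.infinitePi fun _ => treeLaw ((expMeasure μ).prod p.toMeasure))) := by
  have hg : Measurable fun x : (ℕ → ℕ) × (ℕ × ℕ × List ℕ → ℝ) × (ℕ × ℕ × List ℕ → ℕ) =>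
      (x.1, fun (kj : ℕ × ℕ) (u : List ℕ) => (x.2.1 (kj.1, kj.2, u), x.2.2 (kj.1, kj.2, u))) := by
    fun_prop
  have h := M.indepFun_S.comp measurable_id hg
  rw [← M.map_I_tree hμ]
  exact (indepFun_iff_map_prod_eq_prod_map_map M.measurable_S.aemeasurable
    ((measurable_pi_lambda _ M.measurable_I).prodMk M.measurable_tree).aemeasurable).1 h

theorem F_eq (hμ : 0 < μ) (t s : ℝ) : M.F t s = treeGF (expMeasure μ) p t s := by
  have := isProbabilityMeasure_expMeasure hμ
  have h := Measure.infinitePi_map_eval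
    (fun _ : ℕ × ℕ => treeLaw ((expMeasure μ).prod p.toMeasure)) (0, 0)
  rw [← M.map_tree hμ, Measure.map_map (measurable_pi_apply _) M.measurable_tree] at h
  rw [treeGF, ← h, integral_map
    ((measurable_pi_apply _).comp M.measurable_tree).aemeasurable
    (measurable_pow_treePop s t).aestronglyMeasurable]
  rfl

end ImmigrationModel

theorem Measurable.sum_range {X : Type*} [MeasurableSpace X] {N : X → ℕ} (hN : Measurable N)
    {f : ℕ → X → ℕ} (hf : ∀ k, Measurable (f k)) :
    Measurable fun x => ∑ k ∈ Finset.range (N x), f k x := by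
  have h : Measurable fun y : ℕ × X => ∑ k ∈ Finset.range y.1, f k y.2 :=
    measurable_from_prod_countable_right fun n =>
      Finset.measurable_fun_sum (Finset.range n) fun k _ => hf k
  exact h.comp (hN.prodMk measurable_id)

/-- The number of individuals alive at time `t` when group `k` has `i k` members, enters at
time `S k`, and its `j`-th member founds the tree `η (k, j)`. -/
noncomputable def groupsPop (t : ℝ) (S : ℕ → ℝ) (i : ℕ → ℕ) (η : ℕ × ℕ → List ℕ → ℝ × ℕ) : ℕ :=
  ∑ k ∈ Finset.range (pointCount S 0 t), ∑ j ∈ Finset.range (i k), treePop (η (k, j)) (t - S k)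

theorem measurable_groupsPop (t : ℝ) :
    Measurable fun x : (ℕ → ℝ) × (ℕ → ℕ) × (ℕ × ℕ → List ℕ → ℝ × ℕ) =>
      groupsPop t x.1 x.2.1 x.2.2 := by
  have hN : Measurable fun x : (ℕ → ℝ) × (ℕ → ℕ) × (ℕ × ℕ → List ℕ → ℝ × ℕ) =>
      pointCount x.1 0 t := (measurable_pointCount 0 t).comp measurable_fst
  refine hN.sum_range fun k => Measurable.sum_range ?_ fun j => ?_
  · exact (measurable_pi_apply k).comp (measurable_fst.comp measurable_snd)
  · have h : Measurable fun x : (ℕ → ℝ) × (ℕ → ℕ) × (ℕ × ℕ → List ℕ → ℝ × ℕ) =>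
        (x.2.2 (k, j), t - x.1 k) := by fun_prop
    exact measurable_treePop.comp h

namespace ImmigrationModel

variable {Ω : Type*} [MeasurableSpace Ω] {P : Measure Ω} [IsProbabilityMeasure P] {μ : ℝ}
  {p b : PMF ℕ} {r : ℝ → ℝ} (M : ImmigrationModel P μ p b r)

theorem measurable_Y (t : ℝ) : Measurable (M.Y t) := by
  have h : M.Y t = fun ω => groupsPop t (fun k => M.S k ω) (fun k => M.I k ω) (M.tree ω) := rfl
  have h2 : Measurable fun ω => ((fun k => M.S k ω), ((fun k => M.I k ω), M.tree ω)) :=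
    M.measurable_S.prodMk ((measurable_pi_lambda _ M.measurable_I).prodMk M.measurable_tree)
  rw [h]
  have h3 := (measurable_groupsPop t).comp h2
  exact h3

/-- Given the immigration times, the k-th group contributes the independent factor g(F(t - S_k; s));
the Laplace functional of the Poisson process then averages over the times. -/
theorem integral_pow_Y (hmean : ∫⁻ n, (n : ENNReal) ∂p.toMeasure ≤ 1) (hμ : 0 < μ)
    (hr0 : ∀ t, 0 < t → 0 ≤ r t) (hrint : ∀ t, 0 < t → IntervalIntegrable r volume 0 t)
    {t s : ℝ} (ht : 0 < t) (hs0 : 0 ≤ s) (hs1 : s ≤ 1) :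
    ∫ ω, s ^ M.Y t ω ∂P =
      Real.exp (-∫ u in (0 : ℝ)..t, r u * (1 - pgf b (treeGF (expMeasure μ) p (t - u) s))) := by
  have := isProbabilityMeasure_expMeasure hμ
  have hSp : IsProbabilityMeasure (P.map fun ω k => M.S k ω) :=
    Measure.isProbabilityMeasure_map M.measurable_S.aemeasurable
  have hm : Measurable fun x : (ℕ → ℝ) × (ℕ → ℕ) × (ℕ × ℕ → List ℕ → ℝ × ℕ) =>
      s ^ groupsPop t x.1 x.2.1 x.2.2 :=
    (measurable_of_countable fun n : ℕ => s ^ n).comp (measurable_groupsPop t)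
  have hmem : ∀ u, treeGF (expMeasure μ) p u s ∈ Icc (0 : ℝ) 1 := fun u => treeGF_mem hs0 hs1
  have h1 : ∫ ω, s ^ M.Y t ω ∂P = ∫ x, s ^ groupsPop t x.1 x.2.1 x.2.2
      ∂(P.map fun ω => ((fun k => M.S k ω), ((fun k => M.I k ω), M.tree ω))) := by
    rw [integral_map (M.measurable_S.prodMk ((measurable_pi_lambda _ M.measurable_I).prodMk
      M.measurable_tree)).aemeasurable hm.aestronglyMeasurable]
    rfl
  rw [h1, M.map_S_I_tree hμ, integral_prod _ (Integrable.of_bound (C := 1) hm.aestronglyMeasurable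
    (Eventually.of_forall fun x => norm_le_one_of_mem_Icc (pow_mem_Icc hs0 hs1 _)))]
  have h2 : ∀ S : ℕ → ℝ, ∫ y : (ℕ → ℕ) × (ℕ × ℕ → List ℕ → ℝ × ℕ), s ^ groupsPop t S y.1 y.2
      ∂((Measure.infinitePi fun _ => b.toMeasure).prod
        (Measure.infinitePi fun _ => treeLaw ((expMeasure μ).prod p.toMeasure))) =
      ∏ k ∈ Finset.range (pointCount S 0 t), pgf b (treeGF (expMeasure μ) p (t - S k) s) := by
    intro S
    rw [integral_prod (fun y : (ℕ → ℕ) × (ℕ × ℕ → List ℕ → ℝ × ℕ) => s ^ groupsPop t S y.1 y.2)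
      (Integrable.of_bound (C := 1) (hm.comp measurable_prodMk_left).aestronglyMeasurable
      (Eventually.of_forall fun x => norm_le_one_of_mem_Icc (pow_mem_Icc hs0 hs1 _)))]
    simp only [groupsPop, ← Finset.prod_pow_eq_pow_sum]
    exact integral_prod_groups _ b (h := fun k ζ => s ^ treePop ζ (t - S k))
      (fun k => measurable_pow_treePop s _) (fun k ζ => pow_mem_Icc hs0 hs1 _) _
  simp only [h2]
  have hφm : Measurable fun u => pgf b (treeGF (expMeasure μ) p (t - u) s) :=
    (measurable_pgf b).comp ((measurable_treeGF s).comp (measurable_const.sub measurable_id))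
  have hm2 : Measurable fun S : ℕ → ℝ => ∏ k ∈ Finset.range (pointCount S 0 t),
      pgf b (treeGF (expMeasure μ) p (t - S k) s) :=
    (measurable_pointCount 0 t).prod_range fun k => hφm.comp (measurable_pi_apply k)
  rw [integral_map M.measurable_S.aemeasurable hm2.aestronglyMeasurable]
  refine M.poisson_S.integral_prod hr0 hrint ht hφm ?_ fun u _ => pgf_mem (hmem _)
  refine (pgf_continuousOn b).comp ((treeGF_continuousOn hmean hμ hs0 hs1).comp
    (continuous_const.sub continuous_id).continuousOn fun u hu => ?_) fun u _ => hmem _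
  exact sub_nonneg.2 hu.2

theorem measurable_group (t : ℝ) :
    Measurable fun ω => ∑ j ∈ Finset.range (M.I 0 ω), M.Z 0 j t ω := by
  refine (M.measurable_I 0).sum_range fun j => ?_
  exact (measurable_treePop_right t).comp ((measurable_pi_apply (0, j)).comp M.measurable_tree)

/-- The generating function of the population descending from the first group. -/
theorem integral_pow_group (hμ : 0 < μ) {t s : ℝ} (hs0 : 0 ≤ s) (hs1 : s ≤ 1) :
    ∫ ω, s ^ (∑ j ∈ Finset.range (M.I 0 ω), M.Z 0 j t ω) ∂P =
      pgf b (treeGF (expMeasure μ) p t s) := by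
  have := isProbabilityMeasure_expMeasure hμ
  have hm : Measurable fun x : (ℕ → ℕ) × (ℕ × ℕ → List ℕ → ℝ × ℕ) =>
      ∏ k ∈ {0}, ∏ j ∈ Finset.range (x.1 k), s ^ treePop (x.2 (k, j)) t := by
    refine Finset.measurable_fun_prod _ fun k _ => Measurable.prod_range
      ((measurable_pi_apply k).comp measurable_fst) fun j => ?_
    exact (measurable_pow_treePop s t).comp ((measurable_pi_apply (k, j)).comp measurable_snd)
  have h1 := integral_prod_groups (treeLaw ((expMeasure μ).prod p.toMeasure)) b
    (h := fun _ ζ => s ^ treePop ζ t) (fun k => measurable_pow_treePop s _)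
    (fun k ζ => pow_mem_Icc hs0 hs1 _) {0}
  rw [← integral_prod (fun x : (ℕ → ℕ) × (ℕ × ℕ → List ℕ → ℝ × ℕ) =>
      ∏ k ∈ {0}, ∏ j ∈ Finset.range (x.1 k), s ^ treePop (x.2 (k, j)) t)
    (Integrable.of_bound (C := 1) hm.aestronglyMeasurable
    (Eventually.of_forall fun x => norm_le_one_of_mem_Icc
      (prod_mem_Icc fun k _ => prod_mem_Icc fun j _ => pow_mem_Icc hs0 hs1 _))),
    ← M.map_I_tree hμ, integral_map ((measurable_pi_lambda _ M.measurable_I).prodMk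
      M.measurable_tree).aemeasurable hm.aestronglyMeasurable] at h1
  simp only [Finset.prod_singleton, Finset.prod_pow_eq_pow_sum] at h1
  exact h1

end ImmigrationModel

/-! ### Regular variation of survival probabilities -/

/-- The reciprocal of the probability that an individual marked with probability `1 - s` is alive
at time `t` among the descendants of one ancestor. -/
noncomputable def survivalInv (μ : ℝ) (p : PMF ℕ) (t s : ℝ) : ℝ :=
  1 / (1 - treeGF (expMeasure μ) p t s)

/-- The consequences of the regular variation of the offspring law `p` and the immigrant law `b`
on which the limit theorems rest. -/
structure RegularReproduction (μ γ α : ℝ) (p b : PMF ℕ) : Prop where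
  rate_pos : 0 < μ
  index_pos : 0 < γ
  index_pos' : 0 < α
  mean_le : ∫⁻ n, (n : ENNReal) ∂p.toMeasure ≤ 1
  lt_pgf : ∀ s, 0 ≤ s → s < 1 → s < pgf p s
  pgf_lt : ∀ s, 0 ≤ s → s < 1 → pgf b s < 1
  V_regVar : RegVar γ (V p)
  V_tendsto : Tendsto (V p) atTop atTop
  Psi_regVar : RegVar α (Psi b)

theorem tendsto_exp_sub_one_div : Tendsto (fun u : ℝ => (Real.exp u - 1) / u) (𝓝[≠] 0) (𝓝 1) := by
  have h := hasDerivAt_iff_tendsto_slope.1 (Real.hasDerivAt_exp 0)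
  rw [Real.exp_zero] at h
  refine h.congr fun u => ?_
  simp [slope_def_field]

/-- Since 1 - e^{-λ/x} ~ λ/x, the Laplace parameter λ at scale x corresponds to the argument x/λ of
V and Ψ. -/
theorem tendsto_one_div_one_sub_exp {ι : Type*} {l : Filter ι} {x : ι → ℝ}
    (hx : Tendsto x l atTop) {lam : ℝ} (hlam : 0 < lam) :
    Tendsto (fun i => 1 / (1 - Real.exp (-lam / x i)) / x i) l (𝓝 lam⁻¹) := by
  have hu : Tendsto (fun i => -lam / x i) l (𝓝[≠] 0) := by
    refine tendsto_nhdsWithin_iff.2 ⟨hx.const_div_atTop _, ?_⟩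
    filter_upwards [hx.eventually_gt_atTop 0] with i hi
    exact (div_neg_of_neg_of_pos (neg_lt_zero.2 hlam) hi).ne
  have h := ((tendsto_exp_sub_one_div.comp hu).const_mul lam).inv₀ (by simpa using hlam.ne')
  rw [mul_one] at h
  refine h.congr' ?_
  filter_upwards [hx.eventually_gt_atTop 0] with i hi
  have h1 : Real.exp (-lam / x i) < 1 :=
    Real.exp_lt_one_iff.2 (div_neg_of_neg_of_pos (neg_lt_zero.2 hlam) hi)
  have h2 : 1 - Real.exp (-lam / x i) ≠ 0 := by linarith
  have h3 : Real.exp (-lam / x i) - 1 ≠ 0 := by linarith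
  have h4 : Real.exp (-lam / x i) - 1 = -(1 - Real.exp (-lam / x i)) := by ring
  simp only [Function.comp_def]
  rw [h4]
  field_simp

theorem treeGF_mono {e : Measure ℝ} [IsProbabilityMeasure e] {p : PMF ℕ} {t s s' : ℝ}
    (hs0 : 0 ≤ s) (hss : s ≤ s') (hs1 : s' ≤ 1) : treeGF e p t s ≤ treeGF e p t s' := by
  refine integral_mono ?_ ?_ fun ζ => pow_le_pow_left₀ hs0 hss _
  · exact Integrable.of_bound (C := 1) (measurable_pow_treePop s t).aestronglyMeasurable
      (Eventually.of_forall fun x => norm_le_one_of_mem_Icc (pow_mem_Icc hs0 (hss.trans hs1) _))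
  · exact Integrable.of_bound (C := 1) (measurable_pow_treePop s' t).aestronglyMeasurable
      (Eventually.of_forall fun x => norm_le_one_of_mem_Icc (pow_mem_Icc (hs0.trans hss) hs1 _))

theorem exp_neg_div_mem {lam x : ℝ} (hlam : 0 < lam) (hx : 0 < x) :
    0 ≤ Real.exp (-lam / x) ∧ Real.exp (-lam / x) < 1 :=
  ⟨(Real.exp_pos _).le, Real.exp_lt_one_iff.2 (div_neg_of_neg_of_pos (neg_lt_zero.2 hlam) hx)⟩

theorem one_le_one_div_one_sub {s : ℝ} (hs0 : 0 ≤ s) (hs1 : s < 1) : 1 ≤ 1 / (1 - s) := by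
  rw [le_div_iff₀ (by linarith)]
  linarith

namespace RegularReproduction

variable {μ γ α : ℝ} {p b : PMF ℕ} (h : RegularReproduction μ γ α p b) {t s lam : ℝ}

theorem V_monotoneOn (h : RegularReproduction μ γ α p b) : MonotoneOn (V p) (Ici 1) :=
  (V_strictMonoOn h.lt_pgf).monotoneOn

theorem V_eventually_pos (h : RegularReproduction μ γ α p b) : ∀ᶠ x in atTop, 0 < V p x :=
  h.V_tendsto.eventually_gt_atTop 0

theorem Psi_eventually_pos (h : RegularReproduction μ γ α p b) : ∀ᶠ x in atTop, 0 < Psi b x :=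
  (Psi_tendsto_atTop h.pgf_lt).eventually_gt_atTop 0

theorem one_le_survivalInv (h : RegularReproduction μ γ α p b) (ht : 0 ≤ t) (hs0 : 0 ≤ s)
    (hs1 : s < 1) : 1 ≤ survivalInv μ p t s := by
  have := isProbabilityMeasure_expMeasure h.rate_pos
  exact one_le_one_div_one_sub (treeGF_mem hs0 hs1.le).1
    (treeGF_lt_one h.mean_le h.rate_pos ht hs0 hs1)

theorem V_survivalInv (h : RegularReproduction μ γ α p b) (ht : 0 ≤ t) (hs0 : 0 ≤ s)
    (hs1 : s < 1) : V p (survivalInv μ p t s) = μ * t + V p (1 / (1 - s)) :=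
  V_treeGF h.mean_le h.lt_pgf h.rate_pos ht hs0 hs1

theorem V_survivalInv_zero (h : RegularReproduction μ γ α p b) (ht : 0 ≤ t) :
    V p (survivalInv μ p t 0) = μ * t := by
  rw [h.V_survivalInv ht le_rfl one_pos]
  simp [V_one]

theorem W_eq (h : RegularReproduction μ γ α p b) (ht : 0 ≤ t) :
    W p (μ * t) = survivalInv μ p t 0 := by
  rw [← h.V_survivalInv_zero ht, W_V h.lt_pgf (h.one_le_survivalInv ht le_rfl one_pos)]

theorem one_sub_pgf_treeGF (μ : ℝ) (p b : PMF ℕ) (t s : ℝ) :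
    1 - pgf b (treeGF (expMeasure μ) p t s) = 1 / Psi b (survivalInv μ p t s) := by
  simp [Psi, survivalInv]

theorem tendsto_survivalInv (h : RegularReproduction μ γ α p b) :
    Tendsto (fun t => survivalInv μ p t 0) atTop atTop := by
  refine tendsto_atTop.2 fun C => ?_
  filter_upwards [eventually_ge_atTop 0, eventually_gt_atTop (V p (max C 1) / μ)] with t ht0 ht
  rw [div_lt_iff₀' h.rate_pos, ← h.V_survivalInv_zero ht0] at ht
  exact (le_max_left C 1).trans ((V_strictMonoOn h.lt_pgf).lt_iff_lt (le_max_right C 1)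
    (h.one_le_survivalInv ht0 le_rfl one_pos) |>.1 ht).le

theorem tendsto_W (h : RegularReproduction μ γ α p b) :
    Tendsto (fun t => W p (μ * t)) atTop atTop := by
  refine h.tendsto_survivalInv.congr' ?_
  filter_upwards [eventually_ge_atTop 0] with t ht using (h.W_eq ht).symm

/-- A limiting ratio a of V-values forces the ratio a^{1/γ} of the arguments, hence a^{α/γ} for Ψ.
No inverse of V has to be analysed. -/
theorem tendsto_Psi_ratio (h : RegularReproduction μ γ α p b) {ι : Type*} {l : Filter ι}
    {x y : ι → ℝ} {a : ℝ} (ha : 0 < a) (hx : Tendsto x l atTop) (hy : ∀ᶠ i in l, 1 ≤ y i)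
    (hV : Tendsto (fun i => V p (y i) / V p (x i)) l (𝓝 a)) :
    Tendsto (fun i => 1 / Psi b (y i) / (1 / Psi b (x i))) l (𝓝 (a ^ (-(α / γ)))) := by
  have hc : 0 < a ^ (1 / γ) := Real.rpow_pos_of_pos ha _
  have hca : (a ^ (1 / γ)) ^ γ = a := by
    rw [← Real.rpow_mul ha.le, one_div_mul_cancel h.index_pos.ne', Real.rpow_one]
  have h1 := h.V_regVar.tendsto_arg_ratio h.index_pos h.V_monotoneOn h.V_eventually_pos hc hx hy
    (by rwa [hca])
  have h2 := h.Psi_regVar.tendsto_ratio (Psi_monotoneOn h.pgf_lt) h.Psi_eventually_pos hc hx h1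
  have h3 := h2.inv₀ (Real.rpow_pos_of_pos hc _).ne'
  rw [← Real.rpow_mul ha.le, ← Real.rpow_neg ha.le, one_div_mul_eq_div] at h3
  refine h3.congr fun i => ?_
  rw [inv_div, one_div, one_div, inv_div_inv]

/-- The V-value of the numerator is μtw + V(1/(1-s)) with V(1/(1-s)) ~ λ^{-γ} V(W(μt)) = λ^{-γ} μt,
and that of the denominator is μt; the ratio tends to w + λ^{-γ}. -/
theorem tendsto_pgf_ratio (h : RegularReproduction μ γ α p b) (hlam : 0 < lam) {w : ℝ}
    (hw : 0 ≤ w) :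
    Tendsto (fun t => (1 - pgf b (treeGF (expMeasure μ) p (t * w)
        (Real.exp (-lam / W p (μ * t))))) / (1 - pgf b (treeGF (expMeasure μ) p t 0))) atTop
      (𝓝 (lam ^ α * (w * lam ^ γ + 1) ^ (-(α / γ)))) := by
  have hl := Real.rpow_pos_of_pos hlam γ
  have ha : 0 < w + lam⁻¹ ^ γ := by positivity
  have hlim : (w + lam⁻¹ ^ γ) ^ (-(α / γ)) = lam ^ α * (w * lam ^ γ + 1) ^ (-(α / γ)) := by
    have : w * lam ^ γ + 1 = lam ^ γ * (w + lam⁻¹ ^ γ) := by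
      rw [Real.inv_rpow hlam.le]
      field_simp
    rw [this, Real.mul_rpow hl.le ha.le, ← Real.rpow_mul hlam.le, ← mul_assoc,
      ← Real.rpow_add hlam]
    have : α + γ * -(α / γ) = 0 := by
      field_simp [h.index_pos.ne']
      ring
    rw [this, Real.rpow_zero, one_mul]
  simp only [one_sub_pgf_treeGF]
  rw [← hlim]
  refine h.tendsto_Psi_ratio ha h.tendsto_survivalInv ?_ ?_
  · filter_upwards [eventually_ge_atTop 0, h.tendsto_W.eventually_gt_atTop 0] with t ht hW
    exact h.one_le_survivalInv (mul_nonneg ht hw) (exp_neg_div_mem hlam hW).1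
      (exp_neg_div_mem hlam hW).2
  · have h1 := h.V_regVar.tendsto_ratio h.V_monotoneOn h.V_eventually_pos (inv_pos.2 hlam)
      h.tendsto_W (tendsto_one_div_one_sub_exp h.tendsto_W hlam)
    refine (h1.const_add w).congr' ?_
    filter_upwards [eventually_gt_atTop 0, h.tendsto_W.eventually_gt_atTop 0] with t ht hW
    rw [h.V_survivalInv (mul_nonneg ht.le hw) (exp_neg_div_mem hlam hW).1
      (exp_neg_div_mem hlam hW).2, h.W_eq ht.le, h.V_survivalInv_zero ht.le]
    have := h.rate_pos
    field_simp

/-- At s = 0 the V-values are exactly μct and μt, so their ratio is the constant c. -/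
theorem pgf_regVar (h : RegularReproduction μ γ α p b) :
    RegVar (-(α / γ)) fun t => 1 - pgf b (treeGF (expMeasure μ) p t 0) := by
  intro c hc
  simp only [one_sub_pgf_treeGF]
  refine h.tendsto_Psi_ratio hc h.tendsto_survivalInv ?_ ?_
  · filter_upwards [eventually_ge_atTop 0] with t ht
    exact h.one_le_survivalInv (mul_nonneg hc.le ht) le_rfl one_pos
  · refine tendsto_const_nhds.congr' ?_
    filter_upwards [eventually_gt_atTop 0] with t ht
    rw [h.V_survivalInv_zero (mul_nonneg hc.le ht.le), h.V_survivalInv_zero ht.le]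
    have := h.rate_pos
    field_simp

theorem pgf_antitone (h : RegularReproduction μ γ α p b) :
    AntitoneOn (fun t => 1 - pgf b (treeGF (expMeasure μ) p t 0)) (Ioi 0) := by
  intro t ht t' ht' htt
  rw [mem_Ioi] at ht ht'
  have h1 := h.one_le_survivalInv ht.le le_rfl one_pos
  have h2 := h.one_le_survivalInv ht'.le le_rfl one_pos
  simp only [one_sub_pgf_treeGF]
  refine one_div_le_one_div_of_le (Psi_pos h.pgf_lt h1) (Psi_monotoneOn h.pgf_lt h1 h2 ?_)
  refine ((V_strictMonoOn h.lt_pgf).le_iff_le h1 h2).1 ?_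
  rw [h.V_survivalInv_zero ht.le, h.V_survivalInv_zero ht'.le]
  exact mul_le_mul_of_nonneg_left htt h.rate_pos.le

theorem pgf_compl_mem (h : RegularReproduction μ γ α p b) (hs0 : 0 ≤ s) (hs1 : s ≤ 1) :
    1 - pgf b (treeGF (expMeasure μ) p t s) ∈ Icc (0 : ℝ) 1 := by
  have := isProbabilityMeasure_expMeasure h.rate_pos
  have := pgf_mem (p := b) (treeGF_mem (e := expMeasure μ) (p := p) (t := t) hs0 hs1)
  exact ⟨by linarith [this.2], by linarith [this.1]⟩

theorem pgf_compl_pos (h : RegularReproduction μ γ α p b) (ht : 0 ≤ t) (hs0 : 0 ≤ s)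
    (hs1 : s < 1) : 0 < 1 - pgf b (treeGF (expMeasure μ) p t s) := by
  rw [one_sub_pgf_treeGF]
  exact one_div_pos.2 (Psi_pos h.pgf_lt (h.one_le_survivalInv ht hs0 hs1))

theorem pgf_compl_le (h : RegularReproduction μ γ α p b) (hs0 : 0 ≤ s) (hs1 : s ≤ 1) :
    1 - pgf b (treeGF (expMeasure μ) p t s) ≤ 1 - pgf b (treeGF (expMeasure μ) p t 0) := by
  have := isProbabilityMeasure_expMeasure h.rate_pos
  exact sub_le_sub_left (pgf_mono b (treeGF_mem le_rfl zero_le_one).1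
    (treeGF_mono le_rfl hs0 hs1) (treeGF_mem hs0 hs1).2) 1

theorem measurable_pgf_compl (h : RegularReproduction μ γ α p b) (s : ℝ) :
    Measurable fun t => 1 - pgf b (treeGF (expMeasure μ) p t s) := by
  have := isProbabilityMeasure_expMeasure h.rate_pos
  exact measurable_const.sub ((measurable_pgf b).comp (measurable_treeGF s))

end RegularReproduction

theorem beta_comm (a b : ℝ) : beta a b = beta b a := by
  simp only [beta, mul_comm, add_comm]

/-! ### Asymptotics of the exponent -/

section Convolution

variable {μ γ α θ : ℝ} {p b : PMF ℕ} {r LR : ℝ → ℝ} {lam : ℝ}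

theorem RegularReproduction.tendsto_exponent (h : RegularReproduction μ γ α p b) (hθ0 : 0 ≤ θ)
    (hθ1 : θ < 1) (hαγ : α / γ < 1)
    (hr0 : ∀ t, 0 < t → 0 ≤ r t) (hrint : ∀ t, 0 < t → IntervalIntegrable r volume 0 t)
    (hr : ∀ᶠ t in atTop, r t = t ^ (-θ) * LR t) (hLR : SlowlyVarying LR) (hlam : 0 < lam) :
    Tendsto (fun t => (∫ u in (0 : ℝ)..t, r u * (1 - pgf b (treeGF (expMeasure μ) p (t - u)
        (Real.exp (-lam / W p (μ * t)))))) /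
        (t * r t * (1 - pgf b (treeGF (expMeasure μ) p t 0)))) atTop
      (𝓝 (lam ^ α * ∫ u in (0 : ℝ)..1, (1 - u) ^ (-θ) * (u * lam ^ γ + 1) ^ (-(α / γ)))) := by
  have h1 := tendsto_convolution (ψ := fun t v => 1 - pgf b (treeGF (expMeasure μ) p v
        (Real.exp (-lam / W p (μ * t))))) hθ0 hθ1 (div_pos h.index_pos' h.index_pos).le hαγ
    hr0 hrint hr hLR h.pgf_antitone (fun t ht => h.pgf_compl_pos ht.le le_rfl one_pos)
    (fun t _ => (h.pgf_compl_mem le_rfl zero_le_one).2) h.pgf_regVar ?_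
    fun w hw => h.tendsto_pgf_ratio hlam hw.1.le
  · convert h1 using 2
    rw [← intervalIntegral.integral_const_mul]
    congr 1 with u
    ring
  · filter_upwards [h.tendsto_W.eventually_gt_atTop 0] with t hW
    have hs := exp_neg_div_mem hlam hW
    exact ⟨h.measurable_pgf_compl _, fun v _ => ⟨(h.pgf_compl_mem hs.1 hs.2.le).1,
      h.pgf_compl_le hs.1 hs.2.le⟩⟩

theorem RegularReproduction.tendsto_exponent_zero (h : RegularReproduction μ γ α p b)
    (hθ0 : 0 ≤ θ) (hθ1 : θ < 1) (hαγ : α / γ < 1)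
    (hr0 : ∀ t, 0 < t → 0 ≤ r t) (hrint : ∀ t, 0 < t → IntervalIntegrable r volume 0 t)
    (hr : ∀ᶠ t in atTop, r t = t ^ (-θ) * LR t) (hLR : SlowlyVarying LR) :
    Tendsto (fun t => (∫ u in (0 : ℝ)..t, r u * (1 - pgf b (treeGF (expMeasure μ) p (t - u) 0))) /
        (t * r t * (1 - pgf b (treeGF (expMeasure μ) p t 0)))) atTop
      (𝓝 (beta (1 - θ) (1 - α / γ))) := by
  have h1 := tendsto_convolution (ψ := fun _ v => 1 - pgf b (treeGF (expMeasure μ) p v 0))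
    (k := fun w => w ^ (-(α / γ)))
    hθ0 hθ1 (div_pos h.index_pos' h.index_pos).le hαγ
    hr0 hrint hr hLR h.pgf_antitone (fun t ht => h.pgf_compl_pos ht.le le_rfl one_pos)
    (fun t _ => (h.pgf_compl_mem le_rfl zero_le_one).2) h.pgf_regVar ?_ ?_
  · convert h1 using 2
    rw [beta_comm, ← integral_beta hαγ hθ1]
    congr 1 with u
    ring
  · exact Eventually.of_forall fun t => ⟨h.measurable_pgf_compl _, fun v _ =>
      ⟨(h.pgf_compl_mem le_rfl zero_le_one).1, le_rfl⟩⟩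
  · intro w hw
    simpa only [mul_comm] using h.pgf_regVar w hw.1

end Convolution

/-! ### From generating functions to conditional limit laws -/

section Limits

variable {Ω : Type*} [MeasurableSpace Ω] {P : Measure Ω} [IsProbabilityMeasure P]

theorem exp_neg_mul_div (lam x : ℝ) (n : ℕ) :
    Real.exp (-lam * (n / x)) = Real.exp (-lam / x) ^ n := by
  rw [← Real.exp_nat_mul]
  congr 1
  ring

theorem integrable_pow {N : Ω → ℕ} (hN : Measurable N) {s : ℝ} (hs0 : 0 ≤ s) (hs1 : s ≤ 1) :
    Integrable (fun ω => s ^ N ω) P :=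
  Integrable.of_bound (C := 1)
    ((measurable_of_countable fun n : ℕ => s ^ n).comp hN).aestronglyMeasurable
    (Eventually.of_forall fun _ => norm_le_one_of_mem_Icc (pow_mem_Icc hs0 hs1 _))

/-- By the convention 0^0 = 1, 0^N is the indicator of N = 0, so extinction is the generating
function at 0. -/
theorem measureReal_pos_eq {N : Ω → ℕ} (hN : Measurable N) :
    P.real {ω | 0 < N ω} = 1 - ∫ ω, (0 : ℝ) ^ N ω ∂P := by
  have h0 : MeasurableSet {ω | 0 < N ω} := measurableSet_lt measurable_const hN
  have hi : Integrable ({ω | 0 < N ω}.indicator (1 : Ω → ℝ)) P := (integrable_const 1).indicator h0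
  rw [← integral_indicator_one h0, eq_sub_iff_add_eq, ← integral_add hi
    (integrable_pow hN le_rfl zero_le_one)]
  have : ∀ ω, {ω | 0 < N ω}.indicator (1 : Ω → ℝ) ω + (0 : ℝ) ^ N ω = 1 := by
    intro ω
    by_cases h : 0 < N ω
    · simp [h, h.ne']
    · simp [Nat.eq_zero_of_not_pos h]
  simp [this]

theorem integral_cond_pow {N : Ω → ℕ} (hN : Measurable N) {s : ℝ} (hs0 : 0 ≤ s) (hs1 : s ≤ 1)
    (hpos : ∫ ω, (0 : ℝ) ^ N ω ∂P < 1) :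
    ∫ ω, s ^ N ω ∂P[|{ω | 0 < N ω}] =
      1 - (1 - ∫ ω, s ^ N ω ∂P) / (1 - ∫ ω, (0 : ℝ) ^ N ω ∂P) := by
  have h0 : MeasurableSet {ω | 0 < N ω} := measurableSet_lt measurable_const hN
  have h1 : ∫ ω in {ω | 0 < N ω}, s ^ N ω ∂P = ∫ ω, s ^ N ω ∂P - ∫ ω, (0 : ℝ) ^ N ω ∂P := by
    rw [← integral_indicator h0, ← integral_sub (integrable_pow hN hs0 hs1)
      (integrable_pow hN le_rfl zero_le_one)]
    refine integral_congr_ae (Eventually.of_forall fun ω => ?_)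
    by_cases h : 0 < N ω
    · simp [h, h.ne']
    · simp [Nat.eq_zero_of_not_pos h]
  rw [ProbabilityTheory.cond, integral_smul_measure, h1, ENNReal.toReal_inv, smul_eq_mul]
  have h2 := measureReal_pos_eq (P := P) hN
  rw [Measure.real] at h2
  rw [h2]
  have : 1 - ∫ ω, (0 : ℝ) ^ N ω ∂P ≠ 0 := by linarith
  field_simp
  ring

theorem exists_limit_of_tendsto_integral_pow {ι : Type*} {l : Filter ι} [NeBot l]
    {Q : ι → Measure Ω} {N : ι → Ω → ℕ} {c : ι → ℝ} {φ : ℝ → ℝ}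
    (hQ : ∀ᶠ i in l, IsProbabilityMeasure (Q i))
    (hN : ∀ i, Measurable (N i)) (hc : ∀ᶠ i in l, 0 < c i)
    (hφ : ∀ lam, 0 < lam → Tendsto (fun i => ∫ ω, Real.exp (-lam / c i) ^ N i ω ∂Q i) l
      (𝓝 (φ lam)))
    (hφ0 : Tendsto φ (𝓝[>] 0) (𝓝 1)) :
    ∃ D, HasLaplaceTransform D φ ∧ ∀ x, D {x} = 0 →
      Tendsto (fun i => (Q i).real {ω | (N i ω : ℝ) / c i ≤ x}) l (𝓝 (D.real (Iic x))) := by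
  have hm : ∀ i, Measurable fun ω => (N i ω : ℝ) / c i := fun i =>
    ((measurable_of_countable fun n : ℕ => (n : ℝ)).comp (hN i)).div_const _
  have h1 : ∀ᶠ i in l, IsProbabilityMeasure ((Q i).map fun ω => (N i ω : ℝ) / c i) ∧
      ((Q i).map fun ω => (N i ω : ℝ) / c i) (Iio 0) = 0 := by
    filter_upwards [hQ, hc] with i hi hci
    refine ⟨Measure.isProbabilityMeasure_map (hm i).aemeasurable, ?_⟩
    rw [Measure.map_apply (hm i) measurableSet_Iio]
    convert! measure_empty (μ := Q i)
    ext ω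
    simp only [mem_preimage, mem_Iio, mem_empty_iff_false, iff_false, not_lt]
    positivity
  have h2 : ∀ lam, 0 < lam → Tendsto (fun i => ∫ x, Real.exp (-lam * x)
      ∂((Q i).map fun ω => (N i ω : ℝ) / c i)) l (𝓝 (φ lam)) := by
    intro lam hlam
    refine (hφ lam hlam).congr fun i => ?_
    rw [integral_map (hm i).aemeasurable (Continuous.aestronglyMeasurable (by fun_prop))]
    simp only [exp_neg_mul_div]
  obtain ⟨D, hD, hlim⟩ := exists_laplace_limit h1 h2 hφ0
  refine ⟨D, hD, fun x hx => (hlim x hx).congr fun i => ?_⟩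
  rw [map_measureReal_apply (hm i) measurableSet_Iic]
  rfl

theorem exists_conditional_limit {ι : Type*} {l : Filter ι} [NeBot l]
    {N : ι → Ω → ℕ} {c : ι → ℝ} {φ : ℝ → ℝ}
    (hN : ∀ i, Measurable (N i)) (hc : ∀ᶠ i in l, 0 < c i)
    (h0 : ∀ᶠ i in l, ∫ ω, (0 : ℝ) ^ N i ω ∂P < 1)
    (hφ : ∀ lam, 0 < lam → Tendsto (fun i => 1 - (1 - ∫ ω, Real.exp (-lam / c i) ^ N i ω ∂P) /
      (1 - ∫ ω, (0 : ℝ) ^ N i ω ∂P)) l (𝓝 (φ lam)))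
    (hφ0 : Tendsto φ (𝓝[>] 0) (𝓝 1)) :
    ∃ D, HasLaplaceTransform D φ ∧ ∀ x, D {x} = 0 →
      Tendsto (fun i => (P[|{ω | 0 < N i ω}]).real {ω | (N i ω : ℝ) / c i ≤ x}) l
        (𝓝 (D.real (Iic x))) := by
  refine exists_limit_of_tendsto_integral_pow ?_ hN hc (fun lam hlam => ?_) hφ0
  · filter_upwards [h0] with i hi
    refine cond_isProbabilityMeasure fun h => ?_
    have h1 := measureReal_pos_eq (P := P) (hN i)
    rw [Measure.real, h, ENNReal.toReal_zero] at h1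
    linarith
  · refine (hφ lam hlam).congr' ?_
    filter_upwards [h0, hc] with i hi hci
    exact (integral_cond_pow (hN i) (exp_neg_div_mem hlam hci).1
      (exp_neg_div_mem hlam hci).2.le hi).symm

theorem HasLaplaceTransform.tendsto_one {D : Measure ℝ} {φ : ℝ → ℝ} (h : HasLaplaceTransform D φ) :
    Tendsto φ (𝓝[>] 0) (𝓝 1) := by
  have := h.1
  have h1 : Tendsto (fun lam : ℝ => ∫ x, Real.exp (-lam * x) ∂D) (𝓝[>] 0) (𝓝 (∫ _, (1 : ℝ) ∂D)) := by
    refine tendsto_integral_filter_of_dominated_convergence (fun _ => 1) ?_ ?_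
      (integrable_const 1) ?_
    · exact Eventually.of_forall fun lam => Continuous.aestronglyMeasurable (by fun_prop)
    · filter_upwards [self_mem_nhdsWithin] with lam hlam
      filter_upwards [ae_nonneg_of_Iio h.2.1] with x hx
      rw [Real.norm_of_nonneg (Real.exp_pos _).le]
      exact exp_neg_mul_le_one (le_of_lt hlam) hx
    · refine Eventually.of_forall fun x => tendsto_nhdsWithin_of_tendsto_nhds ?_
      have : Continuous fun lam : ℝ => Real.exp (-lam * x) := by fun_prop
      simpa using this.tendsto 0
  simp only [integral_const, probReal_univ, smul_eq_mul, mul_one] at h1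
  refine h1.congr' ?_
  filter_upwards [self_mem_nhdsWithin] with lam hlam using h.2.2 lam hlam

end Limits

/-! ### Beta mixtures -/

section BetaMixture

variable {a c : ℝ}

theorem integral_betaMeasure (ha : 0 < a) (hc : 0 < c) (f : ℝ → ℝ) :
    ∫ u, f u ∂betaMeasure a c =
      ∫ u in (0 : ℝ)..1, 1 / beta a c * (u ^ (a - 1) * (1 - u) ^ (c - 1)) * f u := by
  have hm : Measurable (betaPDF a c) := (measurable_betaPDFReal a c).ennreal_ofReal
  rw [betaMeasure, integral_withDensity_eq_integral_toReal_smul hm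
    (Eventually.of_forall fun _ => ENNReal.ofReal_lt_top),
    intervalIntegral.integral_of_le zero_le_one, integral_Ioc_eq_integral_Ioo,
    ← setIntegral_eq_integral_of_forall_compl_eq_zero (s := Ioo 0 1)]
  · refine setIntegral_congr_fun measurableSet_Ioo fun u hu => ?_
    have := betaPDFReal_pos hu.1 hu.2 ha hc
    simp only [betaPDF, smul_eq_mul]
    rw [ENNReal.toReal_ofReal this.le, betaPDFReal, if_pos ⟨hu.1, hu.2⟩]
    ring
  · intro u hu
    rw [betaPDF, betaPDFReal, if_neg (c := 0 < u ∧ u < 1) hu]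
    simp

theorem nullSingletonClass_betaMeasure (a c : ℝ) : NullSingletonClass (betaMeasure a c) :=
  ⟨fun x => withDensity_absolutelyContinuous _ _ (measure_singleton x)⟩

theorem ae_pos_betaMeasure (a c : ℝ) : ∀ᵐ u ∂betaMeasure a c, 0 < u := by
  have hm : Measurable (betaPDF a c) := (measurable_betaPDFReal a c).ennreal_ofReal
  rw [betaMeasure, ae_withDensity_iff hm]
  refine Eventually.of_forall fun u hu => ?_
  by_contra hcon
  exact hu (betaPDF_eq_zero_of_nonpos (not_lt.1 hcon))

/-- The law whose Laplace transform is `1 - λ^α (λ^γ + 1)^(-α/γ)`, mixed over a beta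
distributed fraction of time. -/
theorem HasLaplaceTransform.exists_beta_mixture {D : Measure ℝ} {α γ θ : ℝ} (hα : 0 < α)
    (hγ : 0 < γ) (hαγ : α / γ < 1) (hθ1 : θ < 1)
    (h : HasLaplaceTransform D fun lam => 1 - lam ^ α * (lam ^ γ + 1) ^ (-(α / γ))) :
    ∃ E, HasLaplaceTransform E (fun lam => 1 - lam ^ α / beta (1 - θ) (1 - α / γ) *
      ∫ u in (0 : ℝ)..1, (1 - u) ^ (-θ) * (u * lam ^ γ + 1) ^ (-(α / γ))) ∧
      ∀ x, E {x} = 0 := by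
  have hβ : 0 < α / γ := div_pos hα hγ
  -- The transform equals 1 - (1 + λ^{-γ})^{-α/γ} and vanishes at infinity, which excludes mass at
  -- 0.
  have h0 : D {0} = 0 := by
    refine h.measure_zero ?_
    have h1 : Tendsto (fun lam : ℝ => (1 + lam ^ (-γ)) ^ (-(α / γ))) atTop (𝓝 1) := by
      have := ((tendsto_rpow_neg_atTop hγ).const_add 1).rpow_const (p := -(α / γ)) (by simp)
      simpa using this
    have h2 := h1.const_sub 1
    rw [sub_self] at h2
    refine h2.congr' ?_
    filter_upwards [eventually_gt_atTop 0] with lam hlam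
    have h3 : lam ^ γ + 1 = lam ^ γ * (1 + lam ^ (-γ)) := by
      rw [mul_add, ← Real.rpow_add hlam]
      simp
    have h4 : 0 < 1 + lam ^ (-γ) := by positivity
    rw [h3, Real.mul_rpow (by positivity) h4.le, ← Real.rpow_mul hlam.le, ← mul_assoc,
      ← Real.rpow_add hlam]
    have : α + γ * -(α / γ) = 0 := by
      field_simp
      ring
    rw [this, Real.rpow_zero, one_mul]
  have hprob := isProbabilityMeasureBeta (sub_pos.2 hαγ) (sub_pos.2 hθ1)
  have hnull := nullSingletonClass_betaMeasure (1 - α / γ) (1 - θ)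
  -- Replacing λ by λu^{1/γ} produces the factor u^{α/γ}, which cancels u^{-α/γ} in the beta density
  -- and leaves the required integrand.
  obtain ⟨E, hE, hE0⟩ := h.exists_scale_mixture h0 (betaMeasure (1 - α / γ) (1 - θ))
    (ae_pos_betaMeasure _ _) (one_div_pos.2 hγ)
  refine ⟨E, hE.congr fun lam hlam => ?_, hE0⟩
  set g : ℝ → ℝ := fun u => lam ^ α * u ^ (α / γ) * (u * lam ^ γ + 1) ^ (-(α / γ))
  have hg : ∀ u, 0 < u → g u ∈ Icc (0 : ℝ) 1 := by
    intro u hu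
    have hl := Real.rpow_pos_of_pos hlam γ
    have h1 : lam ^ α * u ^ (α / γ) = (u * lam ^ γ) ^ (α / γ) := by
      rw [Real.mul_rpow hu.le hl.le, ← Real.rpow_mul hlam.le, mul_div_cancel₀ _ hγ.ne', mul_comm]
    simp only [g]
    refine ⟨by positivity, ?_⟩
    rw [h1, Real.rpow_neg (by positivity), ← div_eq_mul_inv, div_le_one (by positivity)]
    exact Real.rpow_le_rpow (by positivity) (by linarith) hβ.le
  have h1 : ∫ u, (1 - (lam * u ^ (1 / γ)) ^ α * ((lam * u ^ (1 / γ)) ^ γ + 1) ^ (-(α / γ)))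
      ∂betaMeasure (1 - α / γ) (1 - θ) = ∫ u, (1 - g u) ∂betaMeasure (1 - α / γ) (1 - θ) := by
    refine integral_congr_ae ?_
    filter_upwards [ae_pos_betaMeasure (1 - α / γ) (1 - θ)] with u hu
    have hu' := Real.rpow_nonneg hu.le (1 / γ)
    simp only [g]
    rw [Real.mul_rpow hlam.le hu', Real.mul_rpow hlam.le hu', ← Real.rpow_mul hu.le,
      ← Real.rpow_mul hu.le, one_div_mul_cancel hγ.ne', Real.rpow_one, one_div_mul_eq_div,
      mul_comm u]
  have hgm : Measurable g := by
    simp only [g]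
    fun_prop
  rw [h1, integral_sub (integrable_const 1)]
  · simp only [integral_const, probReal_univ, smul_eq_mul, mul_one]
    rw [integral_betaMeasure (sub_pos.2 hαγ) (sub_pos.2 hθ1), beta_comm (1 - θ),
      ← intervalIntegral.integral_const_mul]
    congr 1
    refine intervalIntegral.integral_congr_ae (Eventually.of_forall fun u hu => ?_)
    rw [uIoc_of_le zero_le_one] at hu
    have h2 : u ^ (1 - α / γ - 1) * u ^ (α / γ) = 1 := by
      rw [← Real.rpow_add hu.1]
      simp
    have h3 : (1 : ℝ) - θ - 1 = -θ := by ring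
    simp only [g]
    rw [h3]
    linear_combination (1 / beta (1 - α / γ) (1 - θ) * (1 - u) ^ (-θ) * lam ^ α *
      (u * lam ^ γ + 1) ^ (-(α / γ))) * h2
  · refine Integrable.of_bound (C := 1) hgm.aestronglyMeasurable ?_
    filter_upwards [ae_pos_betaMeasure (1 - α / γ) (1 - θ)] with u hu
    exact norm_le_one_of_mem_Icc (hg u hu)

end BetaMixture

/-! ### From exponents to probabilities -/

section Exponents

variable {ι : Type*} {l : Filter ι} {A B ε : ι → ℝ} {a c : ℝ}

theorem tendsto_one_sub_exp_neg_div (hε0 : Tendsto ε l (𝓝 0)) (hε : ∀ᶠ i in l, 0 < ε i)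
    (hA : Tendsto (fun i => A i / ε i) l (𝓝 a)) :
    Tendsto (fun i => (1 - Real.exp (-A i)) / ε i) l (𝓝 a) := by
  have hA0 : Tendsto (fun i => -A i) l (𝓝 0) := by
    have h := (hA.mul hε0).neg
    rw [mul_zero, neg_zero] at h
    refine h.congr' ?_
    filter_upwards [hε] with i hi
    rw [div_mul_cancel₀ _ hi.ne']
  have hs : Tendsto (fun i => dslope Real.exp 0 (-A i)) l (𝓝 1) := by
    have h := (continuousAt_dslope_same.2 (Real.differentiableAt_exp (x := 0))).tendsto.comp hA0
    simpa [dslope_same, Function.comp_def] using h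
  have h := hA.mul hs
  rw [mul_one] at h
  refine h.congr fun i => ?_
  have h2 := sub_smul_dslope Real.exp 0 (-A i)
  rw [Real.exp_zero, sub_zero, smul_eq_mul] at h2
  rw [div_mul_eq_mul_div]
  congr 1
  linear_combination -h2

theorem tendsto_of_tendsto_div {K : ℝ} (hε : Tendsto ε l (𝓝 K)) (hK : K ≠ 0)
    (hA : Tendsto (fun i => A i / ε i) l (𝓝 a)) : Tendsto A l (𝓝 (K * a)) := by
  have h := hA.mul hε
  rw [mul_comm a] at h
  refine h.congr' ?_
  filter_upwards [hε.eventually_ne hK] with i hi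
  rw [div_mul_cancel₀ _ hi]

end Exponents

theorem regularReproduction_of_slowlyVarying {μ γ α : ℝ} {p b : PMF ℕ} {L l : ℝ → ℝ}
    (hμ : 0 < μ) (hγ0 : 0 < γ) (hγ1 : γ ≤ 1) (hα0 : 0 < α)
    (hf : ∀ s, 0 ≤ s → s < 1 → pgf p s = s + (1 - s) ^ (γ + 1) * L (1 / (1 - s)))
    (hL : SlowlyVarying L)
    (hg : ∀ s, 0 ≤ s → s < 1 → pgf b s = 1 - (1 - s) ^ α * l (1 / (1 - s)))
    (hl : SlowlyVarying l) : RegularReproduction μ γ α p b where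
  rate_pos := hμ
  index_pos := hγ0
  index_pos' := hα0
  mean_le := lintegral_le_one_of_eventually (lt_pgf_of_slowlyVarying hf hL)
  lt_pgf := fun _ hs0 hs1 => lt_pgf_of_eventually (lt_pgf_of_slowlyVarying hf hL) hs0 hs1
  pgf_lt := pgf_lt_one_of_slowlyVarying hg hl
  V_regVar := (V_regVar_aux hγ0 hγ1 hf hL).1
  V_tendsto := (V_regVar_aux hγ0 hγ1 hf hL).2
  Psi_regVar := _root_.Psi_regVar hg hl

/-! ### Vanishing and finite positive limits of t r(t) q(t) -/

namespace ImmigrationModel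

variable {Ω : Type*} [MeasurableSpace Ω] {P : Measure Ω} [IsProbabilityMeasure P]
  {μ γ α θ : ℝ} {p b : PMF ℕ} {r LR : ℝ → ℝ}

theorem q_eq (M : ImmigrationModel P μ p b r) (hμ : 0 < μ) (t : ℝ) :
    M.q t = 1 - pgf b (treeGF (expMeasure μ) p t 0) := by
  rw [q, M.F_eq hμ]

theorem q_pos (M : ImmigrationModel P μ p b r) (h : RegularReproduction μ γ α p b) {t : ℝ}
    (ht : 0 ≤ t) : 0 < M.q t := by
  rw [M.q_eq h.rate_pos]
  exact h.pgf_compl_pos ht le_rfl one_pos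

/-- The limit law of one group of immigrants, conditioned on survival. -/
theorem exists_group_limit (M : ImmigrationModel P μ p b r) (h : RegularReproduction μ γ α p b) :
    ∃ D, HasLaplaceTransform D fun lam => 1 - lam ^ α * (lam ^ γ + 1) ^ (-(α / γ)) := by
  have hμ := h.rate_pos
  -- The law arises as a limit of conditional laws of an actual population, so no abstract
  -- characterisation of Laplace transforms is needed.
  refine Exists.imp (fun D hD => hD.1) (exists_conditional_limit (P := P) (l := atTop)
    (N := fun t ω => ∑ j ∈ Finset.range (M.I 0 ω), M.Z 0 j t ω) (c := fun t => W p (μ * t))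
    (φ := fun lam => 1 - lam ^ α * (lam ^ γ + 1) ^ (-(α / γ)))
    M.measurable_group (h.tendsto_W.eventually_gt_atTop 0) ?_ ?_ ?_)
  · filter_upwards [eventually_ge_atTop 0] with t ht
    rw [M.integral_pow_group hμ le_rfl zero_le_one]
    linarith [h.pgf_compl_pos ht le_rfl one_pos]
  · intro lam hlam
    have h1 := (h.tendsto_pgf_ratio hlam zero_le_one).const_sub 1
    simp only [mul_one, one_mul] at h1
    refine h1.congr' ?_
    filter_upwards [h.tendsto_W.eventually_gt_atTop 0] with t hW
    rw [M.integral_pow_group hμ le_rfl zero_le_one, M.integral_pow_group hμ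
      (exp_neg_div_mem hlam hW).1 (exp_neg_div_mem hlam hW).2.le]
  · have h1 : Tendsto (fun lam : ℝ => lam ^ α) (𝓝[>] 0) (𝓝 0) := by
      have := (Real.continuous_rpow_const h.index_pos'.le).tendsto 0
      rw [Real.zero_rpow h.index_pos'.ne'] at this
      exact tendsto_nhdsWithin_of_tendsto_nhds this
    have h2 : Tendsto (fun lam : ℝ => lam ^ γ) (𝓝[>] 0) (𝓝 0) := by
      have := (Real.continuous_rpow_const h.index_pos.le).tendsto 0
      rw [Real.zero_rpow h.index_pos.ne'] at this
      exact tendsto_nhdsWithin_of_tendsto_nhds this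
    have h3 := (h2.add_const 1).rpow_const (p := -(α / γ)) (by simp)
    simpa using (h1.mul h3).const_sub 1

theorem exists_survival_law (M : ImmigrationModel P μ p b r) (h : RegularReproduction μ γ α p b)
    (hαγ : α / γ < 1) (hθ1 : θ < 1) :
    ∃ D, HasLaplaceTransform D (fun lam => 1 - lam ^ α / beta (1 - θ) (1 - α / γ) *
      ∫ u in (0 : ℝ)..1, (1 - u) ^ (-θ) * (u * lam ^ γ + 1) ^ (-(α / γ))) ∧
      ∀ x, D {x} = 0 := by
  obtain ⟨D, hD⟩ := M.exists_group_limit h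
  exact hD.exists_beta_mixture h.index_pos' h.index_pos hαγ hθ1

/-- Convergence of the conditioned and normalised population, given an atomless candidate for
the limit law. -/
theorem conditional_limit (M : ImmigrationModel P μ p b r) (h : RegularReproduction μ γ α p b)
    (hr0 : ∀ t, 0 < t → 0 ≤ r t) (hrint : ∀ t, 0 < t → IntervalIntegrable r volume 0 t)
    {D : Measure ℝ} {φ : ℝ → ℝ} (hD : HasLaplaceTransform D φ) (hD0 : ∀ x, D {x} = 0)
    (hpos : ∀ᶠ t in atTop,
      0 < ∫ u in (0 : ℝ)..t, r u * (1 - pgf b (treeGF (expMeasure μ) p (t - u) 0)))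
    (hφ : ∀ lam, 0 < lam → Tendsto (fun t =>
      (1 - Real.exp (-∫ u in (0 : ℝ)..t, r u * (1 - pgf b (treeGF (expMeasure μ) p (t - u)
        (Real.exp (-lam / W p (μ * t))))))) /
      (1 - Real.exp (-∫ u in (0 : ℝ)..t, r u *
        (1 - pgf b (treeGF (expMeasure μ) p (t - u) 0))))) atTop (𝓝 (1 - φ lam))) (x : ℝ) :
    Tendsto (fun t => (P[|{ω | 0 < M.Y t ω}]).real {ω | (M.Y t ω : ℝ) / W p (μ * t) ≤ x})
      atTop (𝓝 (D.real (Iic x))) := by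
  -- The continuity theorem yields some law with transform φ. Uniqueness identifies it with the
  -- atomless `D`, so convergence holds at every x. The candidate also supplies the limit of φ at 0.
  refine Exists.elim (exists_conditional_limit (P := P) (l := atTop) (N := M.Y)
    (c := fun t => W p (μ * t)) (φ := φ)
    M.measurable_Y (h.tendsto_W.eventually_gt_atTop 0) ?_ ?_ hD.tendsto_one)
      fun E hE => hD.ext hE.1 (fun _ _ => rfl) ▸ hE.2 x (hD.ext hE.1 (fun _ _ => rfl) ▸ hD0 x)
  · filter_upwards [hpos, eventually_gt_atTop 0] with t ht ht0
    rw [M.integral_pow_Y h.mean_le h.rate_pos hr0 hrint ht0 le_rfl zero_le_one]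
    exact Real.exp_lt_one_iff.2 (neg_lt_zero.2 ht)
  · intro lam hlam
    have h1 := (hφ lam hlam).const_sub 1
    rw [sub_sub_cancel] at h1
    refine h1.congr' ?_
    filter_upwards [h.tendsto_W.eventually_gt_atTop 0, eventually_gt_atTop 0] with t hW ht0
    rw [M.integral_pow_Y h.mean_le h.rate_pos hr0 hrint ht0 le_rfl zero_le_one,
      M.integral_pow_Y h.mean_le h.rate_pos hr0 hrint ht0 (exp_neg_div_mem hlam hW).1
        (exp_neg_div_mem hlam hW).2.le]

theorem eventually_rate_pos (M : ImmigrationModel P μ p b r) (h : RegularReproduction μ γ α p b)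
    (hr : ∀ᶠ t in atTop, r t = t ^ (-θ) * LR t) (hLR : SlowlyVarying LR) :
    ∀ᶠ t in atTop, 0 < t * r t * M.q t := by
  filter_upwards [eventually_gt_atTop 0, hLR.eventually_intensity_pos hr] with t ht hrt
  exact mul_pos (mul_pos ht hrt) (M.q_pos h ht.le)

theorem eventually_exponent_pos (M : ImmigrationModel P μ p b r)
    (h : RegularReproduction μ γ α p b) (hθ0 : 0 ≤ θ) (hθ1 : θ < 1) (hαγ : α / γ < 1)
    (hr0 : ∀ t, 0 < t → 0 ≤ r t) (hrint : ∀ t, 0 < t → IntervalIntegrable r volume 0 t)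
    (hr : ∀ᶠ t in atTop, r t = t ^ (-θ) * LR t) (hLR : SlowlyVarying LR) :
    ∀ᶠ t in atTop,
      0 < ∫ u in (0 : ℝ)..t, r u * (1 - pgf b (treeGF (expMeasure μ) p (t - u) 0)) := by
  have h1 := h.tendsto_exponent_zero hθ0 hθ1 hαγ hr0 hrint hr hLR
  filter_upwards [M.eventually_rate_pos h hr hLR,
    h1.eventually (lt_mem_nhds (beta_pos (sub_pos.2 hθ1) (sub_pos.2 hαγ)))] with t ht1 ht2
  rw [M.q_eq h.rate_pos] at ht1
  exact (div_pos_iff_of_pos_right ht1).1 ht2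

/-- Both exponents tend to 0, so 1 - e^{-A} may be replaced by A, and the common scale t r(t) q(t)
cancels from the quotient. -/
theorem subcritical_limit (M : ImmigrationModel P μ p b r) (h : RegularReproduction μ γ α p b)
    (hθ0 : 0 ≤ θ) (hθ1 : θ < 1) (hαγ : α / γ < 1)
    (hr0 : ∀ t, 0 < t → 0 ≤ r t) (hrint : ∀ t, 0 < t → IntervalIntegrable r volume 0 t)
    (hr : ∀ᶠ t in atTop, r t = t ^ (-θ) * LR t) (hLR : SlowlyVarying LR)
    (hq : Tendsto (fun t => t * r t * M.q t) atTop (𝓝 0)) :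
    ∃ D : Measure ℝ,
      HasLaplaceTransform D (fun lam => 1 - lam ^ α / beta (1 - θ) (1 - α / γ) *
        ∫ u in (0 : ℝ)..1, (1 - u) ^ (-θ) * (u * lam ^ γ + 1) ^ (-(α / γ))) ∧
      ∀ x : ℝ, Tendsto (fun t => (P[|{ω | 0 < M.Y t ω}]).real
        {ω | (M.Y t ω : ℝ) / W p (μ * t) ≤ x}) atTop (𝓝 (D.real (Iic x))) := by
  obtain ⟨D, hD, hD0⟩ := M.exists_survival_law h hαγ hθ1
  refine ⟨D, hD, M.conditional_limit h hr0 hrint hD hD0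
    (M.eventually_exponent_pos h hθ0 hθ1 hαγ hr0 hrint hr hLR) fun lam hlam => ?_⟩
  have hε := M.eventually_rate_pos h hr hLR
  have hB := beta_pos (sub_pos.2 hθ1) (sub_pos.2 hαγ)
  simp only [M.q_eq h.rate_pos] at hq hε
  have h1 := tendsto_one_sub_exp_neg_div hq hε
    (h.tendsto_exponent hθ0 hθ1 hαγ hr0 hrint hr hLR hlam)
  have h2 := tendsto_one_sub_exp_neg_div hq hε
    (h.tendsto_exponent_zero hθ0 hθ1 hαγ hr0 hrint hr hLR)
  have h3 := h1.div h2 hB.ne'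
  rw [sub_sub_cancel, div_mul_eq_mul_div]
  refine h3.congr' ?_
  filter_upwards [hε] with t ht
  exact div_div_div_cancel_right₀ ht.ne' _ _

/-- t r(t) q(t) varies regularly with index 1 - θ - α/γ, and a positive finite limit forces the
index 0. Comparing times t and 2t suffices. -/
theorem index_eq_of_tendsto (M : ImmigrationModel P μ p b r) (h : RegularReproduction μ γ α p b)
    (hr : ∀ᶠ t in atTop, r t = t ^ (-θ) * LR t) (hLR : SlowlyVarying LR) {K : ℝ} (hK : 0 < K)
    (hq : Tendsto (fun t => t * r t * M.q t) atTop (𝓝 K)) : α / γ = 1 - θ := by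
  have h2 : (0 : ℝ) < 2 := two_pos
  have h1 := (hq.comp (tendsto_id.const_mul_atTop h2)).div hq hK.ne'
  have h3 := ((hLR.intensity_ratio hr 2 h2).mul (h.pgf_regVar 2 h2)).const_mul 2
  have h4 : (2 : ℝ) * (2 ^ (-θ) * 2 ^ (-(α / γ))) = K / K := by
    refine tendsto_nhds_unique h3 (h1.congr' ?_)
    filter_upwards [eventually_gt_atTop 0, M.eventually_rate_pos h hr hLR,
      hLR.eventually_intensity_pos hr] with t ht ht2 hrt
    have hqt := M.q_pos h ht.le
    simp only [Function.comp_def, id, ← M.q_eq h.rate_pos, Pi.div_apply]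
    field_simp
  rw [div_self hK.ne', ← Real.rpow_add h2] at h4
  nth_rewrite 1 [← Real.rpow_one 2] at h4
  rw [← Real.rpow_add h2] at h4
  have h5 := congrArg Real.log h4
  rw [Real.log_rpow h2, Real.log_one, mul_eq_zero] at h5
  have := h5.resolve_right (Real.log_pos one_lt_two).ne'
  linarith

/-- The surviving groups become Poisson with mean K B(θ, 1-θ), each contributing according to the
law of the vanishing regime; conditioning on Y > 0 leaves the zero-truncated compound Poisson law.
-/
theorem critical_limit (M : ImmigrationModel P μ p b r) (h : RegularReproduction μ γ α p b)
    (hθ0 : 0 ≤ θ) (hθ1 : θ < 1) (hαγ : α / γ < 1)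
    (hr0 : ∀ t, 0 < t → 0 ≤ r t) (hrint : ∀ t, 0 < t → IntervalIntegrable r volume 0 t)
    (hr : ∀ᶠ t in atTop, r t = t ^ (-θ) * LR t) (hLR : SlowlyVarying LR) {K : ℝ} (hK : 0 < K)
    (hq : Tendsto (fun t => t * r t * M.q t) atTop (𝓝 K)) :
    ∃ D : Measure ℝ,
      HasLaplaceTransform D (fun lam => 1 - (1 - Real.exp (-(K * lam ^ α *
        ∫ u in (0 : ℝ)..1, (1 - u) ^ (-θ) * (u * lam ^ γ + 1) ^ (-(1 - θ))))) /
          (1 - Real.exp (-(K * beta θ (1 - θ))))) ∧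
      ∀ x : ℝ, Tendsto (fun t => (P[|{ω | 0 < M.Y t ω}]).real
        {ω | (M.Y t ω : ℝ) / W p (μ * t) ≤ x}) atTop (𝓝 (D.real (Iic x))) := by
  have hβ := M.index_eq_of_tendsto h hr hLR hK hq
  have hB := beta_pos (sub_pos.2 hθ1) (sub_pos.2 hαγ)
  have hBeq : beta (1 - θ) (1 - α / γ) = beta θ (1 - θ) := by
    rw [hβ, sub_sub_cancel, beta_comm]
  have hKB : 0 < K * beta θ (1 - θ) := mul_pos hK (hBeq ▸ hB)
  have hexp : 1 - Real.exp (-(K * beta θ (1 - θ))) ≠ 0 :=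
    (sub_pos.2 (Real.exp_lt_one_iff.2 (neg_lt_zero.2 hKB))).ne'
  obtain ⟨D₁, hD₁, hna⟩ := M.exists_survival_law h hαγ hθ1
  obtain ⟨D, hD, hD0⟩ := hD₁.exists_compound_poisson hna hKB
  have hD' := hD.congr (φ' := fun lam => 1 - (1 - Real.exp (-(K * lam ^ α *
        ∫ u in (0 : ℝ)..1, (1 - u) ^ (-θ) * (u * lam ^ γ + 1) ^ (-(1 - θ))))) /
          (1 - Real.exp (-(K * beta θ (1 - θ))))) fun lam hlam => by
    rw [hBeq, hβ]
    set J := ∫ u in (0 : ℝ)..1, (1 - u) ^ (-θ) * (u * lam ^ γ + 1) ^ (-(1 - θ))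
    have hb : beta θ (1 - θ) ≠ 0 := (hBeq ▸ hB).ne'
    have e1 : K * beta θ (1 - θ) * (1 - lam ^ α / beta θ (1 - θ) * J) =
        K * beta θ (1 - θ) + -(K * lam ^ α * J) := by
      field_simp
      ring
    have e2 : Real.exp (K * beta θ (1 - θ)) - 1 ≠ 0 :=
      (sub_pos.2 (Real.one_lt_exp_iff.2 hKB)).ne'
    rw [e1, Real.exp_add]
    rw [Real.exp_neg (K * beta θ (1 - θ))] at hexp ⊢
    have e3 := Real.exp_ne_zero (K * beta θ (1 - θ))
    rw [eq_sub_iff_add_eq]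
    field_simp
    ring
  refine ⟨D, hD', M.conditional_limit h hr0 hrint hD' hD0
    (M.eventually_exponent_pos h hθ0 hθ1 hαγ hr0 hrint hr hLR) fun lam hlam => ?_⟩
  simp only [M.q_eq h.rate_pos] at hq
  have h1 := tendsto_of_tendsto_div hq hK.ne'
    (h.tendsto_exponent hθ0 hθ1 hαγ hr0 hrint hr hLR hlam)
  have h2 := tendsto_of_tendsto_div hq hK.ne'
    (h.tendsto_exponent_zero hθ0 hθ1 hαγ hr0 hrint hr hLR)
  rw [hBeq] at h2
  rw [hβ, ← mul_assoc] at h1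
  rw [sub_sub_cancel]
  exact (((Real.continuous_exp.tendsto _).comp h1.neg).const_sub 1).div
    (((Real.continuous_exp.tendsto _).comp h2.neg).const_sub 1) hexp

end ImmigrationModel

/-! ### The diverging regime -/

section Stable

variable {μ γ α θ lam : ℝ} {p b : PMF ℕ} {r LR : ℝ → ℝ}

/-- 1 - g(F(v;s)) decreases with the age v, because V of the reciprocal of 1 - F grows linearly in
v. Replacing every age by t or by 0 gives the two bounds. -/
theorem RegularReproduction.exponent_bounds (h : RegularReproduction μ γ α p b)
    (hr0 : ∀ t, 0 < t → 0 ≤ r t) (hrint : ∀ t, 0 < t → IntervalIntegrable r volume 0 t)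
    {t s : ℝ} (ht : 0 < t) (hs0 : 0 ≤ s) (hs1 : s < 1) :
    (∫ u in (0 : ℝ)..t, r u) / Psi b (survivalInv μ p t s) ≤
        ∫ u in (0 : ℝ)..t, r u * (1 - pgf b (treeGF (expMeasure μ) p (t - u) s)) ∧
      ∫ u in (0 : ℝ)..t, r u * (1 - pgf b (treeGF (expMeasure μ) p (t - u) s)) ≤
        (∫ u in (0 : ℝ)..t, r u) / Psi b (1 / (1 - s)) := by
  have hz := one_le_one_div_one_sub hs0 hs1
  have hX : ∀ v, 0 ≤ v → 1 ≤ survivalInv μ p v s := fun v hv => h.one_le_survivalInv hv hs0 hs1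
  have hle : ∀ {x y : ℝ}, 1 ≤ x → 1 ≤ y → V p x ≤ V p y → 1 / Psi b y ≤ 1 / Psi b x := by
    intro x y hx hy hV
    exact one_div_le_one_div_of_le (Psi_pos h.pgf_lt hx) (Psi_monotoneOn h.pgf_lt hx hy
      (((V_strictMonoOn h.lt_pgf).le_iff_le hx hy).1 hV))
  have hint : IntervalIntegrable (fun u => r u * (1 - pgf b (treeGF (expMeasure μ) p (t - u) s)))
      volume 0 t := by
    rw [intervalIntegrable_iff]
    refine ((intervalIntegrable_iff.1 (hrint t ht)).bdd_mul (c := 1)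
      ((h.measurable_pgf_compl s).comp
        ((measurable_const (a := t)).sub measurable_id)).aestronglyMeasurable ?_).congr ?_
    · exact Eventually.of_forall fun u => norm_le_one_of_mem_Icc (h.pgf_compl_mem hs0 hs1.le)
    · exact Eventually.of_forall fun u => mul_comm _ _
  constructor
  · rw [← intervalIntegral.integral_div]
    refine intervalIntegral.integral_mono_on_of_le_Ioo ht.le ((hrint t ht).div_const _) hint
      fun u hu => ?_
    rw [div_eq_mul_one_div, RegularReproduction.one_sub_pgf_treeGF]
    have hu' : 0 ≤ t - u := sub_nonneg.2 hu.2.le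
    refine mul_le_mul_of_nonneg_left (hle (hX _ hu') (hX _ ht.le) ?_) (hr0 u hu.1)
    rw [h.V_survivalInv hu' hs0 hs1, h.V_survivalInv ht.le hs0 hs1]
    have := mul_pos h.rate_pos hu.1
    linarith
  · rw [← intervalIntegral.integral_div]
    refine intervalIntegral.integral_mono_on_of_le_Ioo ht.le hint ((hrint t ht).div_const _)
      fun u hu => ?_
    rw [div_eq_mul_one_div, RegularReproduction.one_sub_pgf_treeGF]
    have hu' : 0 ≤ t - u := sub_nonneg.2 hu.2.le
    refine mul_le_mul_of_nonneg_left (hle hz (hX _ hu') ?_) (hr0 u hu.1)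
    rw [h.V_survivalInv hu' hs0 hs1]
    have := mul_nonneg h.rate_pos.le hu'
    linarith

/-- Write z = 1/(1-s). By the choice of scale Ψ(z) ~ λ^{-α}R(t), while Karamata's theorem gives
R(t)/Ψ(W(μt)) → ∞. Hence z dominates W(μt), V(z) dominates μt, and the reciprocal y at age t, with
V(y) = μt + V(z), satisfies y ~ z. The bounds for ages t and 0 then share the limit λ^α. -/
theorem RegularReproduction.tendsto_exponent_stable (h : RegularReproduction μ γ α p b)
    (hθ0 : 0 ≤ θ) (hθ1 : θ < 1)
    (hr0 : ∀ t, 0 < t → 0 ≤ r t) (hrint : ∀ t, 0 < t → IntervalIntegrable r volume 0 t)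
    (hr : ∀ᶠ t in atTop, r t = t ^ (-θ) * LR t) (hLR : SlowlyVarying LR)
    (hq : Tendsto (fun t => t * r t * (1 - pgf b (treeGF (expMeasure μ) p t 0))) atTop atTop)
    (hlam : 0 < lam) :
    Tendsto (fun t => ∫ u in (0 : ℝ)..t, r u * (1 - pgf b (treeGF (expMeasure μ) p (t - u)
      (Real.exp (-lam / PsiInv b (∫ u in (0 : ℝ)..t, r u)))))) atTop (𝓝 (lam ^ α)) := by
  set R : ℝ → ℝ := fun t => ∫ u in (0 : ℝ)..t, r u
  set x : ℝ → ℝ := fun t => PsiInv b (R t)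
  set z : ℝ → ℝ := fun t => 1 / (1 - Real.exp (-lam / x t))
  set y : ℝ → ℝ := fun t => survivalInv μ p t (Real.exp (-lam / x t))
  have hR : Tendsto R atTop atTop := hLR.tendsto_integral_atTop hθ0 hθ1 hr0 hrint hr
  have hx : Tendsto x atTop atTop := (PsiInv_tendsto_atTop h.pgf_lt).comp hR
  have hs : ∀ᶠ t in atTop, 0 ≤ Real.exp (-lam / x t) ∧ Real.exp (-lam / x t) < 1 := by
    filter_upwards [hx.eventually_gt_atTop 0] with t ht using exp_neg_div_mem hlam ht
  have hxR : ∀ᶠ t in atTop, Psi b (x t) = R t := by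
    filter_upwards [hR.eventually_ge_atTop (Psi b 1)] with t ht using (Psi_PsiInv h.pgf_lt ht).2
  have hz1 : ∀ᶠ t in atTop, 1 ≤ z t := by
    filter_upwards [hs] with t ht using one_le_one_div_one_sub ht.1 ht.2
  have hy1 : ∀ᶠ t in atTop, 1 ≤ y t := by
    filter_upwards [hs, eventually_ge_atTop 0] with t ht ht0
    exact h.one_le_survivalInv ht0 ht.1 ht.2
  have hzx : Tendsto (fun t => z t / x t) atTop (𝓝 lam⁻¹) := tendsto_one_div_one_sub_exp hx hlam
  have hPmono := Psi_monotoneOn h.pgf_lt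
  have hlam' : 0 < lam⁻¹ := inv_pos.2 hlam
  have hPzR : Tendsto (fun t => Psi b (z t) / R t) atTop (𝓝 (lam⁻¹ ^ α)) := by
    refine (h.Psi_regVar.tendsto_ratio hPmono h.Psi_eventually_pos hlam' hx hzx).congr' ?_
    filter_upwards [hxR] with t ht
    rw [ht]
  have hz : Tendsto z atTop atTop := by
    refine (hzx.pos_mul_atTop hlam' hx).congr' ?_
    filter_upwards [hx.eventually_gt_atTop 0] with t ht
    rw [div_mul_cancel₀ _ ht.ne']
  have hRq : Tendsto (fun t => R t * (1 / Psi b (survivalInv μ p t 0))) atTop atTop := by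
    refine ((hLR.karamata hθ0 hθ1 hr0 hrint hr).pos_mul_atTop (integral_one_sub_rpow_pos hθ1)
      hq).congr' ?_
    filter_upwards [eventually_gt_atTop 0, hLR.eventually_intensity_pos hr] with t ht hrt
    rw [RegularReproduction.one_sub_pgf_treeGF]
    simp only [R]
    field_simp
  have hPz : Tendsto (fun t => Psi b (z t) / Psi b (survivalInv μ p t 0)) atTop atTop := by
    refine (hPzR.pos_mul_atTop (Real.rpow_pos_of_pos hlam' α) hRq).congr' ?_
    filter_upwards [hR.eventually_gt_atTop 0] with t ht
    field_simp
  have hzX := h.Psi_regVar.tendsto_arg_ratio_atTop hPmono h.Psi_eventually_pos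
    h.tendsto_survivalInv hz1 hPz
  have hVz := h.V_regVar.tendsto_ratio_atTop h.index_pos h.V_monotoneOn h.V_eventually_pos
    h.tendsto_survivalInv hzX
  have hVy : Tendsto (fun t => V p (y t) / V p (z t)) atTop (𝓝 (1 ^ γ)) := by
    have h1 := hVz.inv_tendsto_atTop.const_add 1
    rw [add_zero] at h1
    rw [Real.one_rpow]
    refine h1.congr' ?_
    filter_upwards [hs, eventually_gt_atTop 0, hz.eventually h.V_eventually_pos] with t ht ht0 hVt
    simp only [Pi.inv_apply, inv_div, y]
    rw [h.V_survivalInv ht0.le ht.1 ht.2, h.V_survivalInv_zero ht0.le]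
    change 1 + μ * t / V p (z t) = (μ * t + V p (z t)) / V p (z t)
    field_simp
    ring
  have hyz := h.V_regVar.tendsto_arg_ratio h.index_pos h.V_monotoneOn h.V_eventually_pos one_pos
    hz hy1 hVy
  have hPy := h.Psi_regVar.tendsto_ratio hPmono h.Psi_eventually_pos one_pos hz hyz
  have hup : Tendsto (fun t => R t / Psi b (z t)) atTop (𝓝 (lam ^ α)) := by
    have h1 := hPzR.inv₀ (Real.rpow_pos_of_pos hlam' α).ne'
    rw [Real.inv_rpow hlam.le, inv_inv] at h1
    simpa only [inv_div] using h1
  have hlow : Tendsto (fun t => R t / Psi b (y t)) atTop (𝓝 (lam ^ α)) := by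
    have h1 := hup.mul (hPy.inv₀ (by simp))
    rw [Real.one_rpow, inv_one, mul_one] at h1
    refine h1.congr' ?_
    filter_upwards [hz1, hy1] with t h2 h3
    have := Psi_pos h.pgf_lt h2
    have := Psi_pos h.pgf_lt h3
    field_simp
  refine tendsto_of_tendsto_of_tendsto_of_le_of_le' hlow hup ?_ ?_
  · filter_upwards [hs, eventually_gt_atTop 0] with t ht ht0
    exact (h.exponent_bounds hr0 hrint ht0 ht.1 ht.2).1
  · filter_upwards [hs, eventually_gt_atTop 0] with t ht ht0
    exact (h.exponent_bounds hr0 hrint ht0 ht.1 ht.2).2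

theorem ImmigrationModel.supercritical_limit {Ω : Type*} [MeasurableSpace Ω] {P : Measure Ω}
    [IsProbabilityMeasure P] (M : ImmigrationModel P μ p b r)
    (h : RegularReproduction μ γ α p b) (hα1 : α < 1) (hθ0 : 0 ≤ θ) (hθ1 : θ < 1)
    (hr0 : ∀ t, 0 < t → 0 ≤ r t) (hrint : ∀ t, 0 < t → IntervalIntegrable r volume 0 t)
    (hr : ∀ᶠ t in atTop, r t = t ^ (-θ) * LR t) (hLR : SlowlyVarying LR)
    (hq : Tendsto (fun t => t * r t * M.q t) atTop atTop) :
    ∃ D : Measure ℝ, HasLaplaceTransform D (fun lam => Real.exp (-(lam ^ α))) ∧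
      ∀ x : ℝ, Tendsto (fun t => P.real {ω | (M.Y t ω : ℝ) / PsiInv b (∫ u in (0 : ℝ)..t, r u) ≤ x})
        atTop (𝓝 (D.real (Iic x))) := by
  simp only [M.q_eq h.rate_pos] at hq
  have hx : Tendsto (fun t => PsiInv b (∫ u in (0 : ℝ)..t, r u)) atTop atTop :=
    (PsiInv_tendsto_atTop h.pgf_lt).comp (hLR.tendsto_integral_atTop hθ0 hθ1 hr0 hrint hr)
  have h1 : ∀ lam : ℝ, 0 < lam → Tendsto (fun t => ∫ ω, Real.exp (-lam /
      PsiInv b (∫ u in (0 : ℝ)..t, r u)) ^ M.Y t ω ∂P) atTop (𝓝 (Real.exp (-(lam ^ α)))) := by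
    intro lam hlam
    refine ((Real.continuous_exp.tendsto _).comp
      (h.tendsto_exponent_stable hθ0 hθ1 hr0 hrint hr hLR hq hlam).neg).congr' ?_
    filter_upwards [eventually_gt_atTop 0, hx.eventually_gt_atTop 0] with t ht hxt
    exact (M.integral_pow_Y h.mean_le h.rate_pos hr0 hrint ht (exp_neg_div_mem hlam hxt).1
      (exp_neg_div_mem hlam hxt).2.le).symm
  have h2 : Tendsto (fun lam : ℝ => Real.exp (-(lam ^ α))) (𝓝[>] 0) (𝓝 1) := by
    have hc : Continuous fun lam : ℝ => Real.exp (-(lam ^ α)) :=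
      Real.continuous_exp.comp (Real.continuous_rpow_const h.index_pos'.le).neg
    have := hc.tendsto 0
    simp only [Real.zero_rpow h.index_pos'.ne', neg_zero, Real.exp_zero] at this
    exact tendsto_nhdsWithin_of_tendsto_nhds this
  obtain ⟨D, hD, hlim⟩ := exists_limit_of_tendsto_integral_pow (Q := fun _ => P) (N := M.Y)
    (Eventually.of_forall fun _ => inferInstance) M.measurable_Y (hx.eventually_gt_atTop 0) h1 h2
  exact ⟨D, hD, fun x => hlim x (hD.stable_noAtoms h.index_pos' hα1 x)⟩

end Stable

/-! ### The limit theorem -/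

theorem theorem5p5 {Ω : Type*} [MeasurableSpace Ω] (P : Measure Ω) [IsProbabilityMeasure P]
    (θ α γ μ : ℝ) (r LR L l : ℝ → ℝ) (p b : PMF ℕ)
    (hμ : 0 < μ) (hθ0 : 0 < θ) (hθ1 : θ < 1)
    (hγ0 : 0 < γ) (hγ1 : γ ≤ 1) (hα0 : 0 < α) (hα1 : α ≤ 1) (hαγ : α / γ < 1)
    -- the intensity `r(t) = t^{-θ} L_R(t)` of the Poisson process, with finite mean measure
    (hr_nonneg : ∀ t, 0 < t → 0 ≤ r t)
    (hr_int : ∀ t, 0 < t → IntervalIntegrable r volume 0 t)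
    (hr : ∀ t, 0 < t → r t = t ^ (-θ) * LR t) (hLR : SlowlyVarying LR)
    -- the offspring generating function `f`
    (hf : ∀ s, 0 ≤ s → s < 1 → pgf p s = s + (1 - s) ^ (γ + 1) * L (1 / (1 - s)))
    (hL : SlowlyVarying L)
    -- the generating function `g` of the immigrants
    (hg : ∀ s, 0 ≤ s → s < 1 → pgf b s = 1 - (1 - s) ^ α * l (1 / (1 - s)))
    (hl : SlowlyVarying l)
    (M : ImmigrationModel P μ p b r) :
    (Tendsto (fun t => t * r t * M.q t) atTop (𝓝 0) →
      ∃ D₁ : Measure ℝ,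
        HasLaplaceTransform D₁ (fun lam =>
          1 - lam ^ α / beta (1 - θ) (1 - α / γ) *
            ∫ u in (0 : ℝ)..1, (1 - u) ^ (-θ) * (u * lam ^ γ + 1) ^ (-(α / γ))) ∧
        ∀ x : ℝ, 0 ≤ x →
          Tendsto (fun t => (P[|{ω | 0 < M.Y t ω}]).real {ω | (M.Y t ω : ℝ) / W p (μ * t) ≤ x})
            atTop (𝓝 (D₁.real (Iic x)))) ∧
    (∀ K : ℝ, 0 < K → Tendsto (fun t => t * r t * M.q t) atTop (𝓝 K) →
      ∃ D₂ : Measure ℝ,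
        HasLaplaceTransform D₂ (fun lam =>
          1 - (1 - Real.exp (-(K * lam ^ α *
              ∫ u in (0 : ℝ)..1, (1 - u) ^ (-θ) * (u * lam ^ γ + 1) ^ (-(1 - θ))))) /
            (1 - Real.exp (-(K * beta θ (1 - θ))))) ∧
        ∀ x : ℝ, 0 ≤ x →
          Tendsto (fun t => (P[|{ω | 0 < M.Y t ω}]).real {ω | (M.Y t ω : ℝ) / W p (μ * t) ≤ x})
            atTop (𝓝 (D₂.real (Iic x)))) ∧
    (Tendsto (fun t => t * r t * M.q t) atTop atTop →
      ∃ D₃ : Measure ℝ,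
        HasLaplaceTransform D₃ (fun lam => Real.exp (-(lam ^ α))) ∧
        ∀ x : ℝ, 0 ≤ x →
          Tendsto (fun t => P.real {ω | (M.Y t ω : ℝ) / PsiInv b (∫ u in (0 : ℝ)..t, r u) ≤ x})
            atTop (𝓝 (D₃.real (Iic x)))) := by
  have h : RegularReproduction μ γ α p b :=
    regularReproduction_of_slowlyVarying hμ hγ0 hγ1 hα0 hf hL hg hl
  have hr' : ∀ᶠ t in atTop, r t = t ^ (-θ) * LR t := by
    filter_upwards [eventually_gt_atTop 0] with t ht using hr t ht
  -- The strict inequality α < γ ≤ 1 keeps the third limit away from the degenerate case α = 1,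
  -- where it would be a point mass.
  have hα : α < 1 := ((div_lt_one hγ0).1 hαγ).trans_le hγ1
  refine ⟨fun hq => ?_, fun K hK hq => ?_, fun hq => ?_⟩
  · obtain ⟨D, hD, hlim⟩ :=
      M.subcritical_limit h hθ0.le hθ1 hαγ hr_nonneg hr_int hr' hLR hq
    exact ⟨D, hD, fun x _ => hlim x⟩
  · obtain ⟨D, hD, hlim⟩ :=
      M.critical_limit h hθ0.le hθ1 hαγ hr_nonneg hr_int hr' hLR hK hq
    exact ⟨D, hD, fun x _ => hlim x⟩
  · obtain ⟨D, hD, hlim⟩ :=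
      M.supercritical_limit h hα hθ0.le hθ1 hr_nonneg hr_int hr' hLR hq
    exact ⟨D, hD, fun x _ => hlim x⟩
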